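/- **Setting.** Let $\widehat\phi:[0,\infty)\to\mathbb R$ (the radial profile of the Fourier transform of the interaction potential) be bounded and continuous, with $\sup_{r\ge0} r|\widehat\phi(r)|<\infty$ and $2\pi\int_0^\infty r^3|\widehat\phi(r)|^2\,dr=1$. For $\varepsilon>0$ put $$\Phi^\varepsilon(r,\rho)=\varepsilon^{-4}\big(\widehat\phi(r/\varepsilon)+\widehat\phi(\rho/\varepsilon)\big)^2 .$$ For $x,y,z\ge0$ let $x_*=(y+z-x)_+$; write $a\wedge b=\min\{a,b\}$, $a\vee b=\max\{a,b\}$. Define $W_\Phi(x,y,z)$ as follows. If $x,x_*,y,z>0$, $$W_\Phi(x,y,z)=\frac{4\pi}{\sqrt{xyz}}\int_{|\sqrt x-\sqrt y|\vee|\sqrt{x_*}-\sqrt z|}^{(\sqrt x+\sqrt y)\wedge(\sqrt{x_*}+\sqrt z)}\!ds\int_0^{2\pi}\Phi(\sqrt2\,s,\sqrt2\,Y_*)\,d\theta ,$$ where $Y_*=\Big|\sqrt{\big(z-\tfrac{(x-y+s^2)^2}{4s^2}\big)_+}+e^{i\theta}\sqrt{\big(x-\tfrac{(x-y+s^2)^2}{4s^2}\big)_+}\Big|$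 for $s>0$ and $Y_*=0$ for $s=0$. Further $W_\Phi=\frac{(4\pi)^2}{\sqrt{yz}}\Phi(\sqrt{2y},\sqrt{2z})$ if $x=0$, $y,z>0$; $W_\Phi=\frac{(4\pi)^2}{\sqrt{xz}}\Phi(\sqrt{2x},\sqrt{2(z-x)})$ if $y=0$, $z>x>0$; $W_\Phi=\frac{(4\pi)^2}{\sqrt{xy}}\Phi(\sqrt{2(y-x)},\sqrt{2x})$ if $z=0$, $y>x>0$; and $W_\Phi=0$ otherwise. Let $C_c^2(\mathbb R_{\ge0})$ be the set of $C^2$ functions on $[0,\infty)$ (one-sided derivatives at $0$) with compact support in $[0,\infty)$. For such $\varphi$ set $$\mathcal K^\varepsilon[\varphi](x,y,z)=W_{\Phi^\varepsilon}(x,y,z)\big(\varphi(x)+\varphi(x_*)-\varphi(y)-\varphi(z)\big),\qquad \mathcal J^\varepsilon[\varphi](y,z)=\frac12\int_0^{y+z}\mathcal K^\varepsilon[\varphi](x,y,z)\sqrt x\,dx,$$ $$L[\varphi](x,y)=\frac{4\pi}{\sqrt{x\vee y}}\Big(\frac23\big(\varphi''(x)+\varphi''(y)\big)(x\wedge y)-\big(\varphi'(x)-\varphi'(y)\big)\,\mathrm{sgn}(x-y)\Big),\qquad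 L[\varphi](0,0)=0 .$$ Let $\mathcal B_1^+(\mathbb R_{\ge0})$ be the set of positive Borel measures $F$ on $[0,\infty)$ with $\int(1+x)\,dF(x)<\infty$. A family $\{F_t\}_{t\ge0}\subset\mathcal B_1^+(\mathbb R_{\ge0})$ is a *measure-valued isotropic weak solution of the Bose–Einstein equation* with parameter $\varepsilon$ if $\int 1\,dF_t$ and $\int x\,dF_t$ do not depend on $t\ge0$ and, for every $\varphi\in C_c^2(\mathbb R_{\ge0})$, the function $t\mapsto\int\varphi\,dF_t$ is in $C^1([0,\infty))$ with $$\frac{d}{dt}\int\varphi\,dF_t=\int\mathcal J^\varepsilon[\varphi]\,d(F_t\otimes F_t)+\varepsilon^3\int\mathcal K^\varepsilon[\varphi]\,d(F_t\otimes F_t\otimes F_t)\qquad\forall\,t\ge0 .$$ It is a *measure-valued isotropic weak solution of the Fokker–Planck–Landau (FPL) equation* if the same holds with right-hand side $\int L[\varphi]\,d(F_t\otimes F_t)$. **Theorem.** Let $\varepsilon_0>0$, and for each $\varepsilon\in(0,\varepsilon_0]$ let $\{F_t^\varepsilon\}_{t\ge0}$ be a measure-valued isotropic weak solution of the Bose–Einstein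 equation with parameter $\varepsilon$, such that $\sup_{0<\varepsilon\le\varepsilon_0}\int(1+x)\,dF_0^\varepsilon(x)<\infty$. (a) For every sequence $(\varepsilon_n)\subset(0,\varepsilon_0]$ with $\varepsilon_n\to0$ there are a subsequence, still denoted $(\varepsilon_n)$, and a measure-valued isotropic weak solution $\{F_t\}_{t\ge0}$ of the FPL equation such that for every $t\ge0$ $$\lim_{n\to\infty}\int\psi\,dF_t^{\varepsilon_n}=\int\psi\,dF_t\quad\forall\,\psi\in C_c(\mathbb R_{\ge0}),$$ $$\lim_{n\to\infty}\int\mathcal J^{\varepsilon_n}[\varphi]\,d(F_t^{\varepsilon_n}\otimes F_t^{\varepsilon_n})=\int L[\varphi]\,d(F_t\otimes F_t)\quad\forall\,\varphi\in C_c^2(\mathbb R_{\ge0}).$$ In particular the initial datum $F_0$ of the limit is the weak limit of the initial data $F_0^{\varepsilon_n}$; if the $F_0^{\varepsilon_n}$ are all equal to one measure, then $F_0$ is that measure. (b) For every $\varphi\in C_c^2(\mathbb R_{\ge0})$ there is a constant $C$ such that $\big|\varepsilon^3\int\mathcal K^\varepsilon[\varphi]\,d(F_t^\varepsilon\otimes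 F_t^\varepsilon\otimes F_t^\varepsilon)\big|\le C\varepsilon$ for all $\varepsilon\in(0,\varepsilon_0]$ and $t\ge0$; consequently, for every $t\ge0$, this cubic term tends to $0$ as $\varepsilon\to0^+$. -/

import Mathlib

open MeasureTheory Set Filter Topology
open scoped NNReal

noncomputable section

namespace QuantumBoltzmann

/-- Assumptions on the (real, radial) Fourier transform `φhat` of the interaction potential,
viewed as a function of the radius `r ≥ 0`; its values at negative reals are never used. -/
structure IsAdmissible (φhat : ℝ → ℝ) : Prop where
  continuousOn : ContinuousOn φhat (Ici 0)
  bounded : ∃ C : ℝ, ∀ r : ℝ, 0 ≤ r → |φhat r| ≤ C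
  decay : ∃ A : ℝ, ∀ r : ℝ, 0 ≤ r → r * |φhat r| ≤ A
  normalized : 2 * Real.pi * ∫ r in Ioi (0 : ℝ), r ^ 3 * |φhat r| ^ 2 = 1

/-- The test functions `C_c^2(ℝ_{≥0})`: twice continuously differentiable on `[0, ∞)` (one-sided
at `0`), with compact support in `[0, ∞)`. Values at negative reals are never used. -/
structure IsTestFunction (φ : ℝ → ℝ) : Prop where
  contDiffOn : ContDiffOn ℝ 2 φ (Ici 0)
  compactSupport : ∃ R : ℝ, ∀ x : ℝ, R ≤ x → φ x = 0

/-- First derivative on `[0, ∞)`, one-sided at `0`. -/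
def d1 (φ : ℝ → ℝ) : ℝ → ℝ := derivWithin φ (Ici 0)

/-- Second derivative on `[0, ∞)`, one-sided at `0`. -/
def d2 (φ : ℝ → ℝ) : ℝ → ℝ := derivWithin (d1 φ) (Ici 0)

/-- The energy `x_* = (y + z - x)_+`. -/
def xStar (x y z : ℝ) : ℝ := max (y + z - x) 0

/-- The function `Y_*(x, y, z, s, θ)`. -/
def yStar (x y z s θ : ℝ) : ℝ :=
  if 0 < s then
    ‖((Real.sqrt (max (z - (x - y + s ^ 2) ^ 2 / (4 * s ^ 2)) 0) : ℝ) : ℂ) +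
      Complex.exp (Complex.I * (θ : ℂ)) *
        ((Real.sqrt (max (x - (x - y + s ^ 2) ^ 2 / (4 * s ^ 2)) 0) : ℝ) : ℂ)‖
  else 0

/-- The function `W_Φ(x, y, z)` for `x, y, z ≥ 0`. -/
def W (Φ : ℝ → ℝ → ℝ) (x y z : ℝ) : ℝ :=
  if 0 < xStar x y z ∧ 0 < x ∧ 0 < y ∧ 0 < z then
    4 * Real.pi / Real.sqrt (x * y * z) *
      ∫ s in (max |Real.sqrt x - Real.sqrt y| |Real.sqrt (xStar x y z) - Real.sqrt z|)..(min
          (Real.sqrt x + Real.sqrt y) (Real.sqrt (xStar x y z) + Real.sqrt z)),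
        ∫ θ in (0 : ℝ)..(2 * Real.pi), Φ (Real.sqrt 2 * s) (Real.sqrt 2 * yStar x y z s θ)
  else if x = 0 ∧ 0 < y ∧ 0 < z then
    (4 * Real.pi) ^ 2 / Real.sqrt (y * z) * Φ (Real.sqrt (2 * y)) (Real.sqrt (2 * z))
  else if y = 0 ∧ 0 < x ∧ x < z then
    (4 * Real.pi) ^ 2 / Real.sqrt (x * z) * Φ (Real.sqrt (2 * x)) (Real.sqrt (2 * (z - x)))
  else if z = 0 ∧ 0 < x ∧ x < y then
    (4 * Real.pi) ^ 2 / Real.sqrt (x * y) * Φ (Real.sqrt (2 * (y - x))) (Real.sqrt (2 * x))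
  else 0

/-- The Bose–Einstein scattering function
`Φ^ε(r, ρ) = ε⁻⁴ (φhat(r/ε) + φhat(ρ/ε))²`. The collision kernel of the equation is
`B^ε(v - v_*, ω) = |(v - v_*) · ω| Φ^ε(|v - v'|, |v - v_*'|)`. -/
def PhiBE (φhat : ℝ → ℝ) (ε r ρ : ℝ) : ℝ :=
  1 / ε ^ 4 * (φhat (r / ε) + φhat (ρ / ε)) ^ 2

/-- The cubic kernel `K^ε[φ](x, y, z)` for `x, y, z ≥ 0`. -/
def K (φhat : ℝ → ℝ) (ε : ℝ) (φ : ℝ → ℝ) (x y z : ℝ) : ℝ :=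
  W (PhiBE φhat ε) x y z * (φ x + φ (xStar x y z) - φ y - φ z)

/-- The quadratic kernel `J^ε[φ](y, z)` for `y, z ≥ 0`. -/
def J (φhat : ℝ → ℝ) (ε : ℝ) (φ : ℝ → ℝ) (y z : ℝ) : ℝ :=
  1 / 2 * ∫ x in (0 : ℝ)..(y + z), K φhat ε φ x y z * Real.sqrt x

/-- The isotropic Fokker–Planck–Landau kernel `L[φ](x, y)` for `x, y ≥ 0`; at the origin the
division by `√0 = 0` gives `L[φ](0, 0) = 0`, its continuous extension. -/
def L (φ : ℝ → ℝ) (x y : ℝ) : ℝ :=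
  4 * Real.pi / Real.sqrt (max x y) *
    (2 / 3 * (d2 φ x + d2 φ y) * min x y - (d1 φ x - d1 φ y) * Real.sign (x - y))

/-- The integral `∫ Ψ(y, z) dF(y) dF(z)`. -/
def integral2 (Ψ : ℝ → ℝ → ℝ) (F : Measure ℝ≥0) : ℝ :=
  ∫ p : ℝ≥0 × ℝ≥0, Ψ p.1 p.2 ∂(F.prod F)

/-- The integral `∫ Ψ(x, y, z) dF(x) dF(y) dF(z)`. -/
def integral3 (Ψ : ℝ → ℝ → ℝ → ℝ) (F : Measure ℝ≥0) : ℝ :=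
  ∫ p : ℝ≥0 × ℝ≥0 × ℝ≥0, Ψ p.1 p.2.1 p.2.2 ∂(F.prod (F.prod F))

/-- The class `B_1^+(ℝ_{≥0})` of positive finite Borel measures with finite first moment. -/
structure MemB1 (F : Measure ℝ≥0) : Prop where
  finite : IsFiniteMeasure F
  moment : Integrable (fun x : ℝ≥0 => (x : ℝ)) F

/-- `F_t`, `t ≥ 0`, takes values in `B_1^+` and conserves mass and energy. -/
structure Conserves (F : ℝ → Measure ℝ≥0) : Prop where
  mem : ∀ t : ℝ, 0 ≤ t → MemB1 (F t)
  mass : ∀ t : ℝ, 0 ≤ t → F t univ = F 0 univ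
  energy : ∀ t : ℝ, 0 ≤ t → ∫ x : ℝ≥0, (x : ℝ) ∂(F t) = ∫ x : ℝ≥0, (x : ℝ) ∂(F 0)

/-- Measure-valued isotropic weak solutions of the Bose–Einstein equation. Only `t ≥ 0` matters;
the time derivative at `t = 0` is one-sided. -/
structure IsBESolution (φhat : ℝ → ℝ) (ε : ℝ) (F : ℝ → Measure ℝ≥0) : Prop where
  conserves : Conserves F
  contDiff : ∀ φ : ℝ → ℝ, IsTestFunction φ →
    ContDiffOn ℝ 1 (fun t => ∫ x : ℝ≥0, φ x ∂(F t)) (Ici 0)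
  equation : ∀ φ : ℝ → ℝ, IsTestFunction φ → ∀ t : ℝ, 0 ≤ t →
    HasDerivWithinAt (fun t => ∫ x : ℝ≥0, φ x ∂(F t))
      (integral2 (J φhat ε φ) (F t) + ε ^ 3 * integral3 (K φhat ε φ) (F t)) (Ici 0) t

/-- Measure-valued isotropic weak solutions of the Fokker–Planck–Landau equation. Only `t ≥ 0`
matters; the time derivative at `t = 0` is one-sided. -/
structure IsFPLSolution (F : ℝ → Measure ℝ≥0) : Prop where
  conserves : Conserves F
  contDiff : ∀ φ : ℝ → ℝ, IsTestFunction φ →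
    ContDiffOn ℝ 1 (fun t => ∫ x : ℝ≥0, φ x ∂(F t)) (Ici 0)
  equation : ∀ φ : ℝ → ℝ, IsTestFunction φ → ∀ t : ℝ, 0 ≤ t →
    HasDerivWithinAt (fun t => ∫ x : ℝ≥0, φ x ∂(F t)) (integral2 (L φ) (F t)) (Ici 0) t

end QuantumBoltzmann

end

/-! The kernel `W` is an integral over momentum transfers. With u = s² and w = Y_*², the angle θ
turns into an arcsine density in w, and W = 4π/√(xyz) ∬ Φ(√(2u), √(2w)) G^(-1/2) du dw over the
quadrant, where G = `gram` is a concave quadratic in w and also in x (`W_eq_integral_gram`). Hence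
`J` can be computed by integrating over x first, again against an arcsine density. Writing u = qv
and w = q(1 - v) expresses `J` through `collisionRate` (`integral_collision`, `IsAdmissible.J_eq`).

In these variables the weak coupling limit is a concentration phenomenon. With p = q/ε² the
scattering function contributes p²(φhat(√(2pv)) + φhat(√(2p(1 - v))))² dv. Multiplied by v, the
first square is a density whose mass tends to 1/(4π), by the normalization of φhat, and which
concentrates at v = 0: only grazing collisions survive. The angular average of the gain of the test
function vanishes linearly at v = 0, with slope π `gainSlope`, and is symmetric under v → 1 - v. The
two squares therefore contribute equally and the interference term is negligible
(`IsAdmissible.rate_estimate`). Integrating `gainSlope`/q explicitly over the remaining variable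
gives the numerator of `L` (`landauNumerator_eq_integral`). The outcome is |J - L| ≤ δ(1 + y)(1 + z)
for all small ε (`IsAdmissible.eventually_abs_J_sub_L_le`).

For the cubic term, the decay of r φhat(r) bounds each square by a multiple of ε⁻² r⁻², so the
kernel is singular like 1/|x - y|. The gain vanishes on x = y and on x = z, which suffices when the
two largest energies are comparable. If two energies are small compared with the third, exchanging
the small ones produces a second difference at the large energy. The cyclic sum of `K` is thus
O(ε⁻²) (`IsAdmissible.abs_sum_K_le`), and the factor ε³ leaves O(ε) times the cube of the mass.

Finally, measures with ∫(1 + x) ≤ M form a weakly compact set, and the two bounds make the curves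
uniformly Lipschitz in time against test functions. A diagonal argument gives convergence at all
times, and the integrated equation passes to the limit by dominated convergence. Mass passes to the
limit by tightness. Energy may drop in the limit, so its conservation is derived from the limit
equation with dilated test functions (`energy_conserved`). -/

noncomputable section

namespace QuantumBoltzmann

/-! ### Calculus of test functions on the half line: bounds, modulus of continuity, Taylor and
second-difference estimates. -/

section TestFunctions

variable {φ : ℝ → ℝ}

theorem IsTestFunction.hasDeriv_d1 (h : IsTestFunction φ) {x : ℝ} (hx : 0 ≤ x) :
    HasDerivWithinAt φ (d1 φ x) (Ici 0) x :=
  ((h.contDiffOn.differentiableOn (by norm_num)) x hx).hasDerivWithinAt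

theorem IsTestFunction.contDiffOn_d1 (h : IsTestFunction φ) : ContDiffOn ℝ 1 (d1 φ) (Ici 0) :=
  h.contDiffOn.derivWithin (uniqueDiffOn_Ici 0) (by norm_num)

theorem IsTestFunction.hasDeriv_d2 (h : IsTestFunction φ) {x : ℝ} (hx : 0 ≤ x) :
    HasDerivWithinAt (d1 φ) (d2 φ x) (Ici 0) x :=
  ((h.contDiffOn_d1.differentiableOn (by norm_num)) x hx).hasDerivWithinAt

theorem IsTestFunction.continuousOn_d2 (h : IsTestFunction φ) : ContinuousOn (d2 φ) (Ici 0) :=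
  h.contDiffOn_d1.continuousOn_derivWithin (uniqueDiffOn_Ici 0) (by norm_num)

theorem IsTestFunction.continuousOn_d1 (h : IsTestFunction φ) : ContinuousOn (d1 φ) (Ici 0) :=
  h.contDiffOn_d1.continuousOn

theorem IsTestFunction.continuousOn (h : IsTestFunction φ) : ContinuousOn φ (Ici 0) :=
  h.contDiffOn.continuousOn

theorem derivWithin_Ici_eq_zero {f : ℝ → ℝ} {R x : ℝ} (hf : ∀ x, R < x → f x = 0) (hx : R < x) :
    derivWithin f (Ici 0) x = 0 := by
  have : f =ᶠ[𝓝[Ici 0] x] fun _ => 0 := by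
    filter_upwards [mem_nhdsWithin_of_mem_nhds (Ioi_mem_nhds hx)] with y hy using hf y hy
  rw [this.derivWithin_eq (hf x hx)]
  simp

theorem IsTestFunction.exists_radius (h : IsTestFunction φ) :
    ∃ R : ℝ, 0 < R ∧ ∀ x, R < x → φ x = 0 ∧ d1 φ x = 0 ∧ d2 φ x = 0 := by
  obtain ⟨R, hR⟩ := h.compactSupport
  have h0 : ∀ x, max R 1 < x → φ x = 0 := fun x hx => hR x ((le_max_left _ _).trans hx.le)
  have h1 : ∀ x, max R 1 < x → d1 φ x = 0 := fun x hx => derivWithin_Ici_eq_zero h0 hx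
  exact ⟨max R 1, by positivity, fun x hx => ⟨h0 x hx, h1 x hx, derivWithin_Ici_eq_zero h1 hx⟩⟩

theorem hasCompactSupport_of_eq_zero {f : ℝ → ℝ} {R : ℝ} (hR : ∀ x, R < x → f x = 0) :
    HasCompactSupport (fun x : ℝ≥0 => f x) := by
  refine HasCompactSupport.intro (isCompact_Icc (a := 0) (b := R.toNNReal)) fun x hx => hR _ ?_
  have : R.toNNReal < x := by
    by_contra! hc
    exact hx ⟨zero_le, hc⟩
  exact (Real.le_coe_toNNReal R).trans_lt (NNReal.coe_lt_coe.2 this)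

theorem continuous_restrict {f : ℝ → ℝ} (hf : ContinuousOn f (Ici 0)) :
    Continuous (fun x : ℝ≥0 => f x) :=
  hf.comp_continuous NNReal.continuous_coe fun x => x.2

theorem exists_bound_of_eq_zero {f : ℝ → ℝ} {R : ℝ} (hf : ContinuousOn f (Ici 0))
    (hR : ∀ x, R < x → f x = 0) : ∃ C, ∀ x, 0 ≤ x → |f x| ≤ C := by
  obtain ⟨C, hC⟩ := (hasCompactSupport_of_eq_zero hR).exists_bound_of_continuous
    (continuous_restrict hf)
  exact ⟨C, fun x hx => hC ⟨x, hx⟩⟩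

theorem IsTestFunction.exists_bound (h : IsTestFunction φ) :
    ∃ B : ℝ, 0 < B ∧ ∀ x, 0 ≤ x → |φ x| ≤ B ∧ |d1 φ x| ≤ B ∧ |d2 φ x| ≤ B := by
  obtain ⟨R, -, hR⟩ := h.exists_radius
  obtain ⟨C0, h0⟩ := exists_bound_of_eq_zero h.continuousOn fun x hx => (hR x hx).1
  obtain ⟨C1, h1⟩ := exists_bound_of_eq_zero h.continuousOn_d1 fun x hx => (hR x hx).2.1
  obtain ⟨C2, h2⟩ := exists_bound_of_eq_zero h.continuousOn_d2 fun x hx => (hR x hx).2.2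
  refine ⟨max 1 (max C0 (max C1 C2)), by positivity, fun x hx => ⟨?_, ?_, ?_⟩⟩
  · exact (h0 x hx).trans (by simp)
  · exact (h1 x hx).trans (by simp)
  · exact (h2 x hx).trans (by simp)

/-- Uniform continuity of `d2 φ` handles nearby points, and 2B ≤ (2B/δ²)(ξ - x)² handles distant
ones. A modulus polynomial in ξ - x can be averaged over collisions using only a bound on the
squared displacement. -/
theorem IsTestFunction.exists_modulus (h : IsTestFunction φ) {τ : ℝ} (hτ : 0 < τ) :
    ∃ C : ℝ, 0 ≤ C ∧ ∀ x ξ, 0 ≤ x → 0 ≤ ξ → |d2 φ ξ - d2 φ x| ≤ τ + C * (ξ - x) ^ 2 := by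
  obtain ⟨B, hB, hb⟩ := h.exists_bound
  obtain ⟨R, -, hR⟩ := h.exists_radius
  have huc := (hasCompactSupport_of_eq_zero fun x hx => (hR x hx).2.2).uniformContinuous_of_continuous
    (continuous_restrict h.continuousOn_d2)
  obtain ⟨δ, hδ, hd⟩ := Metric.uniformContinuous_iff.1 huc τ hτ
  refine ⟨2 * B / δ ^ 2, by positivity, fun x ξ hx hξ => ?_⟩
  by_cases hlt : |ξ - x| < δ
  · lift x to ℝ≥0 using hx
    lift ξ to ℝ≥0 using hξ
    have := hd (a := ξ) (b := x) (by rw [NNReal.dist_eq]; exact hlt)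
    rw [Real.dist_eq] at this
    have h2 : 0 ≤ 2 * B / δ ^ 2 * (ξ - x) ^ 2 := by positivity
    change |d2 φ ξ - d2 φ x| < τ at this
    linarith
  · have h1 : δ ^ 2 ≤ (ξ - x) ^ 2 := by
      rw [← sq_abs (ξ - x)]
      exact pow_le_pow_left₀ hδ.le (not_lt.1 hlt) 2
    have h2 : 2 * B ≤ 2 * B / δ ^ 2 * (ξ - x) ^ 2 := by
      rw [div_mul_eq_mul_div, le_div_iff₀ (by positivity)]
      gcongr
    have h3 := abs_sub (d2 φ ξ) (d2 φ x)
    have := (hb ξ hξ).2.2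
    have := (hb x hx).2.2
    linarith

theorem mvt_uIcc {f f' : ℝ → ℝ} {C x y : ℝ} (hx : 0 ≤ x) (hy : 0 ≤ y)
    (hf : ∀ t, 0 ≤ t → HasDerivWithinAt f (f' t) (Ici 0) t)
    (hC : ∀ t ∈ uIcc y x, |f' t| ≤ C) : |f x - f y| ≤ C * |x - y| := by
  have hsub : uIcc y x ⊆ Ici 0 := fun t ht => (le_min hy hx).trans ht.1
  exact (convex_uIcc y x).norm_image_sub_le_of_norm_hasDerivWithin_le
    (fun t ht => (hf t (hsub ht)).mono hsub) hC left_mem_uIcc right_mem_uIcc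

theorem IsTestFunction.taylor_two (h : IsTestFunction φ) {x y ω : ℝ} (hx : 0 ≤ x) (hy : 0 ≤ y)
    (hω : ∀ t ∈ uIcc y x, |d2 φ t - d2 φ y| ≤ ω) :
    |φ x - φ y - d1 φ y * (x - y) - d2 φ y * (x - y) ^ 2 / 2| ≤ ω * (x - y) ^ 2 := by
  have hω0 : 0 ≤ ω := (abs_nonneg _).trans (hω y left_mem_uIcc)
  have hsub : uIcc y x ⊆ Ici 0 := fun t ht => (le_min hy hx).trans ht.1
  have step : ∀ t ∈ uIcc y x, |d1 φ t - d1 φ y - d2 φ y * (t - y)| ≤ ω * |x - y| := by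
    intro t ht
    have h1 := mvt_uIcc (f := fun t => d1 φ t - d2 φ y * (t - y)) (f' := fun t => d2 φ t - d2 φ y)
      (C := ω) (x := t) (y := y) (hsub ht) hy (fun s hs => by
        exact ((h.hasDeriv_d2 hs).sub
          ((((hasDerivAt_id s).sub_const y).const_mul (d2 φ y)).hasDerivWithinAt)).congr_deriv
            (by simp))
      (fun s hs => hω s (uIcc_subset_uIcc left_mem_uIcc ht hs))
    have h2 : |t - y| ≤ |x - y| := by
      rw [abs_sub_comm, abs_sub_comm x]
      exact abs_sub_left_of_mem_uIcc ht |>.trans_eq' (by rw [abs_sub_comm]) |>.trans_eq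
        (by rw [abs_sub_comm])
    calc _ = |(d1 φ t - d2 φ y * (t - y)) - (d1 φ y - d2 φ y * (y - y))| := by congr 1; ring
      _ ≤ _ := h1.trans (by gcongr)
  have h1 := mvt_uIcc (f := fun t => φ t - d1 φ y * (t - y) - d2 φ y * (t - y) ^ 2 / 2)
    (f' := fun t => d1 φ t - d1 φ y - d2 φ y * (t - y)) hx hy (fun s hs => by
      have e1 := ((((hasDerivAt_id s).sub_const y).const_mul (d1 φ y)).hasDerivWithinAt
        (s := Ici 0))
      have e2 := (((((hasDerivAt_id s).sub_const y).pow 2).const_mul (d2 φ y)).div_const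
        2).hasDerivWithinAt (s := Ici 0)
      refine (((h.hasDeriv_d1 hs).sub e1).sub e2).congr_deriv ?_
      simp
      ring) step
  calc _ = |(φ x - d1 φ y * (x - y) - d2 φ y * (x - y) ^ 2 / 2) -
        (φ y - d1 φ y * (y - y) - d2 φ y * (y - y) ^ 2 / 2)| := by congr 1; ring
    _ ≤ _ := h1
    _ = _ := by rw [mul_assoc, ← sq, sq_abs]

theorem IsTestFunction.d1_lipschitz (h : IsTestFunction φ) {B : ℝ}
    (hB : ∀ x, 0 ≤ x → |d2 φ x| ≤ B) {x y : ℝ} (hx : 0 ≤ x) (hy : 0 ≤ y) :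
    |d1 φ x - d1 φ y| ≤ B * |x - y| :=
  mvt_uIcc hx hy (fun _ ht => h.hasDeriv_d2 ht) fun t ht => hB t ((le_min hy hx).trans ht.1)

/-- The expression is the increment from y to x of t ↦ φ(t) - φ(t + z - x), whose derivative is at
most B|x - z| because `d1 φ` is B-Lipschitz. -/
theorem IsTestFunction.abs_second_difference_le (h : IsTestFunction φ) {B : ℝ}
    (hB : ∀ x, 0 ≤ x → |d2 φ x| ≤ B) {x y z : ℝ} (hx : 0 ≤ x) (hy : 0 ≤ y) (hz : 0 ≤ z)
    (hs : x ≤ y + z) :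
    |φ x + φ (y + z - x) - φ y - φ z| ≤ B * |x - z| * |x - y| := by
  have hsub : uIcc y x ⊆ Ici 0 := fun t ht => (le_min hy hx).trans ht.1
  have hsub' : ∀ t ∈ uIcc y x, 0 ≤ t + (z - x) := fun t ht => by
    have h1 : min y x ≤ t := ht.1
    rcases min_choice y x with h2 | h2 <;> linarith
  have := (convex_uIcc y x).norm_image_sub_le_of_norm_hasDerivWithin_le
    (f := fun t => φ t - φ (t + (z - x))) (f' := fun t => d1 φ t - d1 φ (t + (z - x)))
    (C := B * |x - z|) (x := y) (y := x)
    (fun t ht => by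
      refine ((h.hasDeriv_d1 (hsub ht)).mono hsub).sub ?_
      have h1 := (h.hasDeriv_d1 (hsub' t ht)).comp t
        (((hasDerivAt_id t).add_const (z - x)).hasDerivWithinAt (s := uIcc y x)) hsub'
      exact h1.congr_deriv (by simp))
    (fun t ht => by
      refine (h.d1_lipschitz hB (hsub ht) (hsub' t ht)).trans_eq ?_
      congr 2
      ring)
    left_mem_uIcc right_mem_uIcc
  refine le_trans (le_of_eq ?_) this
  rw [Real.norm_eq_abs]
  congr 1
  have e1 : x + (z - x) = z := by ring
  have e2 : y + (z - x) = y + z - x := by ring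
  simp only [e1, e2]
  ring

end TestFunctions

/-! ### Bounds and continuity of the Fokker–Planck–Landau kernel. -/

section LandauKernel

variable {φ : ℝ → ℝ}

theorem abs_sign_le_one (r : ℝ) : |Real.sign r| ≤ 1 := by
  rcases Real.sign_apply_eq r with h | h | h <;> rw [h] <;> norm_num

/-- The numerator of the Fokker–Planck–Landau kernel. -/
def landauNumerator (φ : ℝ → ℝ) (x y : ℝ) : ℝ :=
  2 / 3 * (d2 φ x + d2 φ y) * min x y - (d1 φ x - d1 φ y) * Real.sign (x - y)

theorem L_eq (φ : ℝ → ℝ) (x y : ℝ) :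
    L φ x y = 4 * Real.pi / Real.sqrt (max x y) * landauNumerator φ x y := rfl

theorem IsTestFunction.abs_landauNumerator_le (h : IsTestFunction φ) {B : ℝ}
    (hB : ∀ x, 0 ≤ x → |d2 φ x| ≤ B) {x y : ℝ} (hx : 0 ≤ x) (hy : 0 ≤ y) :
    |landauNumerator φ x y| ≤ 3 * B * max x y := by
  have hB0 : 0 ≤ B := (abs_nonneg _).trans (hB 0 le_rfl)
  have h1 : |2 / 3 * (d2 φ x + d2 φ y) * min x y| ≤ 2 / 3 * (B + B) * max x y := by
    rw [abs_mul, abs_mul, abs_of_nonneg (le_min hx hy)]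
    gcongr
    · norm_num
    · exact (abs_add_le _ _).trans (add_le_add (hB x hx) (hB y hy))
    · exact min_le_max
  have h2 : |(d1 φ x - d1 φ y) * Real.sign (x - y)| ≤ B * max x y * 1 := by
    rw [abs_mul]
    gcongr
    · refine (h.d1_lipschitz hB hx hy).trans ?_
      gcongr
      rcases le_total x y with hxy | hxy
      · rw [abs_of_nonpos (by linarith)]; linarith [le_max_right x y]
      · rw [abs_of_nonneg (by linarith)]; linarith [le_max_left x y]
    · exact abs_sign_le_one _
  have h3 := abs_sub (2 / 3 * (d2 φ x + d2 φ y) * min x y) ((d1 φ x - d1 φ y) * Real.sign (x - y))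
  have h4 : 0 ≤ B * max x y := mul_nonneg hB0 (hx.trans (le_max_left _ _))
  unfold landauNumerator
  linarith

theorem IsTestFunction.abs_L_le_sqrt (h : IsTestFunction φ) {B : ℝ}
    (hB : ∀ x, 0 ≤ x → |d2 φ x| ≤ B) {x y : ℝ} (hx : 0 ≤ x) (hy : 0 ≤ y) :
    |L φ x y| ≤ 12 * Real.pi * B * Real.sqrt (max x y) := by
  have hm : 0 ≤ max x y := hx.trans (le_max_left _ _)
  rcases hm.eq_or_lt with h0 | h0
  · simp [L_eq, ← h0]
  have hs := Real.sqrt_pos.2 h0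
  rw [L_eq, abs_mul, abs_of_nonneg (by positivity), div_mul_eq_mul_div, div_le_iff₀ hs,
    mul_assoc _ (√_), Real.mul_self_sqrt hm]
  have := mul_le_mul_of_nonneg_left (h.abs_landauNumerator_le hB hx hy) Real.pi_pos.le
  linarith

/-- The √max bound covers max ≤ 1. Beyond that, `d2 φ` vanishes past a radius R, so `d2 φ u * min u
v` is at most BR even when the other energy is large. -/
theorem IsTestFunction.exists_L_bound (h : IsTestFunction φ) :
    ∃ C : ℝ, 0 ≤ C ∧ ∀ x y, 0 ≤ x → 0 ≤ y → |L φ x y| ≤ C := by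
  obtain ⟨B, hB0, hb⟩ := h.exists_bound
  obtain ⟨R, hR0, hR⟩ := h.exists_radius
  have hB : ∀ x, 0 ≤ x → |d2 φ x| ≤ B := fun x hx => (hb x hx).2.2
  refine ⟨12 * Real.pi * B + 4 * Real.pi * (2 * B * R + 2 * B), by positivity,
    fun x y hx hy => ?_⟩
  have hpi := Real.pi_pos
  rcases le_total (max x y) 1 with hm | hm
  · have h1 := h.abs_L_le_sqrt hB hx hy
    have h2 : 12 * Real.pi * B * √(max x y) ≤ 12 * Real.pi * B * 1 := by
      gcongr
      exact Real.sqrt_le_one.2 hm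
    have : 0 ≤ 4 * Real.pi * (2 * B * R + 2 * B) := by positivity
    linarith
  · have key : ∀ u v, 0 ≤ u → 0 ≤ v → |d2 φ u * min u v| ≤ B * R := fun u v hu hv => by
      by_cases huR : R < u
      · rw [(hR u huR).2.2]; simp; positivity
      · rw [abs_mul, abs_of_nonneg (le_min hu hv)]
        exact mul_le_mul (hB u hu) ((min_le_left _ _).trans (not_lt.1 huR)) (le_min hu hv) hB0.le
    have hN : |landauNumerator φ x y| ≤ 2 * B * R + 2 * B := by
      have h1 := key x y hx hy
      have h2 := key y x hy hx
      have h3 : |(d1 φ x - d1 φ y) * Real.sign (x - y)| ≤ (B + B) * 1 := by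
        rw [abs_mul]
        gcongr
        · exact (abs_sub _ _).trans (add_le_add (hb x hx).2.1 (hb y hy).2.1)
        · exact abs_sign_le_one _
      have e : landauNumerator φ x y = 2 / 3 * (d2 φ x * min x y) + 2 / 3 * (d2 φ y * min y x) -
          (d1 φ x - d1 φ y) * Real.sign (x - y) := by
        rw [landauNumerator, min_comm y x]; ring
      rw [e]
      rw [abs_le] at h1 h2 h3 ⊢
      have : 0 ≤ B * R := by positivity
      constructor <;> linarith [h1.1, h1.2, h2.1, h2.2, h3.1, h3.2]
    have h1 : (1 : ℝ) ≤ √(max x y) := Real.one_le_sqrt.2 hm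
    rw [L_eq, abs_mul, abs_of_nonneg (by positivity)]
    have h4 : 4 * Real.pi / √(max x y) ≤ 4 * Real.pi := div_le_self (by positivity) h1
    have := mul_le_mul h4 hN (abs_nonneg _) (by positivity)
    have : 0 ≤ 12 * Real.pi * B := by positivity
    linarith

/-- The jump of the sign sits on the diagonal, where the factor d1 φ x - d1 φ y vanishes. The
product is a continuous gluing of two expressions. -/
theorem IsTestFunction.continuous_landauNumerator (h : IsTestFunction φ) :
    Continuous fun p : ℝ≥0 × ℝ≥0 => landauNumerator φ p.1 p.2 := by
  have c1 := continuous_restrict h.continuousOn_d1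
  have c2 := continuous_restrict h.continuousOn_d2
  have e : (fun p : ℝ≥0 × ℝ≥0 => landauNumerator φ p.1 p.2) = fun p : ℝ≥0 × ℝ≥0 =>
      2 / 3 * (d2 φ p.1 + d2 φ p.2) * min (p.1 : ℝ) p.2 -
      if (p.2 : ℝ) ≤ p.1 then d1 φ p.1 - d1 φ p.2 else d1 φ p.2 - d1 φ p.1 := by
    funext p
    unfold landauNumerator
    congr 1
    rcases lt_trichotomy (p.1 : ℝ) p.2 with hl | hl | hl
    · rw [Real.sign_of_neg (by linarith), if_neg (not_le.2 hl)]; ring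
    · rw [hl]; simp
    · rw [Real.sign_of_pos (by linarith), if_pos hl.le]; ring
  rw [e]
  refine Continuous.sub ?_ ?_
  · have := c2.comp (continuous_fst (X := ℝ≥0) (Y := ℝ≥0))
    have := c2.comp (continuous_snd (X := ℝ≥0) (Y := ℝ≥0))
    simp only [Function.comp_def] at *
    fun_prop
  · have k1 := c1.comp (continuous_fst (X := ℝ≥0) (Y := ℝ≥0))
    have k2 := c1.comp (continuous_snd (X := ℝ≥0) (Y := ℝ≥0))
    exact Continuous.if_le (k1.sub k2) (k2.sub k1) (by fun_prop) (by fun_prop)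
      fun p hp => by simp [hp]

theorem IsTestFunction.continuous_L (h : IsTestFunction φ) :
    Continuous fun p : ℝ≥0 × ℝ≥0 => L φ p.1 p.2 := by
  obtain ⟨B, hB0, hb⟩ := h.exists_bound
  rw [continuous_iff_continuousAt]
  intro p
  have cm : Continuous fun p : ℝ≥0 × ℝ≥0 => √(max (p.1 : ℝ) p.2) := by fun_prop
  have hm0 : 0 ≤ max (p.1 : ℝ) p.2 := p.1.2.trans (le_max_left _ _)
  rcases hm0.eq_or_lt with h0 | h0
  · have e : L φ p.1 p.2 = 0 := by simp [L_eq, ← h0]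
    rw [ContinuousAt, e]
    refine squeeze_zero_norm (a := fun p : ℝ≥0 × ℝ≥0 => 12 * Real.pi * B * √(max (p.1 : ℝ) p.2))
      (fun q => h.abs_L_le_sqrt (fun x hx => (hb x hx).2.2) q.1.2 q.2.2) ?_
    have := (cm.const_mul (12 * Real.pi * B)).tendsto p
    simpa [← h0] using this
  · exact (continuousAt_const.div cm.continuousAt (Real.sqrt_pos.2 h0).ne').mul
      h.continuous_landauNumerator.continuousAt

end LandauKernel

/-! ### The arcsine density. -/

section Arcsine

theorem image_cos_Ioo {c r : ℝ} (hr : 0 < r) :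
    (fun η => c + r * Real.cos η) '' Ioo 0 Real.pi = Ioo (c - r) (c + r) := by
  ext t
  constructor
  · rintro ⟨η, hη, rfl⟩
    have h1 : Real.cos η < 1 := by
      rw [← Real.cos_zero]
      exact Real.strictAntiOn_cos ⟨le_rfl, Real.pi_pos.le⟩ ⟨hη.1.le, hη.2.le⟩ hη.1
    have h2 : -1 < Real.cos η := by
      rw [← Real.cos_pi]
      exact Real.strictAntiOn_cos ⟨hη.1.le, hη.2.le⟩ ⟨Real.pi_pos.le, le_rfl⟩ hη.2
    constructor <;> dsimp only <;> nlinarith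
  · rintro ⟨h1, h2⟩
    have g1 : -1 < (t - c) / r := by rw [lt_div_iff₀ hr]; linarith
    have g2 : (t - c) / r < 1 := by rw [div_lt_iff₀ hr]; linarith
    refine ⟨Real.arccos ((t - c) / r), ⟨Real.arccos_pos.2 g2, ?_⟩, ?_⟩
    · refine lt_of_le_of_ne (Real.arccos_le_pi _) fun h => ?_
      rw [Real.arccos_eq_pi] at h
      linarith
    · dsimp only
      rw [Real.cos_arccos g1.le g2.le]
      field_simp
      ring

/-- Since √ is 0 on negative numbers and 0⁻¹ = 0, the density vanishes off its natural interval.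
Supports never have to be written as indicators, and integrals may run over larger domains. -/
theorem inv_sqrt_arcsine_eq_zero {a D c t : ℝ} (ha : 0 < a) (ht : D ≤ (t - c) ^ 2) :
    (√(a * (D - (t - c) ^ 2)))⁻¹ = 0 := by
  rw [Real.sqrt_eq_zero_of_nonpos, inv_zero]
  exact mul_nonpos_of_nonneg_of_nonpos ha.le (by linarith)

theorem arcsine_jacobian {a r c : ℝ} (ha : 0 < a) (hr : 0 < r) (g : ℝ → ℝ) {η : ℝ}
    (hη : η ∈ Ioo 0 Real.pi) :
    |-(r * Real.sin η)| • (g (c + r * Real.cos η) *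
      (√(a * (r ^ 2 - (c + r * Real.cos η - c) ^ 2)))⁻¹) = (√a)⁻¹ * g (c + r * Real.cos η) := by
  have hs := Real.sin_pos_of_pos_of_lt_pi hη.1 hη.2
  have e : a * (r ^ 2 - (c + r * Real.cos η - c) ^ 2) = a * (r * Real.sin η) ^ 2 := by
    have := Real.sin_sq_add_cos_sq η
    have : Real.sin η ^ 2 = 1 - Real.cos η ^ 2 := by linarith
    rw [mul_pow r (Real.sin η), this]
    ring
  have hrs : 0 < r * Real.sin η := by positivity
  rw [e, Real.sqrt_mul ha.le, Real.sqrt_sq hrs.le, abs_neg, abs_of_pos hrs, smul_eq_mul]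
  have := Real.sqrt_pos.2 ha
  field_simp

theorem hasDerivWithinAt_arcsine (c r η : ℝ) (s : Set ℝ) :
    HasDerivWithinAt (fun η => c + r * Real.cos η) (-(r * Real.sin η)) s η := by
  have := ((Real.hasDerivAt_cos η).const_mul r).const_add c
  exact (this.congr_deriv (by ring)).hasDerivWithinAt

theorem injOn_arcsine {c r : ℝ} (hr : 0 < r) :
    InjOn (fun η => c + r * Real.cos η) (Ioo 0 Real.pi) := by
  intro x hx y hy h
  have : Real.cos x = Real.cos y := by
    have : r * Real.cos x = r * Real.cos y := by simpa using h
    exact mul_left_cancel₀ hr.ne' this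
  exact Real.injOn_cos ⟨hx.1.le, hx.2.le⟩ ⟨hy.1.le, hy.2.le⟩ this

theorem mem_Ioo_of_sq_lt {c r t : ℝ} (hr : 0 < r) (ht : t ∉ Ioo (c - r) (c + r)) :
    r ^ 2 ≤ (t - c) ^ 2 := by
  by_contra! h
  have := abs_lt_of_sq_lt_sq h hr.le
  rw [abs_lt] at this
  exact ht ⟨by linarith [this.1], by linarith [this.2]⟩

/-- Integration against the (unnormalized) arcsine density. -/
theorem integral_arcsine {a D c : ℝ} (ha : 0 < a) (hD : 0 < D) (g : ℝ → ℝ) :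
    ∫ t, g t * (√(a * (D - (t - c) ^ 2)))⁻¹ =
      (√a)⁻¹ * ∫ η in Ioo 0 Real.pi, g (c + √D * Real.cos η) := by
  have hr := Real.sqrt_pos.2 hD
  have hD' : D = √D ^ 2 := (Real.sq_sqrt hD.le).symm
  generalize √D = r at hr hD' ⊢
  subst hD'
  have h1 := integral_image_eq_integral_abs_deriv_smul (measurableSet_Ioo (a := (0 : ℝ))
    (b := Real.pi)) (fun η _ => hasDerivWithinAt_arcsine c r η _) (injOn_arcsine hr)
    (fun t => g t * (√(a * (r ^ 2 - (t - c) ^ 2)))⁻¹)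
  rw [image_cos_Ioo hr, setIntegral_eq_integral_of_forall_compl_eq_zero] at h1
  · rw [h1, ← integral_const_mul]
    exact setIntegral_congr_fun measurableSet_Ioo fun η hη => arcsine_jacobian ha hr g hη
  · intro t ht
    rw [inv_sqrt_arcsine_eq_zero ha (mem_Ioo_of_sq_lt hr ht), mul_zero]

theorem integrable_arcsine {a D c : ℝ} (ha : 0 < a) :
    Integrable fun t => (√(a * (D - (t - c) ^ 2)))⁻¹ := by
  rcases le_or_gt D 0 with hD | hD
  · have : (fun t => (√(a * (D - (t - c) ^ 2)))⁻¹) = fun _ => 0 := by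
      funext t
      exact inv_sqrt_arcsine_eq_zero ha (hD.trans (sq_nonneg _))
    rw [this]
    exact integrable_zero _ _ _
  have hr := Real.sqrt_pos.2 hD
  have hD' : D = √D ^ 2 := (Real.sq_sqrt hD.le).symm
  generalize √D = r at hr hD'
  subst hD'
  have h1 := integrableOn_image_iff_integrableOn_abs_deriv_smul (measurableSet_Ioo (a := (0 : ℝ))
    (b := Real.pi)) (fun η _ => hasDerivWithinAt_arcsine c r η _) (injOn_arcsine hr)
    (fun t => (1 : ℝ) * (√(a * (r ^ 2 - (t - c) ^ 2)))⁻¹)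
  have h2 : IntegrableOn (fun η => |-(r * Real.sin η)| • ((1 : ℝ) *
      (√(a * (r ^ 2 - (c + r * Real.cos η - c) ^ 2)))⁻¹)) (Ioo 0 Real.pi) := by
    refine (integrableOn_congr_fun (fun η hη => arcsine_jacobian ha hr (fun _ => 1) hη)
      measurableSet_Ioo).2 ?_
    exact integrableOn_const (by simp)
  have h3 := h1.2 h2
  rw [image_cos_Ioo hr] at h3
  simp only [one_mul] at h3
  exact (integrableOn_iff_integrable_of_support_subset fun t ht => by
    by_contra hc
    exact ht (inv_sqrt_arcsine_eq_zero ha (mem_Ioo_of_sq_lt hr hc))).1 h3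

end Arcsine

/-! ### Algebra of the Gram determinant: symmetries, completed squares, positivity region. -/

section CollisionGram

/-- Up to the factor `u`, the Gram determinant governing the collisions with energies
`x, y + z - x → y, z` and squared transfers `u`, `w`. -/
def gram (y z x u w : ℝ) : ℝ :=
  u * w * (2 * (y + z) - u - w) - u * (x - z) ^ 2 - w * (x - y) ^ 2

theorem gram_swap (y z x u w : ℝ) : gram y z x u w = gram z y x w u := by
  unfold gram; ring

theorem gram_reflect (y z x u w : ℝ) : gram y z x u w = gram y z (y + z - x) w u := by
  unfold gram; ring

/-- Completing the square in w, multiplied by 4u. Positivity of the determinant forces the first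
product to be positive. -/
theorem four_mul_gram (y z x u w : ℝ) :
    4 * u * gram y z x u w = (4 * u * x - (x - y + u) ^ 2) * (4 * u * z - (x - y + u) ^ 2) -
      (2 * u * (w - z - x) + (x - y + u) ^ 2) ^ 2 := by
  unfold gram; ring

theorem gram_eq_w {u : ℝ} (hu : 0 < u) (y z x w : ℝ) :
    gram y z x u w = u * (4 * (z - (x - y + u) ^ 2 / (4 * u)) * (x - (x - y + u) ^ 2 / (4 * u)) -
      (w - (z - (x - y + u) ^ 2 / (4 * u) + (x - (x - y + u) ^ 2 / (4 * u)))) ^ 2) := by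
  unfold gram; field_simp; ring

theorem gram_eq_x {u w : ℝ} (h : 0 < u + w) (y z x : ℝ) :
    gram y z x u w = (u + w) * (u * w * (2 * (y + z) * (u + w) - (u + w) ^ 2 - (y - z) ^ 2) /
      (u + w) ^ 2 - (x - (u * z + w * y) / (u + w)) ^ 2) := by
  unfold gram; field_simp; ring

/-- By `four_mul_gram` the two differences have a positive product, hence a common sign. If both
were negative, replacing (x - y + u)² by 4u max(x, z) in the determinant would bound it by -u times
a square. -/
theorem lt_of_gram_pos {y z x u w : ℝ} (hu : 0 < u) (hw : 0 < w) (h : 0 < gram y z x u w) :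
    (x - y + u) ^ 2 < 4 * u * x ∧ (x - y + u) ^ 2 < 4 * u * z := by
  have h1 := four_mul_gram y z x u w
  have h2 : 0 < 4 * u * gram y z x u w := by positivity
  have h3 : 0 < (4 * u * x - (x - y + u) ^ 2) * (4 * u * z - (x - y + u) ^ 2) := by
    nlinarith [sq_nonneg (2 * u * (w - z - x) + (x - y + u) ^ 2)]
  rcases pos_and_pos_or_neg_and_neg_of_mul_pos h3 with ⟨g1, g2⟩ | ⟨g1, g2⟩
  · exact ⟨by linarith, by linarith⟩
  · exfalso
    have e : gram y z x u w = 4 * z * x * u - w * (x - y + u) ^ 2 - u * (w - z - x) ^ 2 := by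
      unfold gram; ring
    rcases le_total z x with hzx | hzx
    · have : gram y z x u w < - u * (x - z + w) ^ 2 := by
        rw [e]; nlinarith
      nlinarith [sq_nonneg (x - z + w)]
    · have : gram y z x u w < - u * (z - x + w) ^ 2 := by
        rw [e]; nlinarith
      nlinarith [sq_nonneg (z - x + w)]

theorem mem_Ioo_of_gram_pos {y z x u w : ℝ} (hu : 0 < u) (hw : 0 < w)
    (h : 0 < gram y z x u w) : x ∈ Ioo 0 (y + z) := by
  have h1 := (lt_of_gram_pos hu hw h).1
  rw [gram_reflect] at h
  have h2 := (lt_of_gram_pos hw hu h).1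
  constructor
  · have : 0 < 4 * u * x := (sq_nonneg _).trans_lt h1
    exact pos_of_mul_pos_right this (by positivity)
  · have : 0 < 4 * w * (y + z - x) := (sq_nonneg _).trans_lt h2
    have := pos_of_mul_pos_right this (by positivity)
    linarith

/-- Heron's factorization: both sides say that √x, √y and s are the sides of a nondegenerate
triangle. -/
theorem triangle_iff {x y s : ℝ} (hx : 0 < x) (hy : 0 < y) (hs : 0 < s) :
    (x - y + s ^ 2) ^ 2 < 4 * s ^ 2 * x ↔ |√x - √y| < s ∧ s < √x + √y := by
  have hp := Real.sqrt_pos.2 hx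
  have hq := Real.sqrt_pos.2 hy
  have ex := Real.sq_sqrt hx.le
  have ey := Real.sq_sqrt hy.le
  generalize √x = p at *
  generalize √y = q at *
  subst ex ey
  have e : 4 * s ^ 2 * p ^ 2 - (p ^ 2 - q ^ 2 + s ^ 2) ^ 2 =
      (p + q + s) * ((p + q - s) * (s ^ 2 - (p - q) ^ 2)) := by ring
  rw [← sub_pos, e, mul_pos_iff_of_pos_left (by positivity), ← sq_lt_sq₀ (abs_nonneg _) hs.le,
    sq_abs]
  constructor
  · intro h
    rcases pos_and_pos_or_neg_and_neg_of_mul_pos h with ⟨g1, g2⟩ | ⟨g1, g2⟩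
    · exact ⟨by linarith, by linarith⟩
    · exfalso
      nlinarith
  · rintro ⟨g1, g2⟩
    exact mul_pos (by linarith) (by linarith)

end CollisionGram

/-! ### The collision kernel as a double integral over squared transfers. -/

section CollisionKernel

/-- The law of cosines |√a + e^{iθ}√b|² = a + b + √(4ab) cos θ shows that Y_*² is the arcsine
substitution with the centre and radius found in `gram_eq_w`. -/
theorem yStar_eq {x y z s θ : ℝ} (hs : 0 < s) (h1 : (x - y + s ^ 2) ^ 2 < 4 * s ^ 2 * x)
    (h2 : (x - y + s ^ 2) ^ 2 < 4 * s ^ 2 * z) :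
    yStar x y z s θ = √(z - (x - y + s ^ 2) ^ 2 / (4 * s ^ 2) +
      (x - (x - y + s ^ 2) ^ 2 / (4 * s ^ 2)) +
      √(4 * (z - (x - y + s ^ 2) ^ 2 / (4 * s ^ 2)) * (x - (x - y + s ^ 2) ^ 2 / (4 * s ^ 2))) *
        Real.cos θ) := by
  have hz : 0 < z - (x - y + s ^ 2) ^ 2 / (4 * s ^ 2) := by
    rw [sub_pos, div_lt_iff₀ (by positivity)]; linarith
  have hx : 0 < x - (x - y + s ^ 2) ^ 2 / (4 * s ^ 2) := by
    rw [sub_pos, div_lt_iff₀ (by positivity)]; linarith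
  rw [yStar, if_pos hs]
  generalize z - (x - y + s ^ 2) ^ 2 / (4 * s ^ 2) = a at *
  generalize x - (x - y + s ^ 2) ^ 2 / (4 * s ^ 2) = b at *
  rw [max_eq_left hz.le, max_eq_left hx.le, Complex.norm_eq_sqrt_sq_add_sq]
  congr 1
  have ea := Real.sq_sqrt hz.le
  have eb := Real.sq_sqrt hx.le
  have e4 : √(4 * a * b) = 2 * √a * √b := by
    rw [Real.sqrt_mul (by positivity), Real.sqrt_mul (by norm_num),
      show (4 : ℝ) = 2 ^ 2 by norm_num, Real.sqrt_sq (by norm_num)]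
  rw [e4]
  have hr : (Complex.exp (Complex.I * θ)).re = Real.cos θ := by
    rw [mul_comm]; exact Complex.exp_ofReal_mul_I_re θ
  have hi : (Complex.exp (Complex.I * θ)).im = Real.sin θ := by
    rw [mul_comm]; exact Complex.exp_ofReal_mul_I_im θ
  simp only [Complex.add_re, Complex.add_im, Complex.mul_re, Complex.mul_im, Complex.ofReal_re,
    Complex.ofReal_im, hr, hi, mul_zero, sub_zero, zero_add]
  have := Real.sin_sq_add_cos_sq θ
  nlinarith

theorem intervalIntegral_cos_full {g : ℝ → ℝ} (hg : Continuous g) (c r : ℝ) :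
    ∫ θ in (0 : ℝ)..(2 * Real.pi), g (c + r * Real.cos θ) =
      2 * ∫ η in Ioo 0 Real.pi, g (c + r * Real.cos η) := by
  have hc : Continuous fun θ => g (c + r * Real.cos θ) := by fun_prop
  rw [← intervalIntegral.integral_add_adjacent_intervals (b := Real.pi)
    (hc.intervalIntegrable _ _) (hc.intervalIntegrable _ _)]
  have h1 : ∫ θ in Real.pi..(2 * Real.pi), g (c + r * Real.cos θ) =
      ∫ θ in (0 : ℝ)..Real.pi, g (c + r * Real.cos θ) := by
    have := intervalIntegral.integral_comp_sub_left (a := 0) (b := Real.pi)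
      (fun θ => g (c + r * Real.cos θ)) (2 * Real.pi)
    simp only [Real.cos_two_pi_sub, sub_zero] at this
    rw [this]
    congr 1
    ring
  rw [h1, intervalIntegral.integral_of_le Real.pi_pos.le, integral_Ioc_eq_integral_Ioo]
  ring

/-- This allows the w-integral to run over w > 0 instead of the whole line: the density vanishes at
negative w. -/
theorem gram_nonpos_of_neg {y z x u w : ℝ} (hu : 0 < u) (hw : w < 0)
    (h1 : (x - y + u) ^ 2 < 4 * u * x) (h2 : (x - y + u) ^ 2 < 4 * u * z) :
    gram y z x u w ≤ 0 := by
  by_contra! h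
  have e := four_mul_gram y z x u w
  have h3 : 0 < 4 * u * gram y z x u w := by positivity
  have h4 : u * w * ((4 * u * x - (x - y + u) ^ 2) + (4 * u * z - (x - y + u) ^ 2)) < 0 :=
    mul_neg_of_neg_of_pos (mul_neg_of_pos_of_neg hu hw) (by linarith)
  nlinarith [sq_nonneg ((4 * u * x - (x - y + u) ^ 2) - (4 * u * z - (x - y + u) ^ 2)),
    sq_nonneg (u * w)]

/-- Substitution w = Y_*². The full circle covers the arc (0, π) twice, which gives the 2, and s is
the square root of the leading coefficient s² of the determinant in w. -/
theorem integral_theta {f : ℝ → ℝ} (hf : Continuous fun w => f (√w)) {x y z s : ℝ} (hs : 0 < s)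
    (h1 : (x - y + s ^ 2) ^ 2 < 4 * s ^ 2 * x) (h2 : (x - y + s ^ 2) ^ 2 < 4 * s ^ 2 * z) :
    ∫ θ in (0 : ℝ)..(2 * Real.pi), f (yStar x y z s θ) =
      2 * s * ∫ w in Ioi (0 : ℝ), f (√w) * (√(gram y z x (s ^ 2) w))⁻¹ := by
  have hu : 0 < s ^ 2 := by positivity
  have hz : 0 < z - (x - y + s ^ 2) ^ 2 / (4 * s ^ 2) := by
    rw [sub_pos, div_lt_iff₀ (by positivity)]; linarith
  have hx : 0 < x - (x - y + s ^ 2) ^ 2 / (4 * s ^ 2) := by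
    rw [sub_pos, div_lt_iff₀ (by positivity)]; linarith
  simp only [yStar_eq hs h1 h2]
  rw [intervalIntegral_cos_full (g := fun w => f (√w)) hf]
  have h3 := integral_arcsine hu (D := 4 * (z - (x - y + s ^ 2) ^ 2 / (4 * s ^ 2)) *
    (x - (x - y + s ^ 2) ^ 2 / (4 * s ^ 2))) (c := z - (x - y + s ^ 2) ^ 2 / (4 * s ^ 2) +
      (x - (x - y + s ^ 2) ^ 2 / (4 * s ^ 2))) (by positivity) (fun w => f (√w))
  simp only [← gram_eq_w hu] at h3
  have h5 : ∫ w in Ioi (0 : ℝ), f (√w) * (√(gram y z x (s ^ 2) w))⁻¹ =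
      ∫ w, f (√w) * (√(gram y z x (s ^ 2) w))⁻¹ := by
    rw [← integral_Ici_eq_integral_Ioi, setIntegral_eq_integral_of_forall_compl_eq_zero]
    intro w hw
    rw [Real.sqrt_eq_zero_of_nonpos (gram_nonpos_of_neg hu (not_le.1 hw) h1 h2)]
    simp
  rw [h5, h3, Real.sqrt_sq hs.le]
  field_simp

theorem integral_gram_eq_zero {f : ℝ → ℝ} {x y z u : ℝ} (hu : 0 < u)
    (h : ¬ ((x - y + u) ^ 2 < 4 * u * x ∧ (x - y + u) ^ 2 < 4 * u * z)) :
    ∫ w in Ioi (0 : ℝ), f w * (√(gram y z x u w))⁻¹ = 0 := by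
  refine setIntegral_eq_zero_of_forall_eq_zero fun w hw => ?_
  have : gram y z x u w ≤ 0 := by
    by_contra! hc
    exact h (lt_of_gram_pos hu hw hc)
  rw [Real.sqrt_eq_zero_of_nonpos this]
  simp

theorem integral_comp_sq_Ioi (h : ℝ → ℝ) :
    ∫ s in Ioi (0 : ℝ), 2 * s * h (s ^ 2) = ∫ u in Ioi (0 : ℝ), h u := by
  rw [← integral_comp_rpow_Ioi_of_pos (g := h) (p := 2) (by norm_num)]
  refine setIntegral_congr_fun measurableSet_Ioi fun s _ => ?_
  norm_num

theorem xStar_of_le {x y z : ℝ} (h : x ≤ y + z) : xStar x y z = y + z - x :=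
  max_eq_left (by linarith)

/-- Since x - y = z - x_*, the same difference x - y + s² governs the triangles (√x, √y, s) and (√z,
√x_*, s). The interval of s is thus exactly the set where both positive parts in Y_* are positive.
-/
theorem mem_Ioo_transfer_iff {x y z s : ℝ} (hx : 0 < x) (hy : 0 < y) (hz : 0 < z)
    (hs : x < y + z) (h0 : 0 < s) :
    s ∈ Ioo (max |√x - √y| |√(xStar x y z) - √z|) (min (√x + √y) (√(xStar x y z) + √z)) ↔
      (x - y + s ^ 2) ^ 2 < 4 * s ^ 2 * x ∧ (x - y + s ^ 2) ^ 2 < 4 * s ^ 2 * z := by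
  have e : x - y = z - (y + z - x) := by ring
  have h1 := triangle_iff hz (show 0 < y + z - x by linarith) h0
  rw [← e] at h1
  rw [triangle_iff hx hy h0, h1, xStar_of_le hs.le, mem_Ioo, max_lt_iff, lt_min_iff,
    abs_sub_comm (√(y + z - x)), add_comm (√(y + z - x))]
  tauto

theorem transfer_low_nonneg (x y z : ℝ) :
    0 ≤ max |√x - √y| |√(xStar x y z) - √z| :=
  (abs_nonneg _).trans (le_max_left _ _)

/-- The product and the difference of the endpoints of the interval of transfers. -/
theorem transfer_endpoints {x y z : ℝ} (hx : 0 < x) (hy : 0 < y) (hz : 0 < z) (hs : x < y + z) :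
    max |√x - √y| |√(xStar x y z) - √z| * min (√x + √y) (√(xStar x y z) + √z) = |x - y| ∧
    min (√x + √y) (√(xStar x y z) + √z) - max |√x - √y| |√(xStar x y z) - √z| =
      2 * min (min (√x) (√y)) (min (√(xStar x y z)) (√z)) := by
  rw [xStar_of_le hs.le]
  have hx' : 0 < y + z - x := by linarith
  have e1 := Real.sq_sqrt hx.le
  have e2 := Real.sq_sqrt hy.le
  have e3 := Real.sq_sqrt hz.le
  have e4 := Real.sq_sqrt hx'.le
  have p1 := Real.sqrt_pos.2 hx
  have p2 := Real.sqrt_pos.2 hy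
  have p3 := Real.sqrt_pos.2 hz
  have p4 := Real.sqrt_pos.2 hx'
  generalize √x = a at *
  generalize √y = b at *
  generalize √z = c at *
  generalize √(y + z - x) = d at *
  have m1 : |a - b| * (a + b) = |x - y| := by
    rw [← abs_of_pos (add_pos p1 p2), ← abs_mul]; congr 1; rw [← e1, ← e2]; ring
  have m2 : |d - c| * (d + c) = |x - y| := by
    rw [← abs_of_pos (add_pos p4 p3), ← abs_mul, abs_sub_comm x]; congr 1; nlinarith
  have d1 : a + b - |a - b| = 2 * min a b := by
    rcases le_total a b with h | h
    · rw [abs_of_nonpos (by linarith), min_eq_left h]; ring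
    · rw [abs_of_nonneg (by linarith), min_eq_right h]; ring
  have d2 : d + c - |d - c| = 2 * min d c := by
    rcases le_total d c with h | h
    · rw [abs_of_nonpos (by linarith), min_eq_left h]; ring
    · rw [abs_of_nonneg (by linarith), min_eq_right h]; ring
  -- When x = y both lower endpoints are 0, and the comparison of products below, which divides by
  -- them, is unavailable.
  rcases eq_or_ne x y with hxy | hxy
  · have hab : a = b := by
      rw [← sq_eq_sq₀ p1.le p2.le, e1, e2, hxy]
    have hdc : d = c := by
      rw [← sq_eq_sq₀ p4.le p3.le, e4, e3, hxy]; ring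
    subst hab hdc
    simp only [sub_self, abs_zero, max_self, zero_mul, hxy, sub_zero, min_self, true_and]
    rw [← two_mul, ← two_mul, mul_min_of_nonneg _ _ (by norm_num : (0 : ℝ) ≤ 2)]
  have n0 : 0 < |x - y| := abs_pos.2 (sub_ne_zero.2 hxy)
  have n1 : 0 < |a - b| := pos_of_mul_pos_left (m1 ▸ n0) (by positivity)
  have n2 : 0 < |d - c| := pos_of_mul_pos_left (m2 ▸ n0) (by positivity)
  -- Both intervals have endpoints with product |x - y|, so the one with the larger lower endpoint
  -- has the smaller upper endpoint. The intervals are nested and the intersection is one of them.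
  rcases le_total |a - b| |d - c| with h | h
  · have h' : d + c ≤ a + b := by
      by_contra! hc
      nlinarith
    have h'' : min d c ≤ min a b := by linarith
    rw [max_eq_right h, min_eq_right h', m2, d2, min_eq_right h'']
    exact ⟨rfl, rfl⟩
  · have h' : a + b ≤ d + c := by
      by_contra! hc
      nlinarith
    have h'' : min a b ≤ min d c := by linarith
    rw [max_eq_left h, min_eq_left h', m1, d1, min_eq_left h'']
    exact ⟨rfl, rfl⟩

theorem transfer_low_lt_high {x y z : ℝ} (hx : 0 < x) (hy : 0 < y) (hz : 0 < z)
    (hs : x < y + z) :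
    max |√x - √y| |√(xStar x y z) - √z| < min (√x + √y) (√(xStar x y z) + √z) := by
  have h := (transfer_endpoints hx hy hz hs).2
  have hx' : 0 < xStar x y z := by rw [xStar_of_le hs.le]; linarith
  have p1 := Real.sqrt_pos.2 hx
  have p2 := Real.sqrt_pos.2 hy
  have p3 := Real.sqrt_pos.2 hz
  have p4 := Real.sqrt_pos.2 hx'
  have : 0 < min (min (√x) (√y)) (min (√(xStar x y z)) (√z)) := by simp [*]
  linarith

/-- A scattering function is regular if it is continuous and bounded in terms of the squared
transfers. -/
structure RegularScattering (Φ : ℝ → ℝ → ℝ) : Prop where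
  continuous : Continuous fun p : ℝ × ℝ => Φ (√2 * √p.1) (√2 * √p.2)
  bounded : ∃ M : ℝ, ∀ u w : ℝ, |Φ (√2 * √u) (√2 * √w)| ≤ M

theorem RegularScattering.flip {Φ : ℝ → ℝ → ℝ} (h : RegularScattering Φ) :
    RegularScattering (fun r ρ => Φ ρ r) :=
  ⟨h.continuous.comp continuous_swap, h.bounded.imp fun _ hM u w => hM w u⟩

theorem W_of_pos {Φ : ℝ → ℝ → ℝ} {x y z : ℝ} (hx : 0 < x) (hy : 0 < y) (hz : 0 < z)
    (hs : x < y + z) :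
    W Φ x y z = 4 * Real.pi / √(x * y * z) *
      ∫ s in Ioo (max |√x - √y| |√(xStar x y z) - √z|) (min (√x + √y) (√(xStar x y z) + √z)),
        ∫ θ in (0 : ℝ)..(2 * Real.pi), Φ (√2 * s) (√2 * yStar x y z s θ) := by
  have hx' : 0 < xStar x y z := by rw [xStar_of_le hs.le]; linarith
  rw [W, if_pos ⟨hx', hx, hy, hz⟩, intervalIntegral.integral_of_le
    (transfer_low_lt_high hx hy hz hs).le, integral_Ioc_eq_integral_Ioo]

/-- The form in which the two transfers play symmetric roles and all the constraints on the
integration domain are carried by the determinant. -/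
theorem W_eq_integral_gram {Φ : ℝ → ℝ → ℝ} (hΦ : RegularScattering Φ) {x y z : ℝ} (hx : 0 < x)
    (hy : 0 < y) (hz : 0 < z) (hs : x < y + z) :
    W Φ x y z = 4 * Real.pi / √(x * y * z) *
      ∫ u in Ioi (0 : ℝ), ∫ w in Ioi (0 : ℝ),
        Φ (√2 * √u) (√2 * √w) * (√(gram y z x u w))⁻¹ := by
  rw [W_of_pos hx hy hz hs, ← integral_comp_sq_Ioi]
  congr 1
  have h0 : Ioo (max |√x - √y| |√(xStar x y z) - √z|) (min (√x + √y) (√(xStar x y z) + √z)) ⊆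
      Ioi 0 := fun s h => (transfer_low_nonneg x y z).trans_lt h.1
  rw [setIntegral_eq_of_subset_of_forall_sdiff_eq_zero (f := fun s => 2 * s * _) measurableSet_Ioi h0]
  · refine setIntegral_congr_fun measurableSet_Ioo fun s hs' => ?_
    have hs0 : 0 < s := h0 hs'
    have h1 := (mem_Ioo_transfer_iff hx hy hz hs hs0).1 hs'
    have hc : Continuous fun w => Φ (√2 * s) (√2 * √w) := by
      have := hΦ.continuous.comp (f := fun w : ℝ => (s ^ 2, w)) (by fun_prop)
      simpa [Function.comp_def, Real.sqrt_sq hs0.le] using this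
    have := integral_theta (f := fun r => Φ (√2 * s) (√2 * r)) hc hs0 h1.1 h1.2
    simp only [Real.sqrt_sq hs0.le]
    exact this
  · intro s hs'
    have hs0 : 0 < s := hs'.1
    rw [integral_gram_eq_zero (f := fun w => Φ (√2 * √(s ^ 2)) (√2 * √w)) (by positivity), mul_zero]
    exact fun h => hs'.2 ((mem_Ioo_transfer_iff hx hy hz hs hs0).2 h)

theorem integrableOn_inv_sqrt (T : ℝ) : IntegrableOn (fun u => (√u)⁻¹) (Ioo 0 T) := by
  rcases le_or_gt T 0 with h | h
  · simp [Ioo_eq_empty (not_lt.2 h)]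
  have := (intervalIntegral.integrableOn_Ioo_rpow_iff (s := -(1 / 2)) h).2 (by norm_num)
  refine this.congr_fun (fun u hu => ?_) measurableSet_Ioo
  dsimp only
  rw [Real.rpow_neg hu.1.le, ← Real.sqrt_eq_rpow]

/-- The total mass of the arcsine density is π/√u. It occurs only if (x - y + u)² < 4ux, which
forces u < 2(x + y). The bound gives integrability over the quadrant. -/
theorem integral_gram_w_le {x y z u : ℝ} (hu : 0 < u) :
    (∫ w in Ioi (0 : ℝ), (√(gram y z x u w))⁻¹) ≤
      (Ioo 0 (2 * (x + y))).indicator (fun u => Real.pi * (√u)⁻¹) u := by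
  have hu0 : 0 ≤ (√u)⁻¹ := by positivity
  have hpi := Real.pi_pos
  by_cases h : (x - y + u) ^ 2 < 4 * u * x ∧ (x - y + u) ^ 2 < 4 * u * z
  · have hm : u ∈ Ioo 0 (2 * (x + y)) := by
      refine ⟨hu, ?_⟩
      by_contra! hc
      nlinarith [sq_nonneg (x - y)]
    rw [indicator_of_mem hm]
    have hz : 0 < z - (x - y + u) ^ 2 / (4 * u) := by
      rw [sub_pos, div_lt_iff₀ (by positivity)]; linarith
    have hx : 0 < x - (x - y + u) ^ 2 / (4 * u) := by
      rw [sub_pos, div_lt_iff₀ (by positivity)]; linarith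
    have h3 := integral_arcsine hu (D := 4 * (z - (x - y + u) ^ 2 / (4 * u)) *
      (x - (x - y + u) ^ 2 / (4 * u))) (c := z - (x - y + u) ^ 2 / (4 * u) +
        (x - (x - y + u) ^ 2 / (4 * u))) (by positivity) (fun _ => 1)
    have h4 := integrable_arcsine hu (D := 4 * (z - (x - y + u) ^ 2 / (4 * u)) *
      (x - (x - y + u) ^ 2 / (4 * u))) (c := z - (x - y + u) ^ 2 / (4 * u) +
        (x - (x - y + u) ^ 2 / (4 * u)))
    simp only [← gram_eq_w hu, one_mul] at h3 h4
    refine (setIntegral_le_integral h4 (ae_of_all _ fun w => by positivity)).trans ?_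
    rw [h3]
    simp [hpi.le, mul_comm]
  · have := integral_gram_eq_zero (f := fun _ => 1) hu h
    simp only [one_mul] at this
    rw [this]
    exact indicator_nonneg (fun u hu => by positivity) _

theorem measurable_gram (y z : ℝ) :
    Measurable fun p : ℝ × ℝ × ℝ => (√(gram y z p.1 p.2.1 p.2.2))⁻¹ := by
  unfold gram; fun_prop

theorem integrable_gram_uw (x y z : ℝ) :
    Integrable (fun p : ℝ × ℝ => (√(gram y z x p.1 p.2))⁻¹)
      ((volume.restrict (Ioi 0)).prod (volume.restrict (Ioi 0))) := by
  have hm : Measurable fun p : ℝ × ℝ => (√(gram y z x p.1 p.2))⁻¹ :=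
    (measurable_gram y z).comp (measurable_const.prodMk measurable_id)
  rw [integrable_prod_iff hm.aestronglyMeasurable]
  constructor
  · filter_upwards [ae_restrict_mem measurableSet_Ioi] with u hu
    have h4 := integrable_arcsine (mem_Ioi.1 hu) (D := 4 * (z - (x - y + u) ^ 2 / (4 * u)) *
      (x - (x - y + u) ^ 2 / (4 * u))) (c := z - (x - y + u) ^ 2 / (4 * u) +
        (x - (x - y + u) ^ 2 / (4 * u)))
    simp only [← gram_eq_w (mem_Ioi.1 hu)] at h4
    exact h4.integrableOn
  · refine Integrable.mono' (g := (Ioo 0 (2 * (x + y))).indicator (fun u => Real.pi * (√u)⁻¹))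
      ?_ ?_ ?_
    · have h5 : IntegrableOn (fun u => Real.pi * (√u)⁻¹) (Ioo 0 (2 * (x + y))) :=
        (integrableOn_inv_sqrt _).const_mul _
      exact (h5.integrable_indicator measurableSet_Ioo).integrableOn
    · exact (hm.norm.stronglyMeasurable.integral_prod_right (ν := volume.restrict
        (Ioi 0))).aestronglyMeasurable
    · filter_upwards [ae_restrict_mem measurableSet_Ioi] with u hu
      rw [Real.norm_of_nonneg (integral_nonneg fun _ => norm_nonneg _)]
      refine le_trans (le_of_eq ?_) (integral_gram_w_le (z := z) (mem_Ioi.1 hu))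
      exact integral_congr_ae (ae_of_all _ fun w => Real.norm_of_nonneg (by positivity))

theorem RegularScattering.integrable_mul_gram {Φ : ℝ → ℝ → ℝ} (hΦ : RegularScattering Φ)
    (x y z : ℝ) :
    Integrable (fun p : ℝ × ℝ => Φ (√2 * √p.1) (√2 * √p.2) * (√(gram y z x p.1 p.2))⁻¹)
      ((volume.restrict (Ioi 0)).prod (volume.restrict (Ioi 0))) := by
  obtain ⟨M, hM⟩ := hΦ.bounded
  exact (integrable_gram_uw x y z).bdd_mul hΦ.continuous.aestronglyMeasurable
    (ae_of_all _ fun p => hM p.1 p.2)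

/-- Exchanging the two outgoing energies exchanges the two transfers. -/
theorem W_swap {Φ : ℝ → ℝ → ℝ} (hΦ : RegularScattering Φ) {x y z : ℝ} (hx : 0 ≤ x) (hy : 0 ≤ y)
    (hz : 0 ≤ z) : W Φ x y z = W (fun r ρ => Φ ρ r) x z y := by
  by_cases h : 0 < xStar x y z ∧ 0 < x ∧ 0 < y ∧ 0 < z
  · obtain ⟨hs, hx, hy, hz⟩ := h
    have hs : x < y + z := by simpa [xStar] using hs
    rw [W_eq_integral_gram hΦ hx hy hz hs, W_eq_integral_gram hΦ.flip hx hz hy (by linarith),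
      integral_integral_swap (hΦ.integrable_mul_gram x y z)]
    simp only [gram_swap y z]
    congr 3
    ring
  · have h' : ¬ (0 < xStar x z y ∧ 0 < x ∧ 0 < z ∧ 0 < y) := fun hc =>
      h ⟨by rw [xStar, add_comm y z]; exact hc.1, hc.2.1, hc.2.2.2, hc.2.2.1⟩
    rw [W, W, if_neg h, if_neg h']
    rcases hx.eq_or_lt with rfl | hx
    · simp only [true_and, and_comm (a := 0 < z), mul_comm z y, lt_self_iff_false, false_and,
        and_false, if_false]
    · rcases hy.eq_or_lt with rfl | hy
      · rcases hz.eq_or_lt with rfl | hz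
        · simp [hx.ne', hx.not_gt]
        · simp [hx.ne', hz.ne', hx]
      · rcases hz.eq_or_lt with rfl | hz
        · simp [hx.ne', hy.ne', hx]
        · simp [hx.ne', hy.ne', hz.ne']

end CollisionKernel

/-! ### Averaging over the outgoing energy: the coordinates q, v, η. -/

section CollisionAverage

/-- The outgoing energy as a function of the total squared transfer `q`, the fraction `v` and the
angle `η`. -/
def deflect (y z q v η : ℝ) : ℝ :=
  y + v * (z - y) + √(v * (1 - v) * (2 * (y + z) * q - q ^ 2 - (y - z) ^ 2)) * Real.cos η

/-- Parametrization of the interval of total squared transfers. -/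
def transferPath (y z σ : ℝ) : ℝ :=
  (|√y - √z| + (√y + √z - |√y - √z|) * σ) ^ 2

/-- Arcsine substitution in x. In terms of q = u + w and v = u/q, the centre is y + v(z - y) and the
squared radius is v(1 - v) times the quantity assumed positive. -/
theorem integral_x_gram {y z u w : ℝ} (hu : 0 < u) (hw : 0 < w) (D : ℝ → ℝ)
    (hκ : 0 < 2 * (y + z) * (u + w) - (u + w) ^ 2 - (y - z) ^ 2) :
    ∫ x, D x * (√(gram y z x u w))⁻¹ = (√(u + w))⁻¹ *
      ∫ η in Ioo 0 Real.pi, D (deflect y z (u + w) (u / (u + w)) η) := by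
  have hq : 0 < u + w := by positivity
  have h := integral_arcsine hq (D := u * w * (2 * (y + z) * (u + w) - (u + w) ^ 2 - (y - z) ^ 2) /
      (u + w) ^ 2) (c := (u * z + w * y) / (u + w)) (by positivity) D
  simp only [← gram_eq_x hq] at h
  rw [h]
  congr 1
  refine setIntegral_congr_fun measurableSet_Ioo fun η _ => ?_
  dsimp only [deflect]
  congr 2
  · field_simp; ring
  · congr 2
    field_simp; ring

theorem integral_x_gram_eq_zero {y z u w : ℝ} (hu : 0 < u) (hw : 0 < w) (D : ℝ → ℝ)
    (hκ : 2 * (y + z) * (u + w) - (u + w) ^ 2 - (y - z) ^ 2 ≤ 0) :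
    ∫ x, D x * (√(gram y z x u w))⁻¹ = 0 := by
  have hq : 0 < u + w := by positivity
  rw [← integral_zero ℝ ℝ]
  congr 1
  funext x
  rw [gram_eq_x hq, inv_sqrt_arcsine_eq_zero hq, mul_zero]
  refine le_trans ?_ (sq_nonneg _)
  rw [mul_div_assoc]
  exact mul_nonpos_of_nonneg_of_nonpos (by positivity) (div_nonpos_of_nonpos_of_nonneg hκ
    (by positivity))

/-- Tonelli with x first: the inner integral is π/√(u + w) ≤ π/√u, and it vanishes unless u + w <
2(y + z). This is an integrable product on a bounded square. -/
theorem integrable_gram (y z : ℝ) :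
    Integrable (fun p : ℝ × ℝ × ℝ => (√(gram y z p.1 p.2.1 p.2.2))⁻¹)
      (volume.prod ((volume.restrict (Ioi 0)).prod (volume.restrict (Ioi 0)))) := by
  have hm := measurable_gram y z
  have hpi := Real.pi_pos
  have hae : ∀ᵐ p : ℝ × ℝ ∂((volume.restrict (Ioi 0)).prod (volume.restrict (Ioi 0))),
      0 < p.1 ∧ 0 < p.2 := by
    rw [Measure.prod_restrict]
    filter_upwards [ae_restrict_mem (measurableSet_Ioi.prod measurableSet_Ioi)] with p hp using hp
  rw [integrable_prod_iff' hm.aestronglyMeasurable]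
  constructor
  · filter_upwards [hae] with p hp
    have hq : 0 < p.1 + p.2 := add_pos hp.1 hp.2
    simp only [gram_eq_x hq]
    exact integrable_arcsine hq
  · set T := 2 * (y + z) with hT
    have g1 : Integrable ((Ioo 0 T).indicator fun u => Real.pi * (√u)⁻¹)
        (volume.restrict (Ioi 0)) := by
      have h5 : IntegrableOn (fun u => Real.pi * (√u)⁻¹) (Ioo 0 T) :=
        (integrableOn_inv_sqrt _).const_mul _
      exact (h5.integrable_indicator measurableSet_Ioo).integrableOn
    have g2 : Integrable ((Ioo 0 T).indicator fun _ => (1 : ℝ)) (volume.restrict (Ioi 0)) := by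
      have h5 : IntegrableOn (fun _ => (1 : ℝ)) (Ioo 0 T) := integrableOn_const (by simp)
      exact (h5.integrable_indicator measurableSet_Ioo).integrableOn
    refine Integrable.mono' (g1.mul_prod g2) ?_ ?_
    · exact (StronglyMeasurable.integral_prod_right' (ν := (volume : Measure ℝ))
        (f := fun p : (ℝ × ℝ) × ℝ => ‖(√(gram y z p.2 p.1.1 p.1.2))⁻¹‖)
        (hm.norm.comp measurable_swap).stronglyMeasurable).aestronglyMeasurable
    · filter_upwards [hae] with p hp
      rw [Real.norm_of_nonneg (integral_nonneg fun _ => norm_nonneg _)]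
      have e : ∫ x, ‖(√(gram y z x p.1 p.2))⁻¹‖ = ∫ x, 1 * (√(gram y z x p.1 p.2))⁻¹ :=
        integral_congr_ae (ae_of_all _ fun w => by
          dsimp only
          rw [one_mul]
          exact Real.norm_of_nonneg (by positivity))
      refine e.trans_le ?_
      have hq : 0 < p.1 + p.2 := add_pos hp.1 hp.2
      have hnn : ∀ s t : ℝ, 0 ≤ (Ioo 0 T).indicator (fun u => Real.pi * (√u)⁻¹) s *
          (Ioo 0 T).indicator (fun _ => (1 : ℝ)) t := fun s t =>
        mul_nonneg (indicator_nonneg (fun _ _ => by positivity) _)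
          (indicator_nonneg (fun _ _ => zero_le_one) _)
      rcases le_or_gt (2 * (y + z) * (p.1 + p.2) - (p.1 + p.2) ^ 2 - (y - z) ^ 2) 0 with hκ | hκ
      · rw [integral_x_gram_eq_zero hp.1 hp.2 _ hκ]
        exact hnn _ _
      · rw [integral_x_gram hp.1 hp.2 _ hκ]
        have hlt : p.1 + p.2 < T := by
          by_contra! hc
          nlinarith [sq_nonneg (y - z)]
        rw [indicator_of_mem (show p.1 ∈ Ioo 0 T from ⟨hp.1, by linarith [hp.2]⟩),
          indicator_of_mem (show p.2 ∈ Ioo 0 T from ⟨hp.2, by linarith [hp.1]⟩)]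
        simp only [integral_const, smul_eq_mul, mul_one, MeasurableSet.univ,
          measureReal_restrict_apply, univ_inter, Real.volume_real_Ioo_of_le hpi.le, sub_zero]
        rw [mul_comm]
        have := Real.sqrt_pos.2 hp.1
        gcongr
        linarith [hp.2]

/-- Integration over the positive quadrant along the lines `u + w = q`. -/
theorem integral_quadrant {h : ℝ × ℝ → ℝ}
    (hh : Integrable h ((volume.restrict (Ioi 0)).prod (volume.restrict (Ioi 0)))) :
    ∫ p, h p ∂((volume.restrict (Ioi 0)).prod (volume.restrict (Ioi 0))) =
      ∫ q in Ioi (0 : ℝ), ∫ u in Ioo 0 q, h (u, q - u) := by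
  rw [Measure.prod_restrict] at hh ⊢
  have hS : MeasurableSet (Ioi (0 : ℝ) ×ˢ Ioi (0 : ℝ)) := measurableSet_Ioi.prod measurableSet_Ioi
  rw [← integral_indicator hS]
  have hi := (integrable_indicator_iff hS).2 hh
  set H := (Ioi (0 : ℝ) ×ˢ Ioi (0 : ℝ)).indicator h with hH
  have hmp : MeasurePreserving (fun z : ℝ × ℝ => (z.1, -z.1 + z.2)) (volume.prod volume)
      (volume.prod volume) :=
    measurePreserving_prod_neg_add (μ := (volume : Measure ℝ)) (ν := volume)
  have hemb : MeasurableEmbedding (fun z : ℝ × ℝ => (z.1, -z.1 + z.2)) :=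
    (MeasurableEquiv.shearAddRight ℝ).symm.measurableEmbedding
  have hi' : Integrable (fun z : ℝ × ℝ => H (z.1, -z.1 + z.2)) (volume.prod volume) :=
    hmp.integrable_comp_of_integrable hi
  have e1 : ∫ p, H p ∂(volume.prod volume) =
      ∫ z : ℝ × ℝ, H (z.1, -z.1 + z.2) ∂(volume.prod volume) :=
    (hmp.integral_comp hemb H).symm
  rw [e1, integral_prod_symm _ hi', ← integral_indicator measurableSet_Ioi]
  congr 1
  funext q
  have key : ∀ u, H (u, -u + q) = (Ioo 0 q).indicator (fun u => h (u, q - u)) u := by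
    intro u
    rw [hH, neg_add_eq_sub]
    by_cases hu : u ∈ Ioo 0 q
    · rw [indicator_of_mem hu, indicator_of_mem]
      exact ⟨hu.1, sub_pos.2 hu.2⟩
    · rw [indicator_of_notMem hu, indicator_of_notMem]
      exact fun hc => hu ⟨hc.1, sub_pos.1 hc.2⟩
  simp only [key]
  rw [integral_indicator measurableSet_Ioo]
  by_cases hq : q ∈ Ioi (0 : ℝ)
  · rw [indicator_of_mem hq]
  · rw [indicator_of_notMem hq, Ioo_eq_empty (by simpa using hq)]
    simp

/-- For q = t² with t > 0, the discriminant is positive exactly for t between |√y - √z| and √y + √z.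
This is why `transferPath` squares an affine path between these endpoints. -/
theorem kappa_eq {y z t : ℝ} (hy : 0 ≤ y) (hz : 0 ≤ z) :
    2 * (y + z) * t ^ 2 - (t ^ 2) ^ 2 - (y - z) ^ 2 =
      (t ^ 2 - |√y - √z| ^ 2) * ((√y + √z) ^ 2 - t ^ 2) := by
  have e1 := Real.sq_sqrt hy
  have e2 := Real.sq_sqrt hz
  rw [sq_abs]
  generalize √y = a at *
  generalize √z = b at *
  subst e1 e2
  ring

theorem high_sub_low (y z : ℝ) : √y + √z - |√y - √z| = 2 * √(min y z) := by
  rcases le_total y z with h | h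
  · rw [min_eq_left h, abs_of_nonpos (sub_nonpos.2 (Real.sqrt_le_sqrt h))]; ring
  · rw [min_eq_right h, abs_of_nonneg (sub_nonneg.2 (Real.sqrt_le_sqrt h))]; ring

/-- Fubini puts the x-integral innermost, the quadrant is sliced along u + w = q, and q = t² with t
affine in σ. The prefactor is 2 times the length 2√(min y z) of the t-interval. -/
theorem integral_collision {Φ : ℝ → ℝ → ℝ} (hΦ : RegularScattering Φ) {D : ℝ → ℝ}
    (hD : Continuous D) {M : ℝ} (hM : ∀ x, |D x| ≤ M) {y z : ℝ} (hy : 0 ≤ y) (hz : 0 ≤ z) :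
    ∫ x, D x * (∫ u in Ioi (0 : ℝ), ∫ w in Ioi (0 : ℝ),
        Φ (√2 * √u) (√2 * √w) * (√(gram y z x u w))⁻¹) =
      4 * √(min y z) * ∫ σ in (0 : ℝ)..1, transferPath y z σ * ∫ v in (0 : ℝ)..1,
        Φ (√2 * √(transferPath y z σ * v)) (√2 * √(transferPath y z σ * (1 - v))) *
          ∫ η in (0 : ℝ)..Real.pi, D (deflect y z (transferPath y z σ) v η) := by
  obtain ⟨N, hN⟩ := hΦ.bounded
  have hint : Integrable (fun p : ℝ × ℝ × ℝ => D p.1 * (Φ (√2 * √p.2.1) (√2 * √p.2.2) *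
      (√(gram y z p.1 p.2.1 p.2.2))⁻¹))
      (volume.prod ((volume.restrict (Ioi 0)).prod (volume.restrict (Ioi 0)))) := by
    refine Integrable.bdd_mul (c := M) ?_ (hD.comp continuous_fst).aestronglyMeasurable
      (ae_of_all _ fun p => hM p.1)
    exact (integrable_gram y z).bdd_mul (c := N)
      (hΦ.continuous.comp continuous_snd).aestronglyMeasurable (ae_of_all _ fun p => hN p.2.1 p.2.2)
  have s1 : ∫ x, D x * (∫ u in Ioi (0 : ℝ), ∫ w in Ioi (0 : ℝ),
        Φ (√2 * √u) (√2 * √w) * (√(gram y z x u w))⁻¹) =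
      ∫ p : ℝ × ℝ, Φ (√2 * √p.1) (√2 * √p.2) * (∫ x, D x * (√(gram y z x p.1 p.2))⁻¹)
        ∂((volume.restrict (Ioi 0)).prod (volume.restrict (Ioi 0))) := by
    have : ∀ x, D x * (∫ u in Ioi (0 : ℝ), ∫ w in Ioi (0 : ℝ),
        Φ (√2 * √u) (√2 * √w) * (√(gram y z x u w))⁻¹) =
        ∫ p : ℝ × ℝ, D x * (Φ (√2 * √p.1) (√2 * √p.2) * (√(gram y z x p.1 p.2))⁻¹)
          ∂((volume.restrict (Ioi 0)).prod (volume.restrict (Ioi 0))) := fun x => by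
      rw [integral_const_mul, integral_prod _ (hΦ.integrable_mul_gram x y z)]
    simp only [this]
    rw [integral_integral_swap (f := fun (x : ℝ) (p : ℝ × ℝ) =>
      D x * (Φ (√2 * √p.1) (√2 * √p.2) * (√(gram y z x p.1 p.2))⁻¹)) hint]
    congr 1
    funext p
    rw [← integral_const_mul]
    congr 1
    funext x
    ring
  have hint2 : Integrable (fun p : ℝ × ℝ => Φ (√2 * √p.1) (√2 * √p.2) *
      ∫ x, D x * (√(gram y z x p.1 p.2))⁻¹)
      ((volume.restrict (Ioi 0)).prod (volume.restrict (Ioi 0))) := by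
    refine hint.integral_prod_right.congr (ae_of_all _ fun p => ?_)
    dsimp only
    rw [← integral_const_mul]
    congr 1
    funext x
    ring
  rw [s1, integral_quadrant hint2, ← integral_comp_sq_Ioi]
  set a := |√y - √z| with ha
  set b := √y + √z with hb
  have ha0 : 0 ≤ a := abs_nonneg _
  have hb0 : 0 ≤ b := by positivity
  have hab : a ≤ b := by
    have := high_sub_low y z
    have : 0 ≤ √(min y z) := Real.sqrt_nonneg _
    linarith
  set Q : ℝ → ℝ := fun q => q * ∫ v in (0 : ℝ)..1, Φ (√2 * √(q * v)) (√2 * √(q * (1 - v))) *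
          ∫ η in (0 : ℝ)..Real.pi, D (deflect y z q v η) with hQ
  -- The Jacobian 2t of q = t² cancels the factor t⁻¹ from the x-integral; the remaining q comes
  -- from u = qv.
  have inner : ∀ t, 0 < t → 0 < 2 * (y + z) * t ^ 2 - (t ^ 2) ^ 2 - (y - z) ^ 2 →
      2 * t * (∫ u in Ioo 0 (t ^ 2), Φ (√2 * √u) (√2 * √(t ^ 2 - u)) *
        ∫ x, D x * (√(gram y z x u (t ^ 2 - u)))⁻¹) = 2 * Q (t ^ 2) := by
    intro t ht hκ
    have ht2 : 0 < t ^ 2 := by positivity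
    have e1 : (∫ u in Ioo 0 (t ^ 2), Φ (√2 * √u) (√2 * √(t ^ 2 - u)) *
        ∫ x, D x * (√(gram y z x u (t ^ 2 - u)))⁻¹) = ∫ u in Ioo 0 (t ^ 2), t⁻¹ *
        (Φ (√2 * √u) (√2 * √(t ^ 2 - u)) *
          ∫ η in (0 : ℝ)..Real.pi, D (deflect y z (t ^ 2) (u / t ^ 2) η)) := by
      refine setIntegral_congr_fun measurableSet_Ioo fun u hu => ?_
      have eq : u + (t ^ 2 - u) = t ^ 2 := by ring
      have h1 := integral_x_gram (y := y) (z := z) hu.1 (sub_pos.2 hu.2) D (by rwa [eq])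
      rw [eq, Real.sqrt_sq ht.le] at h1
      rw [h1, intervalIntegral.integral_of_le Real.pi_pos.le, integral_Ioc_eq_integral_Ioo]
      ring
    rw [e1, ← integral_Ioc_eq_integral_Ioo, ← intervalIntegral.integral_of_le ht2.le,
      intervalIntegral.integral_const_mul]
    have e2 := intervalIntegral.mul_integral_comp_mul_left (a := 0) (b := 1) (c := t ^ 2)
      (f := fun u => Φ (√2 * √u) (√2 * √(t ^ 2 - u)) *
          ∫ η in (0 : ℝ)..Real.pi, D (deflect y z (t ^ 2) (u / t ^ 2) η))
    rw [mul_zero, mul_one] at e2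
    rw [← e2, hQ]
    have e3 : ∀ v, t ^ 2 - t ^ 2 * v = t ^ 2 * (1 - v) := fun v => by ring
    have e4 : ∀ v, t ^ 2 * v / t ^ 2 = v := fun v => by field_simp
    simp only [e3, e4]
    field_simp
  have hsub : Ioo a b ⊆ Ioi 0 := fun t ht => ha0.trans_lt ht.1
  rw [setIntegral_eq_of_subset_of_forall_sdiff_eq_zero (s := Ioo a b)
    (f := fun t => 2 * t * _) measurableSet_Ioi hsub]
  · have e1 : (∫ t in Ioo a b, 2 * t * (∫ u in Ioo 0 (t ^ 2), Φ (√2 * √u) (√2 * √(t ^ 2 - u)) *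
        ∫ x, D x * (√(gram y z x u (t ^ 2 - u)))⁻¹)) = ∫ t in Ioo a b, 2 * Q (t ^ 2) := by
      refine setIntegral_congr_fun measurableSet_Ioo fun t ht => inner t (hsub ht) ?_
      rw [kappa_eq hy hz]
      exact mul_pos (sub_pos.2 (pow_lt_pow_left₀ ht.1 ha0 two_ne_zero))
        (sub_pos.2 (pow_lt_pow_left₀ ht.2 (hsub ht).le two_ne_zero))
    refine e1.trans ?_
    rw [← integral_Ioc_eq_integral_Ioo, ← intervalIntegral.integral_of_le hab]
    have e2 := intervalIntegral.mul_integral_comp_add_mul (a := 0) (b := 1) (c := b - a) (d := a)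
      (f := fun t => 2 * Q (t ^ 2))
    rw [mul_zero, mul_one, add_zero, add_sub_cancel] at e2
    rw [← e2, intervalIntegral.integral_const_mul, ← mul_assoc]
    congr 1
    rw [hb, ha, high_sub_low]
    ring
  · intro t ht
    have ht0 : 0 < t := ht.1
    have hκ : 2 * (y + z) * t ^ 2 - (t ^ 2) ^ 2 - (y - z) ^ 2 ≤ 0 := by
      rw [kappa_eq hy hz]
      by_contra! hc
      refine ht.2 ?_
      rcases pos_and_pos_or_neg_and_neg_of_mul_pos hc with ⟨g1, g2⟩ | ⟨g1, g2⟩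
      · exact ⟨lt_of_pow_lt_pow_left₀ 2 ht0.le (sub_pos.1 g1),
          lt_of_pow_lt_pow_left₀ 2 hb0 (sub_pos.1 g2)⟩
      · exfalso
        have : t < a := lt_of_pow_lt_pow_left₀ 2 ha0 (sub_neg.1 g1)
        have : b < t := lt_of_pow_lt_pow_left₀ 2 ht0.le (sub_neg.1 g2)
        linarith
    dsimp only
    rw [setIntegral_eq_zero_of_forall_eq_zero, mul_zero]
    intro u hu
    have eq : u + (t ^ 2 - u) = t ^ 2 := by ring
    rw [integral_x_gram_eq_zero hu.1 (sub_pos.2 hu.2) D (by rwa [eq]), mul_zero]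

end CollisionAverage

/-! ### The quadratic kernel in collision coordinates. -/

section QuadraticKernel

variable {φhat φ : ℝ → ℝ} {ε : ℝ}

theorem IsAdmissible.continuous_comp (h : IsAdmissible φhat) {X : Type*} [TopologicalSpace X]
    {f : X → ℝ} (hf : Continuous f) (h0 : ∀ x, 0 ≤ f x) : Continuous fun x => φhat (f x) :=
  h.continuousOn.comp_continuous hf h0

theorem IsAdmissible.regularScattering (h : IsAdmissible φhat) (hε : 0 < ε) :
    RegularScattering (PhiBE φhat ε) := by
  obtain ⟨C, hC⟩ := h.bounded
  refine ⟨?_, 1 / ε ^ 4 * (C + C) ^ 2, fun u w => ?_⟩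
  · have h1 : Continuous fun p : ℝ × ℝ => φhat (√2 * √p.1 / ε) :=
      h.continuous_comp (by fun_prop) fun p => by positivity
    have h2 : Continuous fun p : ℝ × ℝ => φhat (√2 * √p.2 / ε) :=
      h.continuous_comp (by fun_prop) fun p => by positivity
    exact ((h1.add h2).pow 2).const_mul _
  · rw [PhiBE, abs_of_nonneg (by positivity)]
    rw [← sq_abs]
    gcongr
    exact (abs_add_le _ _).trans (add_le_add (hC _ (by positivity)) (hC _ (by positivity)))

theorem PhiBE_comm (φhat : ℝ → ℝ) (ε r ρ : ℝ) : PhiBE φhat ε r ρ = PhiBE φhat ε ρ r := by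
  unfold PhiBE; ring

/-- The gain of the test function in a collision producing the energy `x`; negative energies are
truncated. -/
def gain (φ : ℝ → ℝ) (y z x : ℝ) : ℝ :=
  φ (max x 0) + φ (max (y + z - x) 0) - φ (max y 0) - φ (max z 0)

theorem K_eq (φhat : ℝ → ℝ) (ε : ℝ) (φ : ℝ → ℝ) {x y z : ℝ} (hx : 0 ≤ x) (hy : 0 ≤ y)
    (hz : 0 ≤ z) : K φhat ε φ x y z = W (PhiBE φhat ε) x y z * gain φ y z x := by
  rw [K, gain, max_eq_left hx, max_eq_left hy, max_eq_left hz, xStar]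

theorem gain_comm (φ : ℝ → ℝ) (y z x : ℝ) : gain φ y z x = gain φ z y x := by
  rw [gain, gain, add_comm y z]; ring

theorem gain_reflect (φ : ℝ → ℝ) (y z x : ℝ) : gain φ y z (y + z - x) = gain φ y z x := by
  rw [gain, gain, sub_sub_cancel]; ring

theorem IsAdmissible.K_comm (h : IsAdmissible φhat) (hε : 0 < ε) {x y z : ℝ} (hx : 0 ≤ x)
    (hy : 0 ≤ y) (hz : 0 ≤ z) : K φhat ε φ x y z = K φhat ε φ x z y := by
  have e : (fun r ρ => PhiBE φhat ε ρ r) = PhiBE φhat ε := by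
    funext r ρ; exact PhiBE_comm _ _ _ _
  rw [K_eq _ _ _ hx hy hz, K_eq _ _ _ hx hz hy, gain_comm, W_swap (h.regularScattering hε) hx hy hz,
    e]

theorem IsAdmissible.J_comm (h : IsAdmissible φhat) (hε : 0 < ε) {y z : ℝ}
    (hy : 0 ≤ y) (hz : 0 ≤ z) : J φhat ε φ y z = J φhat ε φ z y := by
  rw [J, J, add_comm z y]
  congr 1
  refine intervalIntegral.integral_congr fun x hx => ?_
  rw [uIcc_of_le (by positivity)] at hx
  rw [h.K_comm hε hx.1 hy hz]

theorem IsTestFunction.continuous_max (h : IsTestFunction φ) : Continuous fun x => φ (max x 0) :=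
  h.continuousOn.comp_continuous (by fun_prop) fun x => le_max_right x 0

theorem IsTestFunction.continuous_gain (h : IsTestFunction φ) :
    Continuous fun p : ℝ × ℝ × ℝ => gain φ p.1 p.2.1 p.2.2 := by
  have hc := h.continuous_max
  have h1 := hc.comp (f := fun p : ℝ × ℝ × ℝ => p.2.2) (by fun_prop)
  have h2 := hc.comp (f := fun p : ℝ × ℝ × ℝ => p.1 + p.2.1 - p.2.2) (by fun_prop)
  have h3 := hc.comp (f := fun p : ℝ × ℝ × ℝ => p.1) (by fun_prop)
  have h4 := hc.comp (f := fun p : ℝ × ℝ × ℝ => p.2.1) (by fun_prop)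
  exact ((h1.add h2).sub h3).sub h4

theorem abs_gain_le {B : ℝ}
    (hB : ∀ x, 0 ≤ x → |φ x| ≤ B) (y z x : ℝ) : |gain φ y z x| ≤ 4 * B := by
  have h1 := abs_le.1 (hB (max x 0) (le_max_right _ _))
  have h2 := abs_le.1 (hB (max (y + z - x) 0) (le_max_right _ _))
  have h3 := abs_le.1 (hB (max y 0) (le_max_right _ _))
  have h4 := abs_le.1 (hB (max z 0) (le_max_right _ _))
  rw [gain, abs_le]
  constructor <;> linarith

/-- The contribution of the collisions of total squared transfer `q` to the quadratic kernel. -/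
def collisionRate (φhat : ℝ → ℝ) (ε : ℝ) (φ : ℝ → ℝ) (y z q : ℝ) : ℝ :=
  q * ∫ v in (0 : ℝ)..1, PhiBE φhat ε (√2 * √(q * v)) (√2 * √(q * (1 - v))) *
    ∫ η in (0 : ℝ)..Real.pi, gain φ y z (deflect y z q v η)

theorem IsTestFunction.continuous_gain_average (h : IsTestFunction φ) :
    Continuous fun p : (ℝ × ℝ × ℝ) × ℝ =>
      ∫ η in (0 : ℝ)..Real.pi, gain φ p.1.1 p.1.2.1 (deflect p.1.1 p.1.2.1 p.1.2.2 p.2 η) := by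
  refine intervalIntegral.continuous_parametric_intervalIntegral_of_continuous' ?_ _ _
  refine h.continuous_gain.comp (f := fun p : ((ℝ × ℝ × ℝ) × ℝ) × ℝ =>
    (p.1.1.1, p.1.1.2.1, deflect p.1.1.1 p.1.1.2.1 p.1.1.2.2 p.1.2 p.2)) ?_
  unfold deflect
  fun_prop

theorem IsAdmissible.continuous_collisionRate (h : IsAdmissible φhat) (hε : 0 < ε)
    (hφ : IsTestFunction φ) :
    Continuous fun p : ℝ × ℝ × ℝ => collisionRate φhat ε φ p.1 p.2.1 p.2.2 := by
  unfold collisionRate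
  have hc : Continuous fun p : ℝ × ℝ × ℝ => p.2.2 := by fun_prop
  refine hc.mul (intervalIntegral.continuous_parametric_intervalIntegral_of_continuous' ?_ _ _)
  refine Continuous.mul ?_ hφ.continuous_gain_average
  exact (h.regularScattering hε).continuous.comp (f := fun p : (ℝ × ℝ × ℝ) × ℝ =>
    (p.1.2.2 * p.2, p.1.2.2 * (1 - p.2))) (by fun_prop)

theorem continuous_transferPath :
    Continuous fun p : (ℝ × ℝ) × ℝ => transferPath p.1.1 p.1.2 p.2 := by
  unfold transferPath; fun_prop

theorem IsAdmissible.continuous_collisionRate_average (h : IsAdmissible φhat) (hε : 0 < ε)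
    (hφ : IsTestFunction φ) :
    Continuous fun p : ℝ × ℝ =>
      ∫ σ in (0 : ℝ)..1, collisionRate φhat ε φ p.1 p.2 (transferPath p.1 p.2 σ) := by
  refine intervalIntegral.continuous_parametric_intervalIntegral_of_continuous' ?_ _ _
  exact (h.continuous_collisionRate hε hφ).comp (f := fun p : (ℝ × ℝ) × ℝ =>
    (p.1.1, p.1.2, transferPath p.1.1 p.1.2 p.2)) (by have := continuous_transferPath; fun_prop)

/-- The weight √x cancels the √x in the prefactor of `W`, and √(min y z)/√(yz) = 1/√(max y z). The
constant is ½ · 4π · 4. -/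
theorem IsAdmissible.J_eq_of_pos (h : IsAdmissible φhat) (hε : 0 < ε) (hφ : IsTestFunction φ)
    {y z : ℝ} (hy : 0 < y) (hz : 0 < z) :
    J φhat ε φ y z = 8 * Real.pi / √(max y z) *
      ∫ σ in (0 : ℝ)..1, collisionRate φhat ε φ y z (transferPath y z σ) := by
  obtain ⟨B, -, hB⟩ := hφ.exists_bound
  have hΦ := h.regularScattering hε
  have hc : Continuous (gain φ y z) :=
    hφ.continuous_gain.comp (f := fun x : ℝ => (y, z, x)) (by fun_prop)
  have key := integral_collision hΦ hc (abs_gain_le (fun x hx => (hB x hx).1) y z) hy.le hz.le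
  have hyz : 0 < y + z := by positivity
  have e1 : ∫ x in (0 : ℝ)..(y + z), K φhat ε φ x y z * √x = 4 * Real.pi / √(y * z) *
      ∫ x, gain φ y z x * (∫ u in Ioi (0 : ℝ), ∫ w in Ioi (0 : ℝ),
        PhiBE φhat ε (√2 * √u) (√2 * √w) * (√(gram y z x u w))⁻¹) := by
    rw [← setIntegral_eq_integral_of_forall_compl_eq_zero (s := Ioo 0 (y + z)),
      intervalIntegral.integral_of_le hyz.le, integral_Ioc_eq_integral_Ioo, ← integral_const_mul]
    · refine setIntegral_congr_fun measurableSet_Ioo fun x hx => ?_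
      rw [K_eq _ _ _ hx.1.le hy.le hz.le, W_eq_integral_gram hΦ hx.1 hy hz hx.2]
      have h1 : √(x * y * z) = √x * √(y * z) := by rw [mul_assoc, Real.sqrt_mul hx.1.le]
      have h2 := Real.sqrt_pos.2 hx.1
      have h3 := Real.sqrt_pos.2 (mul_pos hy hz)
      rw [h1]
      field_simp
    · intro x hx
      refine mul_eq_zero_of_right _ ?_
      refine setIntegral_eq_zero_of_forall_eq_zero fun u hu =>
        setIntegral_eq_zero_of_forall_eq_zero fun w hw => ?_
      have : gram y z x u w ≤ 0 := by
        by_contra! hc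
        exact hx (mem_Ioo_of_gram_pos hu hw hc)
      rw [Real.sqrt_eq_zero_of_nonpos this]
      simp
  rw [J, e1, key]
  have h4 : √(y * z) = √(min y z) * √(max y z) := by
    rw [← Real.sqrt_mul (le_min hy.le hz.le), min_mul_max]
  have h5 := Real.sqrt_pos.2 (lt_min hy hz)
  have h6 : 0 < √(max y z) := Real.sqrt_pos.2 (lt_max_of_lt_left hy)
  rw [h4]
  simp only [collisionRate]
  field_simp
  ring

/-- At y = 0 the only possible total transfer is q = z and the outgoing energy is zv, whatever σ and
η. The prescribed boundary value of `W` makes the general formula hold there too, so atoms at zero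
energy need no separate treatment later. -/
theorem J_zero_left_eq (φhat : ℝ → ℝ) (ε : ℝ) (φ : ℝ → ℝ) {z : ℝ} (hz : 0 < z) :
    J φhat ε φ 0 z = 8 * Real.pi / √(max 0 z) *
      ∫ σ in (0 : ℝ)..1, collisionRate φhat ε φ 0 z (transferPath 0 z σ) := by
  have hsz := Real.sqrt_pos.2 hz
  have e0 : ∀ σ, transferPath 0 z σ = z := fun σ => by
    rw [transferPath, Real.sqrt_zero, zero_sub, abs_neg, abs_of_pos hsz, zero_add, sub_self,
      zero_mul, add_zero, Real.sq_sqrt hz.le]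
  have e1 : ∀ v η, deflect 0 z z v η = z * v := fun v η => by
    rw [deflect, show 2 * (0 + z) * z - z ^ 2 - (0 - z) ^ 2 = 0 by ring, mul_zero, Real.sqrt_zero]
    ring
  have e2 := intervalIntegral.mul_integral_comp_mul_left (a := 0) (b := 1) (c := z)
    (f := fun x => PhiBE φhat ε (√2 * √x) (√2 * √(z - x)) * (Real.pi * gain φ 0 z x))
  rw [mul_zero, mul_one] at e2
  have e3 : ∀ v, z - z * v = z * (1 - v) := fun v => by ring
  simp only [e3] at e2
  simp only [e0, collisionRate, e1, intervalIntegral.integral_const, sub_zero, smul_eq_mul]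
  rw [e2, one_mul, J, zero_add, intervalIntegral.integral_of_le hz.le,
    intervalIntegral.integral_of_le hz.le, integral_Ioc_eq_integral_Ioo,
    integral_Ioc_eq_integral_Ioo, ← integral_const_mul, ← integral_const_mul]
  refine setIntegral_congr_fun measurableSet_Ioo fun x hx => ?_
  have hx0 := Real.sqrt_pos.2 hx.1
  rw [K_eq _ _ _ hx.1.le le_rfl hz.le, W, if_neg (by simp), if_neg (by simp),
    if_pos ⟨rfl, hx.1, hx.2⟩, max_eq_right hz.le, Real.sqrt_mul hx.1.le,
    Real.sqrt_mul zero_le_two, Real.sqrt_mul zero_le_two]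
  field_simp
  ring

theorem IsAdmissible.J_eq (h : IsAdmissible φhat) (hε : 0 < ε) (hφ : IsTestFunction φ)
    {y z : ℝ} (hy : 0 ≤ y) (hyz : y ≤ z) :
    J φhat ε φ y z = 8 * Real.pi / √z *
      ∫ σ in (0 : ℝ)..1, collisionRate φhat ε φ y z (transferPath y z σ) := by
  have e := congrArg (fun r => 8 * Real.pi / √r * ∫ σ in (0 : ℝ)..1,
    collisionRate φhat ε φ y z (transferPath y z σ)) (max_eq_right hyz)
  refine Eq.trans ?_ e
  rcases hy.eq_or_lt with rfl | hy'
  · rcases hyz.eq_or_lt with rfl | hz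
    · simp [J]
    · exact J_zero_left_eq φhat ε φ hz
  · exact h.J_eq_of_pos hε hφ hy' (hy'.trans_le hyz)

/-- The piecewise definition of `W` is avoided: by symmetry `J` is a prefactor times a continuous
function of min and max. -/
theorem IsAdmissible.measurable_J (h : IsAdmissible φhat) (hε : 0 < ε) (hφ : IsTestFunction φ) :
    Measurable fun p : ℝ≥0 × ℝ≥0 => J φhat ε φ p.1 p.2 := by
  have e : (fun p : ℝ≥0 × ℝ≥0 => J φhat ε φ p.1 p.2) = fun p : ℝ≥0 × ℝ≥0 =>
      8 * Real.pi / √(max (p.1 : ℝ) p.2) * ∫ σ in (0 : ℝ)..1, collisionRate φhat ε φ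
        (min (p.1 : ℝ) p.2) (max (p.1 : ℝ) p.2)
        (transferPath (min (p.1 : ℝ) p.2) (max (p.1 : ℝ) p.2) σ) := by
    funext p
    rw [← h.J_eq hε hφ (le_min p.1.coe_nonneg p.2.coe_nonneg) min_le_max]
    rcases le_total (p.1 : ℝ) p.2 with hp | hp
    · rw [min_eq_left hp, max_eq_right hp]
    · rw [min_eq_right hp, max_eq_left hp, h.J_comm hε p.1.coe_nonneg p.2.coe_nonneg]
  rw [e]
  have h1 := (h.continuous_collisionRate_average hε hφ).comp (f := fun p : ℝ≥0 × ℝ≥0 =>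
    (min (p.1 : ℝ) p.2, max (p.1 : ℝ) p.2)) (by fun_prop)
  exact Measurable.mul (by fun_prop) h1.measurable

end QuadraticKernel

/-! ### The density of grazing transfers: mass, first moment and tail. -/

section TransferDensity

variable {φhat : ℝ → ℝ}

/-- The density of small squared transfers; its total mass is fixed by the normalization of the
potential. -/
def transferDensity (φhat : ℝ → ℝ) (t : ℝ) : ℝ := φhat (√2 * √t) ^ 2 * t

/-- The mass of the transfer density up to `p`. -/
def transferMass (φhat : ℝ → ℝ) (p : ℝ) : ℝ :=
  ∫ v in (0 : ℝ)..1, p * transferDensity φhat (p * v)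

/-- The normalized first moment of the transfer density up to `p`. -/
def transferMoment (φhat : ℝ → ℝ) (p : ℝ) : ℝ :=
  ∫ v in (0 : ℝ)..1, v * (p * transferDensity φhat (p * v))

/-- A decreasing majorant of the tail of the transfer density. -/
def transferTail (φhat : ℝ → ℝ) (p : ℝ) : ℝ :=
  ∫ t in Ioi (0 : ℝ), transferDensity φhat t * min 1 (t / p)

theorem IsAdmissible.continuous_transferDensity (h : IsAdmissible φhat) :
    Continuous (transferDensity φhat) := by
  have h1 : Continuous fun t : ℝ => φhat (√2 * √t) :=
    h.continuous_comp (by fun_prop) fun p => by positivity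
  exact (h1.pow 2).mul continuous_id

theorem transferDensity_nonneg (φhat : ℝ → ℝ) {t : ℝ} (ht : 0 ≤ t) :
    0 ≤ transferDensity φhat t := by
  unfold transferDensity; positivity

/-- With t = r²/2 one has t dt = r³/2 dr, so the normalization 2π ∫ r³|φhat|² dr = 1 gives 1/(4π).
-/
theorem IsAdmissible.integral_transferDensity (h : IsAdmissible φhat) :
    ∫ t in Ioi (0 : ℝ), transferDensity φhat t = 1 / (4 * Real.pi) := by
  rw [← integral_comp_sq_Ioi]
  have h2 : (0 : ℝ) < √2 := by positivity
  have e := integral_comp_mul_left_Ioi (fun r => r ^ 3 * |φhat r| ^ 2 / √2) 0 h2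
  have e2 : ∀ s ∈ Ioi (0 : ℝ), 2 * s * transferDensity φhat (s ^ 2) =
      (√2 * s) ^ 3 * |φhat (√2 * s)| ^ 2 / √2 := by
    intro s hs
    rw [transferDensity, Real.sqrt_sq (mem_Ioi.1 hs).le, sq_abs, mul_pow,
      show √2 ^ 3 = √2 ^ 2 * √2 by ring, Real.sq_sqrt zero_le_two]
    field_simp
  rw [setIntegral_congr_fun measurableSet_Ioi e2, e, mul_zero, integral_div, smul_eq_mul]
  have h3 := h.normalized
  have hpi := Real.pi_pos
  have h4 : √2 * √2 = 2 := Real.mul_self_sqrt zero_le_two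
  field_simp
  rw [show √2 ^ 2 = 2 by rw [sq, h4]]
  linarith

/-- Integrability is hidden in the normalization: a non-integrable function has Bochner integral 0,
which is not 1/(4π). -/
theorem IsAdmissible.integrable_transferDensity (h : IsAdmissible φhat) :
    IntegrableOn (transferDensity φhat) (Ioi 0) := by
  by_contra hc
  have := h.integral_transferDensity
  rw [integral_undef hc] at this
  have := Real.pi_pos
  have : 0 < 1 / (4 * Real.pi) := by positivity
  linarith

theorem min_one_div_mem {t p : ℝ} (ht : 0 ≤ t) (hp : 0 ≤ p) :
    0 ≤ min 1 (t / p) ∧ min 1 (t / p) ≤ 1 :=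
  ⟨le_min zero_le_one (by positivity), min_le_left _ _⟩

theorem IsAdmissible.integrable_transferTail (h : IsAdmissible φhat) {p : ℝ} (hp : 0 ≤ p) :
    IntegrableOn (fun t => transferDensity φhat t * min 1 (t / p)) (Ioi 0) := by
  refine h.integrable_transferDensity.mul_bdd (c := 1) (by fun_prop) ?_
  filter_upwards [ae_restrict_mem measurableSet_Ioi] with t ht
  have := min_one_div_mem (mem_Ioi.1 ht).le hp
  rw [Real.norm_of_nonneg this.1]
  exact this.2

theorem transferTail_nonneg (φhat : ℝ → ℝ) {p : ℝ} (hp : 0 ≤ p) : 0 ≤ transferTail φhat p :=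
  setIntegral_nonneg measurableSet_Ioi fun _ ht =>
    mul_nonneg (transferDensity_nonneg _ (le_of_lt ht)) (min_one_div_mem (le_of_lt ht) hp).1

theorem four_pi_inv_le_one : 1 / (4 * Real.pi) ≤ 1 := by
  have := Real.pi_gt_three
  rw [div_le_one (by positivity)]
  linarith

theorem IsAdmissible.transferTail_le_one (h : IsAdmissible φhat) {p : ℝ} (hp : 0 ≤ p) :
    transferTail φhat p ≤ 1 := by
  refine le_trans ?_ (h.integral_transferDensity.trans_le four_pi_inv_le_one)
  refine setIntegral_mono_on (h.integrable_transferTail hp) h.integrable_transferDensity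
    measurableSet_Ioi fun t ht => ?_
  exact mul_le_of_le_one_right (transferDensity_nonneg _ (le_of_lt ht))
    (min_one_div_mem (le_of_lt ht) hp).2

theorem IsAdmissible.transferTail_anti (h : IsAdmissible φhat) {p q : ℝ} (hp : 0 < p)
    (hpq : p ≤ q) : transferTail φhat q ≤ transferTail φhat p := by
  refine setIntegral_mono_on (h.integrable_transferTail (hp.le.trans hpq))
    (h.integrable_transferTail hp.le) measurableSet_Ioi fun t ht => ?_
  have ht' : 0 < t := ht
  refine mul_le_mul_of_nonneg_left ?_ (transferDensity_nonneg _ ht'.le)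
  gcongr

theorem IsAdmissible.tendsto_transferTail (h : IsAdmissible φhat) :
    Tendsto (transferTail φhat) atTop (𝓝 0) := by
  have e : (0 : ℝ) = ∫ t in Ioi (0 : ℝ), (0 : ℝ) := by simp
  rw [e]
  refine tendsto_integral_filter_of_dominated_convergence (transferDensity φhat) ?_ ?_
    h.integrable_transferDensity ?_
  · filter_upwards [eventually_ge_atTop 0] with p hp
    exact (h.integrable_transferTail hp).aestronglyMeasurable
  · filter_upwards [eventually_ge_atTop 0] with p hp
    filter_upwards [ae_restrict_mem measurableSet_Ioi] with t ht
    have h0 := transferDensity_nonneg φhat (mem_Ioi.1 ht).le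
    have h1 := min_one_div_mem (mem_Ioi.1 ht).le hp
    rw [Real.norm_of_nonneg (mul_nonneg h0 h1.1)]
    exact mul_le_of_le_one_right h0 h1.2
  · filter_upwards with t
    have h1 : Tendsto (fun p : ℝ => min 1 (t / p)) atTop (𝓝 (min 1 0)) :=
      tendsto_const_nhds.min (tendsto_const_nhds.div_atTop tendsto_id)
    rw [min_eq_right zero_le_one] at h1
    simpa using h1.const_mul (transferDensity φhat t)

theorem transferMass_eq (φhat : ℝ → ℝ) {p : ℝ} (hp : 0 ≤ p) :
    transferMass φhat p = ∫ t in Ioc 0 p, transferDensity φhat t := by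
  have := intervalIntegral.mul_integral_comp_mul_left (a := 0) (b := 1) (c := p)
    (f := transferDensity φhat)
  rw [mul_zero, mul_one] at this
  rw [transferMass, intervalIntegral.integral_const_mul, this, intervalIntegral.integral_of_le hp]

theorem transferMoment_eq (φhat : ℝ → ℝ) {p : ℝ} (hp : 0 < p) :
    transferMoment φhat p = ∫ t in Ioc 0 p, transferDensity φhat t * min 1 (t / p) := by
  have := intervalIntegral.mul_integral_comp_mul_left (a := 0) (b := 1) (c := p)
    (f := fun t => transferDensity φhat t * (t / p))
  rw [mul_zero, mul_one, ← intervalIntegral.integral_const_mul,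
    intervalIntegral.integral_of_le hp.le] at this
  rw [transferMoment]
  refine Eq.trans ?_ (this.trans ?_)
  · refine intervalIntegral.integral_congr fun v _ => ?_
    field_simp
  · refine setIntegral_congr_fun measurableSet_Ioc fun t ht => ?_
    rw [min_eq_right ((div_le_one hp).2 ht.2)]

theorem IsAdmissible.transferMass_le_one (h : IsAdmissible φhat) {p : ℝ} (hp : 0 ≤ p) :
    transferMass φhat p ≤ 1 := by
  rw [transferMass_eq _ hp]
  refine le_trans ?_ (h.integral_transferDensity.trans_le four_pi_inv_le_one)
  refine setIntegral_mono_set h.integrable_transferDensity ?_ (LE.le.eventuallyLE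
    Ioc_subset_Ioi_self)
  filter_upwards [ae_restrict_mem measurableSet_Ioi] with t ht using
    transferDensity_nonneg _ (mem_Ioi.1 ht).le

/-- The weight min(1, t/p) equals t/p up to p, where it yields the normalized moment, and 1 beyond
p, where it yields the missing mass. `transferTail` thus controls both errors, is nonincreasing in p
> 0 and tends to 0. -/
theorem IsAdmissible.transferMoment_le (h : IsAdmissible φhat) {p : ℝ} (hp : 0 < p) :
    transferMoment φhat p ≤ transferTail φhat p := by
  rw [transferMoment_eq _ hp]
  refine setIntegral_mono_set (h.integrable_transferTail hp.le) ?_ (LE.le.eventuallyLE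
    Ioc_subset_Ioi_self)
  filter_upwards [ae_restrict_mem measurableSet_Ioi] with t ht using
    mul_nonneg (transferDensity_nonneg _ (le_of_lt ht)) (min_one_div_mem (le_of_lt ht) hp.le).1

theorem IsAdmissible.abs_transferMass_sub_le (h : IsAdmissible φhat) {p : ℝ} (hp : 0 < p) :
    |transferMass φhat p - 1 / (4 * Real.pi)| ≤ transferTail φhat p := by
  have hi := h.integrable_transferDensity
  have e : ∫ t in Ioi p, transferDensity φhat t = 1 / (4 * Real.pi) - transferMass φhat p := by
    rw [← h.integral_transferDensity, transferMass_eq _ hp.le, ← Ioc_union_Ioi_eq_Ioi hp.le,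
      setIntegral_union (Ioc_disjoint_Ioi le_rfl) measurableSet_Ioi
        (hi.mono_set Ioc_subset_Ioi_self) (hi.mono_set (Ioi_subset_Ioi hp.le))]
    ring
  have e2 : ∫ t in Ioi p, transferDensity φhat t =
      ∫ t in Ioi p, transferDensity φhat t * min 1 (t / p) := by
    refine setIntegral_congr_fun measurableSet_Ioi fun t ht => ?_
    rw [min_eq_left ((one_le_div hp).2 (le_of_lt ht)), mul_one]
  have h0 : 0 ≤ ∫ t in Ioi p, transferDensity φhat t :=
    setIntegral_nonneg measurableSet_Ioi fun t ht =>
      transferDensity_nonneg _ (hp.le.trans (le_of_lt ht))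
  rw [abs_sub_comm, ← e, abs_of_nonneg h0, e2]
  refine setIntegral_mono_set (h.integrable_transferTail hp.le) ?_ (LE.le.eventuallyLE
    (Ioi_subset_Ioi hp.le))
  filter_upwards [ae_restrict_mem measurableSet_Ioi] with t ht using
    mul_nonneg (transferDensity_nonneg _ (le_of_lt ht)) (min_one_div_mem (le_of_lt ht) hp.le).1

end TransferDensity

/-! ### Taylor expansion of the gain, averaged over the collision angle. -/

section AngularAverage

variable {φ : ℝ → ℝ}

/-- The leading coefficient of the angular average of the gain for small transfers. -/
def gainSlope (φ : ℝ → ℝ) (y z q : ℝ) : ℝ :=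
  (z - y) * (d1 φ y - d1 φ z) +
    1 / 4 * (d2 φ y + d2 φ z) * (2 * (y + z) * q - q ^ 2 - (y - z) ^ 2)

/-- The average of the gain over the collision angle. -/
def gainAverage (φ : ℝ → ℝ) (y z q v : ℝ) : ℝ :=
  ∫ η in (0 : ℝ)..Real.pi, gain φ y z (deflect y z q v η)

/-- The bracket under the root is 4yz - (q - y - z)², so the radius is at most √((1 - v)y · vz) · 2.
By the arithmetic-geometric mean inequality this does not exceed the centre y + v(z - y) = (1 - v)y
+ vz, nor its reflection. -/
theorem deflect_mem {y z q v : ℝ} (hy : 0 ≤ y) (hz : 0 ≤ z) (hv : v ∈ Icc (0 : ℝ) 1) (η : ℝ) :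
    0 ≤ deflect y z q v η ∧ 0 ≤ y + z - deflect y z q v η := by
  obtain ⟨h0, h1⟩ := hv
  have h1' : 0 ≤ 1 - v := by linarith
  have hρ0 := Real.sqrt_nonneg (v * (1 - v) * (2 * (y + z) * q - q ^ 2 - (y - z) ^ 2))
  have hle : v * (1 - v) * (2 * (y + z) * q - q ^ 2 - (y - z) ^ 2) ≤ v * (1 - v) * (4 * y * z) := by
    refine mul_le_mul_of_nonneg_left ?_ (by positivity)
    nlinarith [sq_nonneg (q - (y + z))]
  have hm1 : 0 ≤ y + v * (z - y) := by nlinarith [mul_nonneg h0 hz, mul_nonneg h1' hy]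
  have hm2 : 0 ≤ z - v * (z - y) := by nlinarith [mul_nonneg h0 hy, mul_nonneg h1' hz]
  have hρ1 : √(v * (1 - v) * (2 * (y + z) * q - q ^ 2 - (y - z) ^ 2)) ≤ y + v * (z - y) := by
    refine Real.sqrt_le_iff.2 ⟨hm1, hle.trans ?_⟩
    nlinarith [sq_nonneg ((1 - v) * y - v * z)]
  have hρ2 : √(v * (1 - v) * (2 * (y + z) * q - q ^ 2 - (y - z) ^ 2)) ≤ z - v * (z - y) := by
    refine Real.sqrt_le_iff.2 ⟨hm2, hle.trans ?_⟩
    nlinarith [sq_nonneg ((1 - v) * z - v * y)]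
  have hc1 := Real.neg_one_le_cos η
  have hc2 := Real.cos_le_one η
  unfold deflect
  constructor <;> nlinarith

/-- The squared displacement is O(v): the drift gives v²(z - y)² ≤ v(z - y)², the oscillation at
most v times the bracket in `hκ`, and these two add up to v(2(y + z)q - q²). -/
theorem sq_deflect_sub_le {y z q v : ℝ} (hv : v ∈ Icc (0 : ℝ) 1)
    (hκ : 0 ≤ 2 * (y + z) * q - q ^ 2 - (y - z) ^ 2) (η : ℝ) :
    (deflect y z q v η - y) ^ 2 ≤ 4 * (v * q * (y + z)) := by
  obtain ⟨h0, h1⟩ := hv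
  have h1' : 0 ≤ 1 - v := by linarith
  have e := Real.sq_sqrt (mul_nonneg (mul_nonneg h0 h1') hκ)
  have hc : Real.cos η ^ 2 ≤ 1 := Real.cos_sq_le_one η
  have hvv : v ^ 2 ≤ v := by nlinarith
  rw [show deflect y z q v η - y = v * (z - y) + √(v * (1 - v) *
    (2 * (y + z) * q - q ^ 2 - (y - z) ^ 2)) * Real.cos η by unfold deflect; ring]
  generalize √(v * (1 - v) * (2 * (y + z) * q - q ^ 2 - (y - z) ^ 2)) = ρ at *
  have g1 : ρ ^ 2 * Real.cos η ^ 2 ≤ ρ ^ 2 := mul_le_of_le_one_right (sq_nonneg _) hc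
  have g2 : (v * (z - y) + ρ * Real.cos η) ^ 2 ≤
      2 * (v * (z - y)) ^ 2 + 2 * (ρ ^ 2 * Real.cos η ^ 2) := by
    nlinarith [sq_nonneg (v * (z - y) - ρ * Real.cos η)]
  have g3 : v ^ 2 * (z - y) ^ 2 ≤ v * (z - y) ^ 2 := by gcongr
  have g4 : v * (1 - v) * (2 * (y + z) * q - q ^ 2 - (y - z) ^ 2) ≤
      v * (2 * (y + z) * q - q ^ 2 - (y - z) ^ 2) := by
    refine mul_le_mul_of_nonneg_right ?_ hκ
    nlinarith
  nlinarith [mul_nonneg h0 (sq_nonneg q)]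

theorem integral_quadratic_cos (a b c : ℝ) :
    ∫ η in (0 : ℝ)..Real.pi, (a + (b * Real.cos η + c * Real.cos η ^ 2)) =
      Real.pi * (a + c / 2) := by
  rw [intervalIntegral.integral_add (by simp) (Continuous.intervalIntegrable (by fun_prop) _ _),
    intervalIntegral.integral_add (Continuous.intervalIntegrable (by fun_prop) _ _)
      (Continuous.intervalIntegrable (by fun_prop) _ _), intervalIntegral.integral_const_mul,
    intervalIntegral.integral_const_mul, integral_cos, integral_cos_sq]
  simp
  ring

theorem integral_deflect (a b y z q v : ℝ) (h : 0 ≤ v * (1 - v) * (2 * (y + z) * q - q ^ 2 -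
    (y - z) ^ 2)) :
    ∫ η in (0 : ℝ)..Real.pi, (a * (deflect y z q v η - y) + b * (deflect y z q v η - y) ^ 2) =
      Real.pi * (a * (v * (z - y)) + b * ((v * (z - y)) ^ 2 +
        v * (1 - v) * (2 * (y + z) * q - q ^ 2 - (y - z) ^ 2) / 2)) := by
  have e := Real.sq_sqrt h
  unfold deflect
  generalize √(v * (1 - v) * (2 * (y + z) * q - q ^ 2 - (y - z) ^ 2)) = ρ at *
  rw [← e]
  have e1 : ∀ η, a * (y + v * (z - y) + ρ * Real.cos η - y) +
      b * (y + v * (z - y) + ρ * Real.cos η - y) ^ 2 =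
      (a * (v * (z - y)) + b * (v * (z - y)) ^ 2) +
        ((a * ρ + 2 * b * (v * (z - y)) * ρ) * Real.cos η + b * ρ ^ 2 * Real.cos η ^ 2) :=
    fun η => by ring
  simp only [e1]
  rw [integral_quadratic_cos]
  ring

theorem continuous_deflect (y z q v : ℝ) : Continuous (deflect y z q v) := by
  unfold deflect; fun_prop

theorem IsTestFunction.continuous_gain_deflect (h : IsTestFunction φ) (y z q v : ℝ) :
    Continuous fun η => gain φ y z (deflect y z q v η) := by
  have := continuous_deflect y z q v
  exact h.continuous_gain.comp (f := fun η => (y, z, deflect y z q v η)) (by fun_prop)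

/-- The two particles undergo opposite displacements x - y and y - x from y and z, so Taylor's
formula at y and at z gives the difference of the first derivatives and the sum of the second ones.
-/
theorem IsTestFunction.gain_expansion (h : IsTestFunction φ) {τ C : ℝ} (hC : 0 ≤ C)
    (hmod : ∀ x ξ, 0 ≤ x → 0 ≤ ξ → |d2 φ ξ - d2 φ x| ≤ τ + C * (ξ - x) ^ 2) {x y z : ℝ}
    (hy : 0 ≤ y) (hz : 0 ≤ z) (hx : 0 ≤ x) (hx' : 0 ≤ y + z - x) :
    |gain φ y z x - ((d1 φ y - d1 φ z) * (x - y) + (d2 φ y + d2 φ z) / 2 * (x - y) ^ 2)| ≤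
      2 * ((τ + C * (x - y) ^ 2) * (x - y) ^ 2) := by
  have key : ∀ u t : ℝ, 0 ≤ u → 0 ≤ t → |φ t - φ u - d1 φ u * (t - u) - d2 φ u * (t - u) ^ 2 / 2| ≤
      (τ + C * (t - u) ^ 2) * (t - u) ^ 2 := fun u t hu ht =>
    h.taylor_two ht hu fun s hs => by
      refine (hmod u s hu ((le_min hu ht).trans hs.1)).trans ?_
      have : |s - u| ≤ |t - u| := by
        have := abs_sub_left_of_mem_uIcc hs
        simpa [abs_sub_comm] using this
      have := sq_le_sq.2 this
      gcongr
  have h1 := key y x hy hx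
  have h2 := key z (y + z - x) hz hx'
  rw [show y + z - x - z = -(x - y) by ring, neg_sq] at h2
  rw [gain, max_eq_left hx, max_eq_left hx', max_eq_left hy, max_eq_left hz]
  rw [abs_le] at h1 h2 ⊢
  constructor <;> linarith [h1.1, h1.2, h2.1, h2.2]

/-- The mean displacement is v(z - y) and the mean square is v²(z - y)² + v(1 - v)κ/2, with κ the
bracket in `hκ`. `gainSlope` collects the coefficient of v; the v² part and the Taylor remainder
make up the error. -/
theorem IsTestFunction.abs_gainAverage_sub_le (h : IsTestFunction φ) {B τ C : ℝ}
    (hB : ∀ x, 0 ≤ x → |d2 φ x| ≤ B) (hC : 0 ≤ C)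
    (hmod : ∀ x ξ, 0 ≤ x → 0 ≤ ξ → |d2 φ ξ - d2 φ x| ≤ τ + C * (ξ - x) ^ 2) {y z q v : ℝ}
    (hy : 0 ≤ y) (hz : 0 ≤ z) (hq : 0 ≤ q) (hv : v ∈ Icc (0 : ℝ) 1)
    (hκ : 0 ≤ 2 * (y + z) * q - q ^ 2 - (y - z) ^ 2) :
    |gainAverage φ y z q v - Real.pi * (v * gainSlope φ y z q)| ≤
      Real.pi * (v * q * (y + z)) * (8 * τ + (2 * B + 32 * C * (q * (y + z))) * v) := by
  have hB0 : 0 ≤ B := (abs_nonneg _).trans (hB 0 le_rfl)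
  have hτ : 0 ≤ τ := by simpa using (abs_nonneg _).trans (hmod 0 0 le_rfl le_rfl)
  obtain ⟨h0, h1⟩ := hv
  have h1' : 0 ≤ 1 - v := by linarith
  have hpi := Real.pi_pos
  have hint := integral_deflect (d1 φ y - d1 φ z) ((d2 φ y + d2 φ z) / 2) y z q v
    (mul_nonneg (mul_nonneg h0 h1') hκ)
  set P := v * q * (y + z) with hP
  have hP0 : 0 ≤ P := by positivity
  have hdc := continuous_deflect y z q v
  have s1 : |gainAverage φ y z q v - ∫ η in (0 : ℝ)..Real.pi, ((d1 φ y - d1 φ z) *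
      (deflect y z q v η - y) + (d2 φ y + d2 φ z) / 2 * (deflect y z q v η - y) ^ 2)| ≤
      2 * ((τ + C * (4 * P)) * (4 * P)) * |Real.pi - 0| := by
    rw [gainAverage, ← intervalIntegral.integral_sub
      ((h.continuous_gain_deflect y z q v).intervalIntegrable _ _)
      (Continuous.intervalIntegrable (by fun_prop) _ _)]
    refine intervalIntegral.norm_integral_le_of_norm_le_const (E := ℝ) fun η _ => ?_
    have hm := deflect_mem (q := q) hy hz ⟨h0, h1⟩ η
    refine (h.gain_expansion hC hmod hy hz hm.1 hm.2).trans ?_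
    have := sq_deflect_sub_le ⟨h0, h1⟩ hκ η
    gcongr
  rw [hint, sub_zero, abs_of_pos hpi] at s1
  have hd : (z - y) ^ 2 + (2 * (y + z) * q - q ^ 2 - (y - z) ^ 2) ≤ 2 * (q * (y + z)) := by
    nlinarith [sq_nonneg q]
  -- Only the terms quadratic in v remain after subtracting the slope.
  have s2 : |Real.pi * ((d1 φ y - d1 φ z) * (v * (z - y)) + (d2 φ y + d2 φ z) / 2 *
      ((v * (z - y)) ^ 2 + v * (1 - v) * (2 * (y + z) * q - q ^ 2 - (y - z) ^ 2) / 2)) -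
      Real.pi * (v * gainSlope φ y z q)| ≤ Real.pi * (v * P * (2 * B)) := by
    have e : Real.pi * ((d1 φ y - d1 φ z) * (v * (z - y)) + (d2 φ y + d2 φ z) / 2 *
      ((v * (z - y)) ^ 2 + v * (1 - v) * (2 * (y + z) * q - q ^ 2 - (y - z) ^ 2) / 2)) -
      Real.pi * (v * gainSlope φ y z q) = Real.pi * (v ^ 2 * ((d2 φ y + d2 φ z) / 2 *
        ((z - y) ^ 2 - (2 * (y + z) * q - q ^ 2 - (y - z) ^ 2) / 2))) := by
      unfold gainSlope; ring
    rw [e, abs_mul, abs_of_pos hpi, abs_mul, abs_of_nonneg (sq_nonneg v), abs_mul]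
    have b1 : |(d2 φ y + d2 φ z) / 2| ≤ B := by
      have := abs_le.1 (hB y hy)
      have := abs_le.1 (hB z hz)
      rw [abs_le]; constructor <;> linarith
    have b2 : |(z - y) ^ 2 - (2 * (y + z) * q - q ^ 2 - (y - z) ^ 2) / 2| ≤ 2 * (q * (y + z)) := by
      rw [abs_le]; constructor <;> nlinarith [sq_nonneg (z - y)]
    calc Real.pi * (v ^ 2 * (|(d2 φ y + d2 φ z) / 2| *
          |(z - y) ^ 2 - (2 * (y + z) * q - q ^ 2 - (y - z) ^ 2) / 2|))
        ≤ Real.pi * (v ^ 2 * (B * (2 * (q * (y + z))))) := by gcongr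
      _ = _ := by rw [hP]; ring
  have s3 := abs_sub_le (gainAverage φ y z q v) (Real.pi * ((d1 φ y - d1 φ z) * (v * (z - y)) +
    (d2 φ y + d2 φ z) / 2 * ((v * (z - y)) ^ 2 +
      v * (1 - v) * (2 * (y + z) * q - q ^ 2 - (y - z) ^ 2) / 2)))
    (Real.pi * (v * gainSlope φ y z q))
  refine s3.trans ((add_le_add s1 s2).trans (le_of_eq ?_))
  rw [hP]; ring

theorem IsTestFunction.abs_gainSlope_le (h : IsTestFunction φ) {B : ℝ}
    (hB : ∀ x, 0 ≤ x → |d2 φ x| ≤ B) {y z q : ℝ} (hy : 0 ≤ y) (hz : 0 ≤ z)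
    (hκ : 0 ≤ 2 * (y + z) * q - q ^ 2 - (y - z) ^ 2) :
    |gainSlope φ y z q| ≤ 2 * B * (q * (y + z)) := by
  have hB0 : 0 ≤ B := (abs_nonneg _).trans (hB 0 le_rfl)
  have h1 : |(z - y) * (d1 φ y - d1 φ z)| ≤ B * (z - y) ^ 2 := by
    rw [abs_mul]
    calc |z - y| * |d1 φ y - d1 φ z| ≤ |z - y| * (B * |y - z|) := by
          gcongr; exact h.d1_lipschitz hB hy hz
      _ = _ := by rw [abs_sub_comm y z, ← sq_abs]; ring
  have h2 : |1 / 4 * (d2 φ y + d2 φ z) * (2 * (y + z) * q - q ^ 2 - (y - z) ^ 2)| ≤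
      B * (2 * (y + z) * q - q ^ 2 - (y - z) ^ 2) := by
    rw [abs_mul, abs_of_nonneg hκ]
    gcongr
    have := abs_le.1 (hB y hy)
    have := abs_le.1 (hB z hz)
    rw [abs_le]; constructor <;> linarith
  refine (abs_add_le _ _).trans ((add_le_add h1 h2).trans ?_)
  nlinarith [mul_nonneg hB0 (sq_nonneg q)]

/-- The expansion with the trivial modulus τ = 2B, C = 0. The constant is 20 = 16 + 2 + 2: Taylor
remainder, v² part, slope. -/
theorem IsTestFunction.abs_gainAverage_le (h : IsTestFunction φ) {B : ℝ}
    (hB : ∀ x, 0 ≤ x → |d2 φ x| ≤ B) {y z q v : ℝ}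
    (hy : 0 ≤ y) (hz : 0 ≤ z) (hq : 0 ≤ q) (hv : v ∈ Icc (0 : ℝ) 1)
    (hκ : 0 ≤ 2 * (y + z) * q - q ^ 2 - (y - z) ^ 2) :
    |gainAverage φ y z q v| ≤ 20 * Real.pi * B * (v * q * (y + z)) := by
  have hpi := Real.pi_pos
  have hB0 : 0 ≤ B := (abs_nonneg _).trans (hB 0 le_rfl)
  have h1 := h.abs_gainAverage_sub_le hB le_rfl (τ := 2 * B) (C := 0) (fun x ξ hx hξ => by
    have := abs_le.1 (hB x hx)
    have := abs_le.1 (hB ξ hξ)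
    rw [abs_le]; constructor <;> linarith) hy hz hq hv hκ
  have h2 := h.abs_gainSlope_le hB hy hz hκ
  have h3 : |Real.pi * (v * gainSlope φ y z q)| ≤ Real.pi * (v * (2 * B * (q * (y + z)))) := by
    rw [abs_mul, abs_of_pos hpi, abs_mul, abs_of_nonneg hv.1]
    have := hv.1
    gcongr
  have h4 := abs_sub_le (gainAverage φ y z q v) (Real.pi * (v * gainSlope φ y z q)) 0
  rw [sub_zero, sub_zero] at h4
  have h5 : 0 ≤ Real.pi * (v * q * (y + z)) := by have := hv.1; positivity
  have h6 : Real.pi * (v * q * (y + z)) * (2 * B * v) ≤ Real.pi * (v * q * (y + z)) * (2 * B) := by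
    exact mul_le_mul_of_nonneg_left (mul_le_of_le_one_right (by positivity) hv.2) h5
  nlinarith

/-- Exchanging the two incoming energies x and y + z - x amounts to v → 1 - v together with η → π -
η, and the gain is invariant. -/
theorem gainAverage_reflect (φ : ℝ → ℝ) (y z q v : ℝ) :
    gainAverage φ y z q (1 - v) = gainAverage φ y z q v := by
  have := intervalIntegral.integral_comp_sub_left (a := 0) (b := Real.pi)
    (fun η => gain φ y z (deflect y z q (1 - v) η)) Real.pi
  rw [sub_self, sub_zero] at this
  rw [gainAverage, ← this, gainAverage]
  refine intervalIntegral.integral_congr fun η _ => ?_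
  rw [← gain_reflect φ y z (deflect y z q v η)]
  congr 1
  unfold deflect
  rw [Real.cos_pi_sub, sub_sub_cancel, mul_comm (1 - v) v]
  ring

end AngularAverage

/-! ### The weak coupling limit of the quadratic kernel. -/

section WeakCoupling

variable {φhat φ : ℝ → ℝ}

/-- A weighted Young inequality puts the small factor `lam` on the mass term and 1/`lam` on the
moment term, which tends to 0. The interference is thus killed by letting p grow first and then
taking `lam` small. -/
theorem cross_term_le {f g v lam : ℝ} (h0 : 0 ≤ v) (h1 : v ≤ 1) (hl : 0 < lam) :
    2 * (|f| * |g|) * min v (1 - v) ≤ lam * (f ^ 2 * v + g ^ 2 * (1 - v)) +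
      2 / lam * (f ^ 2 * v * v + g ^ 2 * (1 - v) * (1 - v)) := by
  have key : ∀ f g v : ℝ, 0 ≤ v → v ≤ 1 - v → 2 * (|f| * |g|) * v ≤
      lam * (f ^ 2 * v + g ^ 2 * (1 - v)) +
        2 / lam * (f ^ 2 * v * v + g ^ 2 * (1 - v) * (1 - v)) := by
    intro f g v h0 h1
    have e1 : 2 * (|f| * |g|) ≤ lam * f ^ 2 + 1 / lam * g ^ 2 := by
      rw [← sq_abs f, ← sq_abs g]
      have : 0 ≤ (lam * |f| - |g|) ^ 2 / lam := by positivity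
      have e : (lam * |f| - |g|) ^ 2 / lam =
          lam * |f| ^ 2 + 1 / lam * |g| ^ 2 - 2 * (|f| * |g|) := by field_simp; ring
      linarith
    -- As 1 - v ≥ 1/2, the amplitude g is evaluated away from its concentration point, so its
    -- contribution is dominated by the moment density.
    have e2 : v ≤ 2 * ((1 - v) * (1 - v)) := by nlinarith
    have e3 : 0 ≤ lam * (g ^ 2 * (1 - v)) := by
      have : 0 ≤ 1 - v := by linarith
      positivity
    have e4 : 0 ≤ 2 / lam * (f ^ 2 * v * v) := by positivity
    have e5 : 1 / lam * g ^ 2 * v ≤ 1 / lam * g ^ 2 * (2 * ((1 - v) * (1 - v))) := by gcongr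
    have e6 := mul_le_mul_of_nonneg_right e1 h0
    have e7 : 1 / lam * g ^ 2 * (2 * ((1 - v) * (1 - v))) = 2 / lam * (g ^ 2 * (1 - v) * (1 - v)) := by
      ring
    nlinarith
  rcases le_total v (1 - v) with h | h
  · rw [min_eq_left h]
    exact key f g v h0 h
  · rw [min_eq_right h]
    have := key g f (1 - v) (by linarith) (by linarith)
    rw [sub_sub_cancel] at this
    linarith [mul_comm |f| |g|]

theorem integral_reflect (f : ℝ → ℝ) : ∫ v in (0 : ℝ)..1, f (1 - v) = ∫ v in (0 : ℝ)..1, f v := by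
  have := intervalIntegral.integral_comp_sub_left (a := 0) (b := 1) f 1
  rwa [sub_self, sub_zero] at this

/-- Expanding the square: by reflection both squares contribute the same integral of a(v) ≈ sv,
about s times the mass 1/(4π), hence s/(2π) in total. The cross term is bounded by `cross_term_le`,
since the symmetry of a improves |a| ≤ Mv to M min(v, 1 - v). -/
theorem IsAdmissible.rate_estimate (h : IsAdmissible φhat) {p lam M N₀ N₁ s : ℝ} {a : ℝ → ℝ}
    (hp : 0 < p) (hl : 0 < lam) (ha : Continuous a) (hsymm : ∀ v, a (1 - v) = a v)
    (hM : ∀ v ∈ Icc (0 : ℝ) 1, |a v| ≤ M * v)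
    (hN : ∀ v ∈ Icc (0 : ℝ) 1, |a v - s * v| ≤ v * (N₀ + N₁ * v)) (hM0 : 0 ≤ M) (hN0 : 0 ≤ N₀)
    (hN1 : 0 ≤ N₁) :
    |(∫ v in (0 : ℝ)..1, p ^ 2 * (φhat (√2 * √(p * v)) + φhat (√2 * √(p * (1 - v)))) ^ 2 * a v) -
      s / (2 * Real.pi)| ≤ 2 * N₀ + 2 * M * lam +
        (2 * N₁ + 2 * |s| + 4 * M / lam) * transferTail φhat p := by
  have hpi := Real.pi_pos
  set f : ℝ → ℝ := fun t => φhat (√2 * √t) with hf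
  have hfc : Continuous f := h.continuous_comp (by fun_prop) fun p => by positivity
  have hf1 : Continuous fun v => f (p * v) := hfc.comp (by fun_prop)
  have hf2 : Continuous fun v => f (p * (1 - v)) := hfc.comp (by fun_prop)
  set w : ℝ → ℝ := fun v => p * transferDensity φhat (p * v) with hw
  have hwe : ∀ v, w v = p ^ 2 * (f (p * v) ^ 2 * v) := fun v => by
    simp only [hw, hf, transferDensity]; ring
  have hwc : Continuous w := continuous_const.mul (h.continuous_transferDensity.comp (by fun_prop))
  have hwc' : Continuous fun v => w (1 - v) := hwc.comp (by fun_prop)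
  have hw0 : ∀ v, 0 ≤ v → 0 ≤ w v := fun v hv => by rw [hwe]; positivity
  have im0 : ∫ v in (0 : ℝ)..1, w v = transferMass φhat p := rfl
  have im1 : ∫ v in (0 : ℝ)..1, v * w v = transferMoment φhat p := rfl
  have m0le := h.transferMass_le_one hp.le
  have m1le := h.transferMoment_le hp
  have msub := h.abs_transferMass_sub_le hp
  have hG := transferTail_nonneg φhat hp.le
  have I1 : Continuous fun v => p ^ 2 * f (p * v) ^ 2 * a v := by fun_prop
  have I2 : Continuous fun v => p ^ 2 * f (p * (1 - v)) ^ 2 * a v := by fun_prop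
  have I3 : Continuous fun v => p ^ 2 * (2 * (f (p * v) * f (p * (1 - v)))) * a v := by fun_prop
  have split : (∫ v in (0 : ℝ)..1, p ^ 2 * (f (p * v) + f (p * (1 - v))) ^ 2 * a v) =
      2 * (∫ v in (0 : ℝ)..1, p ^ 2 * f (p * v) ^ 2 * a v) +
        ∫ v in (0 : ℝ)..1, p ^ 2 * (2 * (f (p * v) * f (p * (1 - v)))) * a v := by
    have e2 := integral_reflect fun v => p ^ 2 * f (p * v) ^ 2 * a v
    simp only [hsymm] at e2
    rw [two_mul]
    nth_rewrite 2 [← e2]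
    have I12 : Continuous fun v => p ^ 2 * f (p * v) ^ 2 * a v + p ^ 2 * f (p * (1 - v)) ^ 2 * a v :=
      I1.add I2
    rw [← intervalIntegral.integral_add (I1.intervalIntegrable _ _) (I2.intervalIntegrable _ _),
      ← intervalIntegral.integral_add (I12.intervalIntegrable _ _) (I3.intervalIntegrable _ _)]
    refine intervalIntegral.integral_congr fun v _ => ?_
    ring
  have T1 : |(∫ v in (0 : ℝ)..1, p ^ 2 * f (p * v) ^ 2 * a v) - s * transferMass φhat p| ≤
      N₀ * transferMass φhat p + N₁ * transferMoment φhat p := by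
    rw [← im0, ← im1, ← intervalIntegral.integral_const_mul, ← intervalIntegral.integral_const_mul,
      ← intervalIntegral.integral_const_mul, ← intervalIntegral.integral_sub
        (I1.intervalIntegrable _ _) (Continuous.intervalIntegrable (by fun_prop) _ _),
      ← intervalIntegral.integral_add (Continuous.intervalIntegrable (by fun_prop) _ _)
        (Continuous.intervalIntegrable (by fun_prop) _ _)]
    refine intervalIntegral.norm_integral_le_of_norm_le (E := ℝ) zero_le_one
      (ae_of_all _ fun v hv => ?_) (Continuous.intervalIntegrable (by fun_prop) _ _)
    have hv' : v ∈ Icc (0 : ℝ) 1 := Ioc_subset_Icc_self hv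
    have e : p ^ 2 * f (p * v) ^ 2 * a v - s * w v = p ^ 2 * f (p * v) ^ 2 * (a v - s * v) := by
      rw [hwe]; ring
    rw [e, Real.norm_eq_abs, abs_mul, abs_of_nonneg (by positivity)]
    refine (mul_le_mul_of_nonneg_left (hN v hv') (by positivity)).trans (le_of_eq ?_)
    rw [hwe]; ring
  have T3 : |∫ v in (0 : ℝ)..1, p ^ 2 * (2 * (f (p * v) * f (p * (1 - v)))) * a v| ≤
      M * (lam * (2 * transferMass φhat p) + 2 / lam * (2 * transferMoment φhat p)) := by
    have e1 : 2 * transferMass φhat p = ∫ v in (0 : ℝ)..1, (w v + w (1 - v)) := by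
      rw [intervalIntegral.integral_add (hwc.intervalIntegrable _ _) (hwc'.intervalIntegrable _ _),
        integral_reflect, im0, two_mul]
    have e2 : 2 * transferMoment φhat p = ∫ v in (0 : ℝ)..1, (v * w v + (1 - v) * w (1 - v)) := by
      rw [intervalIntegral.integral_add (Continuous.intervalIntegrable (by fun_prop) _ _)
        (Continuous.intervalIntegrable (by fun_prop) _ _), integral_reflect (fun v => v * w v), im1,
        two_mul]
    rw [e1, e2, ← intervalIntegral.integral_const_mul, ← intervalIntegral.integral_const_mul,
      ← intervalIntegral.integral_add (Continuous.intervalIntegrable (by fun_prop) _ _)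
        (Continuous.intervalIntegrable (by fun_prop) _ _), ← intervalIntegral.integral_const_mul]
    refine intervalIntegral.norm_integral_le_of_norm_le (E := ℝ) zero_le_one
      (ae_of_all _ fun v hv => ?_) (Continuous.intervalIntegrable (by fun_prop) _ _)
    have hv' : v ∈ Icc (0 : ℝ) 1 := Ioc_subset_Icc_self hv
    have hv1 : 1 - v ∈ Icc (0 : ℝ) 1 := ⟨by linarith [hv'.2], by linarith [hv'.1]⟩
    have hmin : |a v| ≤ M * min v (1 - v) := by
      have h1 := hM v hv'
      have h2 := hM _ hv1
      rw [hsymm] at h2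
      rcases min_choice v (1 - v) with hh | hh <;> rw [hh] <;> assumption
    have hcr := cross_term_le (f := f (p * v)) (g := f (p * (1 - v))) hv'.1 hv'.2 hl
    rw [Real.norm_eq_abs, abs_mul, abs_mul, abs_of_nonneg (sq_nonneg p), abs_mul, abs_mul, abs_two]
    calc p ^ 2 * (2 * (|f (p * v)| * |f (p * (1 - v))|)) * |a v|
        ≤ p ^ 2 * (2 * (|f (p * v)| * |f (p * (1 - v))|)) * (M * min v (1 - v)) := by gcongr
      _ = M * (p ^ 2 * (2 * (|f (p * v)| * |f (p * (1 - v))|) * min v (1 - v))) := by ring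
      _ ≤ M * (p ^ 2 * (lam * (f (p * v) ^ 2 * v + f (p * (1 - v)) ^ 2 * (1 - v)) +
          2 / lam * (f (p * v) ^ 2 * v * v + f (p * (1 - v)) ^ 2 * (1 - v) * (1 - v)))) := by
        gcongr
      _ = _ := by rw [hwe, hwe]; ring
  have hm0 : 0 ≤ transferMass φhat p := by
    rw [← im0]
    exact intervalIntegral.integral_nonneg zero_le_one fun v hv => hw0 v hv.1
  have hm1 : 0 ≤ transferMoment φhat p := by
    rw [← im1]
    exact intervalIntegral.integral_nonneg zero_le_one fun v hv => mul_nonneg hv.1 (hw0 v hv.1)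
  have T2 : |2 * (s * transferMass φhat p) - s / (2 * Real.pi)| ≤ 2 * |s| * transferTail φhat p := by
    have e : 2 * (s * transferMass φhat p) - s / (2 * Real.pi) =
        2 * s * (transferMass φhat p - 1 / (4 * Real.pi)) := by field_simp; ring
    rw [e, abs_mul, abs_mul, abs_two]
    gcongr
  have B1 : N₀ * transferMass φhat p + N₁ * transferMoment φhat p ≤
      N₀ * 1 + N₁ * transferTail φhat p := by gcongr
  have B3 : M * (lam * (2 * transferMass φhat p) + 2 / lam * (2 * transferMoment φhat p)) ≤
      M * (lam * (2 * 1) + 2 / lam * (2 * transferTail φhat p)) := by gcongr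
  have e4 : M * (lam * (2 * 1) + 2 / lam * (2 * transferTail φhat p)) =
      2 * M * lam + 4 * M / lam * transferTail φhat p := by ring
  rw [split]
  rw [abs_le] at T1 T2 T3 ⊢
  constructor <;> linarith [T1.1, T1.2, T2.1, T2.2, T3.1, T3.2]

theorem continuous_gainAverage (hφ : IsTestFunction φ) (y z q : ℝ) :
    Continuous (gainAverage φ y z q) :=
  hφ.continuous_gain_average.comp (f := fun v : ℝ => ((y, z, q), v)) (by fun_prop)

/-- The scaling identity: ε enters only through p = q/ε², since qε⁻⁴ = p²/q. -/
theorem collisionRate_eq {ε : ℝ} (hε : 0 < ε) {q : ℝ} (hq : 0 < q) (y z : ℝ) :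
    collisionRate φhat ε φ y z q = ∫ v in (0 : ℝ)..1, (q / ε ^ 2) ^ 2 *
      (φhat (√2 * √(q / ε ^ 2 * v)) + φhat (√2 * √(q / ε ^ 2 * (1 - v)))) ^ 2 *
        (gainAverage φ y z q v / q) := by
  rw [collisionRate, ← intervalIntegral.integral_const_mul]
  refine intervalIntegral.integral_congr fun v _ => ?_
  have e : ∀ v, √(q / ε ^ 2 * v) = √(q * v) / ε := fun v => by
    rw [div_mul_eq_mul_div, Real.sqrt_div' _ (by positivity), Real.sqrt_sq hε.le]
  simp only [PhiBE, e, gainAverage, ← mul_div_assoc]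
  field_simp

/-- `rate_estimate` with s = π `gainSlope`/q. Division by q is harmless because the bounds on the
gain carry a factor q; y + z ≤ 2z and q ≤ 4z express every constant in z. -/
theorem IsAdmissible.abs_collisionRate_sub_le (h : IsAdmissible φhat) {ε : ℝ} (hε : 0 < ε)
    (hφ : IsTestFunction φ) {B τ C lam : ℝ} (hl : 0 < lam) (hB : ∀ x, 0 ≤ x → |d2 φ x| ≤ B)
    (hC : 0 ≤ C) (hmod : ∀ x ξ, 0 ≤ x → 0 ≤ ξ → |d2 φ ξ - d2 φ x| ≤ τ + C * (ξ - x) ^ 2)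
    {y z q : ℝ} (hy : 0 ≤ y) (hyz : y ≤ z) (hq : 0 < q) (hqz : q ≤ 4 * z)
    (hκ : 0 ≤ 2 * (y + z) * q - q ^ 2 - (y - z) ^ 2) :
    |collisionRate φhat ε φ y z q - 1 / 2 * (gainSlope φ y z q / q)| ≤
      2 * Real.pi * z * (16 * τ + 40 * B * lam +
        (8 * B + 512 * C * z ^ 2 + 80 * B / lam) * transferTail φhat (q / ε ^ 2)) := by
  have hz : 0 ≤ z := hy.trans hyz
  have hpi := Real.pi_pos
  have hB0 : 0 ≤ B := (abs_nonneg _).trans (hB 0 le_rfl)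
  have hτ : 0 ≤ τ := by simpa using (abs_nonneg _).trans (hmod 0 0 le_rfl le_rfl)
  have hqyz : q * (y + z) ≤ 4 * z * (2 * z) := by gcongr; linarith
  have est := h.rate_estimate (p := q / ε ^ 2) (lam := lam) (M := 40 * Real.pi * B * z)
    (N₀ := 16 * Real.pi * τ * z) (N₁ := 2 * Real.pi * z * (2 * B + 256 * C * z ^ 2))
    (s := Real.pi * (gainSlope φ y z q / q)) (a := fun v => gainAverage φ y z q v / q)
    (by positivity) hl ((continuous_gainAverage hφ y z q).div_const q)
    (fun v => by rw [gainAverage_reflect])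
    (fun v hv => by
      have h1 := hφ.abs_gainAverage_le hB hy hz hq.le hv hκ
      rw [abs_div, abs_of_pos hq, div_le_iff₀ hq]
      refine h1.trans ?_
      have h0 : 0 ≤ v * q := mul_nonneg hv.1 hq.le
      calc 20 * Real.pi * B * (v * q * (y + z)) ≤ 20 * Real.pi * B * (v * q * (2 * z)) := by
            gcongr; linarith
        _ = _ := by ring)
    (fun v hv => by
      have h1 := hφ.abs_gainAverage_sub_le hB hC hmod hy hz hq.le hv hκ
      have h0 := hv.1
      have e : gainAverage φ y z q v / q - Real.pi * (gainSlope φ y z q / q) * v =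
          (gainAverage φ y z q v - Real.pi * (v * gainSlope φ y z q)) / q := by
        field_simp
      rw [e, abs_div, abs_of_pos hq, div_le_iff₀ hq]
      refine h1.trans ?_
      calc Real.pi * (v * q * (y + z)) * (8 * τ + (2 * B + 32 * C * (q * (y + z))) * v)
          ≤ Real.pi * (v * q * (2 * z)) * (8 * τ + (2 * B + 32 * C * (4 * z * (2 * z))) * v) := by
            gcongr; linarith
        _ = _ := by ring)
    (by positivity) (by positivity) (by positivity)
  have hs : |Real.pi * (gainSlope φ y z q / q)| ≤ 4 * Real.pi * B * z := by
    have h1 := hφ.abs_gainSlope_le hB hy hz hκ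
    rw [abs_mul, abs_of_pos hpi, abs_div, abs_of_pos hq, mul_div_assoc', div_le_iff₀ hq]
    calc Real.pi * |gainSlope φ y z q| ≤ Real.pi * (2 * B * (q * (2 * z))) := by
          gcongr
          refine h1.trans ?_
          gcongr
          linarith
      _ = _ := by ring
  rw [← collisionRate_eq hε hq] at est
  have e2 : Real.pi * (gainSlope φ y z q / q) / (2 * Real.pi) =
      1 / 2 * (gainSlope φ y z q / q) := by field_simp
  rw [e2] at est
  refine est.trans ?_
  have hG := transferTail_nonneg φhat (show 0 ≤ q / ε ^ 2 by positivity)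
  have h3 : (2 * (2 * Real.pi * z * (2 * B + 256 * C * z ^ 2)) +
      2 * |Real.pi * (gainSlope φ y z q / q)| + 4 * (40 * Real.pi * B * z) / lam) *
        transferTail φhat (q / ε ^ 2) ≤ (2 * (2 * Real.pi * z * (2 * B + 256 * C * z ^ 2)) +
      2 * (4 * Real.pi * B * z) + 4 * (40 * Real.pi * B * z) / lam) *
        transferTail φhat (q / ε ^ 2) := by gcongr
  refine (add_le_add_right h3 _).trans (le_of_eq ?_)
  field_simp
  ring

/-- The path between the endpoints |√y - √z| and √y + √z dominates σ√z. Hence q ≥ zσ², so p = q/ε²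
is large except for σ near 0. -/
theorem transferPath_bounds {y z σ : ℝ} (hy : 0 ≤ y) (hyz : y ≤ z)
    (hσ : σ ∈ Icc (0 : ℝ) 1) :
    z * σ ^ 2 ≤ transferPath y z σ ∧ transferPath y z σ ≤ 4 * z ∧
      0 ≤ 2 * (y + z) * transferPath y z σ - transferPath y z σ ^ 2 - (y - z) ^ 2 := by
  have hz := hy.trans hyz
  obtain ⟨h0, h1⟩ := hσ
  have ha : 0 ≤ |√y - √z| := abs_nonneg _
  have hab := high_sub_low y z
  have hm : 0 ≤ √(min y z) := Real.sqrt_nonneg _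
  have hsy := Real.sqrt_nonneg y
  have hsz := Real.sqrt_nonneg z
  have hyz' := Real.sqrt_le_sqrt hyz
  have ez := Real.sq_sqrt hz
  have t1 : |√y - √z| ≤ |√y - √z| + (√y + √z - |√y - √z|) * σ := by
    have : 0 ≤ (√y + √z - |√y - √z|) * σ := mul_nonneg (by linarith) h0
    linarith
  have t2 : |√y - √z| + (√y + √z - |√y - √z|) * σ ≤ √y + √z := by
    nlinarith [mul_nonneg (show 0 ≤ √y + √z - |√y - √z| by linarith) (show 0 ≤ 1 - σ by linarith)]
  have t3 : √z * σ ≤ |√y - √z| + (√y + √z - |√y - √z|) * σ := by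
    nlinarith [mul_nonneg ha (show 0 ≤ 1 - σ by linarith), mul_nonneg hsy h0]
  refine ⟨?_, ?_, ?_⟩
  · calc z * σ ^ 2 = (√z * σ) ^ 2 := by rw [mul_pow, ez]
      _ ≤ _ := by unfold transferPath; gcongr
  · calc transferPath y z σ ≤ (√z + √z) ^ 2 := by
          unfold transferPath
          exact pow_le_pow_left₀ (ha.trans t1) (t2.trans (by linarith)) 2
      _ = 4 * z := by rw [← two_mul, mul_pow, ez]; norm_num
  · unfold transferPath
    rw [kappa_eq hy hz]
    exact mul_nonneg (sub_nonneg.2 (pow_le_pow_left₀ ha t1 2))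
      (sub_nonneg.2 (pow_le_pow_left₀ (ha.trans t1) t2 2))

/-- With q = t² and t affine in σ, the integrand is a combination of (z - y)/t², of integral 1, and
2(y + z) - t², of integral z + 5y/3. The terms in z cancel in the coefficient of d2 φ y + d2 φ z,
which leaves 2y/3. -/
theorem landauNumerator_eq_integral (φ : ℝ → ℝ) {y z : ℝ} (hy : 0 ≤ y) (hyz : y ≤ z) (hz : 0 < z) :
    IntervalIntegrable (fun σ => gainSlope φ y z (transferPath y z σ) / transferPath y z σ)
      volume 0 1 ∧
    ∫ σ in (0 : ℝ)..1, gainSlope φ y z (transferPath y z σ) / transferPath y z σ =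
      landauNumerator φ y z := by
  have ey := Real.sq_sqrt hy
  have ez := Real.sq_sqrt hz.le
  have hsz := Real.sqrt_pos.2 hz
  have hsy := Real.sqrt_nonneg y
  have hsyz := Real.sqrt_le_sqrt hyz
  set S := d2 φ y + d2 φ z with hS
  set c := d1 φ y - d1 φ z with hc
  have hpath : ∀ σ, transferPath y z σ = (√z - √y + 2 * √y * σ) ^ 2 := fun σ => by
    rw [transferPath, abs_of_nonpos (by linarith)]; ring
  suffices ∃ g : ℝ → ℝ, IntervalIntegrable g volume 0 1 ∧
      (∫ σ in (0 : ℝ)..1, g σ = landauNumerator φ y z) ∧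
      ∀ σ ∈ Ioc (0 : ℝ) 1, gainSlope φ y z (transferPath y z σ) / transferPath y z σ = g σ by
    obtain ⟨g, g1, g2, g3⟩ := this
    constructor
    · exact g1.congr fun σ hσ => (g3 σ (by rwa [uIoc_of_le zero_le_one] at hσ)).symm
    · rw [← g2]
      refine intervalIntegral.integral_congr_ae (ae_of_all _ fun σ hσ => g3 σ ?_)
      rwa [uIoc_of_le zero_le_one] at hσ
  -- The antiderivatives here and in `F1` avoid division by √y, so y = 0 is included.
  have F3 : ∀ σ, HasDerivAt (fun σ : ℝ => (2 * (y + z)) * σ - ((√z - √y) ^ 2 * σ +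
      (√z - √y) * (2 * √y) * σ ^ 2 + (2 * √y) ^ 2 * σ ^ 3 / 3))
      (2 * (y + z) - (√z - √y + 2 * √y * σ) ^ 2) σ := fun σ => by
    have e1 := (hasDerivAt_id σ).const_mul (2 * (y + z))
    have e2 := (hasDerivAt_id σ).const_mul ((√z - √y) ^ 2)
    have e3 := (hasDerivAt_pow 2 σ).const_mul ((√z - √y) * (2 * √y))
    have e4 := ((hasDerivAt_pow 3 σ).const_mul ((2 * √y) ^ 2)).div_const 3
    refine (e1.sub ((e2.add e3).add e4)).congr_deriv ?_
    norm_num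
    ring
  -- If y = z then t vanishes at σ = 0, but the singular coefficient z - y vanishes as well.
  rcases hyz.eq_or_lt with rfl | hlt
  · refine ⟨fun σ => 1 / 4 * S * (2 * (y + y) - (√y - √y + 2 * √y * σ) ^ 2),
      Continuous.intervalIntegrable (by fun_prop) _ _, ?_, fun σ hσ => ?_⟩
    · rw [intervalIntegral.integral_const_mul, intervalIntegral.integral_eq_sub_of_hasDerivAt
        (fun σ _ => F3 σ) (Continuous.intervalIntegrable (by fun_prop) _ _), landauNumerator,
        min_self, sub_self (d1 φ y), zero_mul, ← hS, sub_self (√y)]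
      simp only [mul_pow, ey]
      ring
    · have h0 : 0 < σ := hσ.1
      have hp : 0 < transferPath y y σ := by rw [hpath]; positivity
      change _ = 1 / 4 * S * (2 * (y + y) - (√y - √y + 2 * √y * σ) ^ 2)
      rw [← hpath, gainSlope, div_eq_iff hp.ne', ← hS]
      ring
  · have hslt := Real.sqrt_lt_sqrt hy hlt
    have htpos : ∀ σ ∈ Icc (0 : ℝ) 1, 0 < √z - √y + 2 * √y * σ := fun σ hσ => by
      have := mul_nonneg hsy hσ.1
      linarith
    have F1 : ∀ σ ∈ Icc (0 : ℝ) 1, HasDerivAt (fun σ : ℝ => (√z + √y) * σ /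
        (√z - √y + 2 * √y * σ)) ((z - y) / (√z - √y + 2 * √y * σ) ^ 2) σ := fun σ hσ => by
      have e1 := (hasDerivAt_id σ).const_mul (√z + √y)
      have e2 := ((hasDerivAt_id σ).const_mul (2 * √y)).const_add (√z - √y)
      refine (e1.div e2 (htpos σ hσ).ne').congr_deriv ?_
      congr 1
      simp only [id]
      nlinarith
    have hcont : ContinuousOn (fun σ : ℝ => (z - y) / (√z - √y + 2 * √y * σ) ^ 2) (Icc 0 1) := by
      refine ContinuousOn.div (by fun_prop) (by fun_prop) fun σ hσ => ?_
      exact (pow_pos (htpos σ hσ) 2).ne'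
    have i1 : IntervalIntegrable (fun σ : ℝ => (z - y) / (√z - √y + 2 * √y * σ) ^ 2) volume 0 1 :=
      ContinuousOn.intervalIntegrable (by rwa [uIcc_of_le zero_le_one])
    have i3 : IntervalIntegrable (fun σ : ℝ => 2 * (y + z) - (√z - √y + 2 * √y * σ) ^ 2)
        volume 0 1 := Continuous.intervalIntegrable (by fun_prop) _ _
    refine ⟨fun σ => (c - 1 / 4 * S * (z - y)) * ((z - y) / (√z - √y + 2 * √y * σ) ^ 2) +
      1 / 4 * S * (2 * (y + z) - (√z - √y + 2 * √y * σ) ^ 2),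
      (i1.const_mul _).add (i3.const_mul _), ?_, fun σ hσ => ?_⟩
    · rw [intervalIntegral.integral_add (i1.const_mul _) (i3.const_mul _),
        intervalIntegral.integral_const_mul, intervalIntegral.integral_const_mul,
        intervalIntegral.integral_eq_sub_of_hasDerivAt (fun σ _ => F3 σ) i3,
        intervalIntegral.integral_eq_sub_of_hasDerivAt
          (fun σ hσ => F1 σ (by rwa [uIcc_of_le zero_le_one] at hσ)) i1, landauNumerator,
        min_eq_left hyz, Real.sign_of_neg (by linarith), ← hS, ← hc]
      have e5 : (√z + √y) * 1 / (√z - √y + 2 * √y * 1) = 1 := by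
        rw [div_eq_one_iff_eq (by linarith)]; ring
      rw [e5, mul_zero, zero_div]
      clear_value S c
      generalize √z = a at *
      generalize √y = b at *
      rw [← ey, ← ez]
      ring
    · have hp := pow_pos (htpos σ (Ioc_subset_Icc_self hσ)) 2
      dsimp only
      rw [hpath, gainSlope, ← hS, ← hc]
      generalize (√z - √y + 2 * √y * σ) ^ 2 = q at *
      field_simp
      ring

theorem L_comm (φ : ℝ → ℝ) (x y : ℝ) : L φ x y = L φ y x := by
  rw [L, L, max_comm, min_comm, show y - x = -(x - y) by ring, Real.sign_neg]
  ring

/-- The rate error is integrated over σ. For σ > σ₀ the tail is monotone and q ≥ zσ₀²; the part σ ≤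
σ₀ has length σ₀ and there the tail is at most 1. -/
theorem IsAdmissible.abs_J_sub_L_le (h : IsAdmissible φhat) {ε : ℝ} (hε : 0 < ε)
    (hφ : IsTestFunction φ) {B τ C lam σ₀ : ℝ} (hl : 0 < lam)
    (hB : ∀ x, 0 ≤ x → |d2 φ x| ≤ B)
    (hC : 0 ≤ C) (hmod : ∀ x ξ, 0 ≤ x → 0 ≤ ξ → |d2 φ ξ - d2 φ x| ≤ τ + C * (ξ - x) ^ 2)
    (hσ0 : 0 < σ₀) (hσ1 : σ₀ ≤ 1) {y z : ℝ} (hy : 0 ≤ y) (hyz : y ≤ z) (hz : 0 < z) :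
    |J φhat ε φ y z - L φ y z| ≤ 16 * Real.pi ^ 2 * √z * (16 * τ + 40 * B * lam +
      (8 * B + 512 * C * z ^ 2 + 80 * B / lam) *
        (transferTail φhat (z * σ₀ ^ 2 / ε ^ 2) + σ₀)) := by
  have hpi := Real.pi_pos
  have hB0 : 0 ≤ B := (abs_nonneg _).trans (hB 0 le_rfl)
  have hτ : 0 ≤ τ := by simpa using (abs_nonneg _).trans (hmod 0 0 le_rfl le_rfl)
  have hsz := Real.sqrt_pos.2 hz
  obtain ⟨li, le⟩ := landauNumerator_eq_integral φ hy hyz hz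
  have hcr : Continuous fun σ => collisionRate φhat ε φ y z (transferPath y z σ) :=
    (h.continuous_collisionRate hε hφ).comp (f := fun σ : ℝ => (y, z, transferPath y z σ)) (by
      have := continuous_transferPath.comp (f := fun σ : ℝ => ((y, z), σ)) (by fun_prop)
      simp only [Function.comp_def] at this
      fun_prop)
  have e1 : J φhat ε φ y z - L φ y z = 8 * Real.pi / √z * ∫ σ in (0 : ℝ)..1,
      (collisionRate φhat ε φ y z (transferPath y z σ) -
        1 / 2 * (gainSlope φ y z (transferPath y z σ) / transferPath y z σ)) := by
    rw [intervalIntegral.integral_sub (hcr.intervalIntegrable _ _) (li.const_mul _),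
      intervalIntegral.integral_const_mul, le, h.J_eq hε hφ hy hyz, L_eq, max_eq_right hyz]
    ring
  set X := 16 * τ + 40 * B * lam with hX
  set K₀ := 8 * B + 512 * C * z ^ 2 + 80 * B / lam with hK
  have hX0 : 0 ≤ X := by positivity
  have hK0 : 0 ≤ K₀ := by positivity
  set G₀ := transferTail φhat (z * σ₀ ^ 2 / ε ^ 2) with hG₀
  have hG0 : 0 ≤ G₀ := transferTail_nonneg _ (by positivity)
  have hind : IntervalIntegrable ({σ : ℝ | σ ≤ σ₀}.indicator fun _ => (1 : ℝ)) volume 0 1 := by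
    have : IntegrableOn (fun _ => (1 : ℝ)) (Ioc (0 : ℝ) 1) := integrableOn_const (by simp)
    rw [intervalIntegrable_iff_integrableOn_Ioc_of_le zero_le_one]
    exact this.indicator measurableSet_Iic
  have bound : |∫ σ in (0 : ℝ)..1, (collisionRate φhat ε φ y z (transferPath y z σ) -
        1 / 2 * (gainSlope φ y z (transferPath y z σ) / transferPath y z σ))| ≤
      ∫ σ in (0 : ℝ)..1, (2 * Real.pi * z * (X + K₀ * G₀) +
        2 * Real.pi * z * K₀ * ({σ : ℝ | σ ≤ σ₀}.indicator fun _ => (1 : ℝ)) σ) := by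
    refine intervalIntegral.norm_integral_le_of_norm_le (E := ℝ) zero_le_one
      (ae_of_all _ fun σ hσ => ?_)
      ((Continuous.intervalIntegrable (by fun_prop) _ _).add (hind.const_mul _))
    obtain ⟨p1, p2, p3⟩ := transferPath_bounds hy hyz (Ioc_subset_Icc_self hσ)
    have hσp : 0 < σ := hσ.1
    have hq : 0 < transferPath y z σ := lt_of_lt_of_le (by positivity) p1
    refine (h.abs_collisionRate_sub_le hε hφ hl hB hC hmod hy hyz hq p2 p3).trans ?_
    rw [← hX, ← hK]
    have hG : transferTail φhat (transferPath y z σ / ε ^ 2) ≤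
        G₀ + ({σ : ℝ | σ ≤ σ₀}.indicator fun _ => (1 : ℝ)) σ := by
      by_cases hs : σ ≤ σ₀
      · rw [indicator_of_mem (show σ ∈ {σ : ℝ | σ ≤ σ₀} from hs)]
        have := h.transferTail_le_one (show 0 ≤ transferPath y z σ / ε ^ 2 by positivity)
        linarith
      · rw [indicator_of_notMem (show σ ∉ {σ : ℝ | σ ≤ σ₀} from hs), add_zero]
        refine h.transferTail_anti (by positivity) ?_
        have : z * σ₀ ^ 2 ≤ transferPath y z σ := by
          refine le_trans ?_ p1
          have := (not_le.1 hs).le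
          gcongr
        gcongr
    calc 2 * Real.pi * z * (X + K₀ * transferTail φhat (transferPath y z σ / ε ^ 2))
        ≤ 2 * Real.pi * z * (X + K₀ * (G₀ + ({σ : ℝ | σ ≤ σ₀}.indicator fun _ => (1 : ℝ)) σ)) := by
          gcongr
      _ = _ := by ring
  rw [intervalIntegral.integral_add (Continuous.intervalIntegrable (by fun_prop) _ _)
    (hind.const_mul _), intervalIntegral.integral_const_mul (2 * Real.pi * z * K₀),
    intervalIntegral.integral_indicator ⟨hσ0.le, hσ1⟩, intervalIntegral.integral_const,
    intervalIntegral.integral_const] at bound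
  simp only [sub_zero, smul_eq_mul, mul_one, one_mul] at bound
  rw [e1, abs_mul, abs_of_pos (by positivity)]
  refine (mul_le_mul_of_nonneg_left bound (by positivity)).trans (le_of_eq ?_)
  have : z = √z * √z := (Real.mul_self_sqrt hz.le).symm
  generalize √z = s at *
  subst this
  field_simp
  ring

/-- The quadratic kernels grow at most like the square root of the energy, uniformly in `ε`. -/
theorem IsAdmissible.exists_J_bound (h : IsAdmissible φhat) (hφ : IsTestFunction φ) :
    ∃ C : ℝ, 0 ≤ C ∧ ∀ ε, 0 < ε → ∀ y z, 0 ≤ y → 0 ≤ z →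
      |J φhat ε φ y z| ≤ C * √(max y z) := by
  obtain ⟨B, hB0, hb⟩ := hφ.exists_bound
  have hB : ∀ x, 0 ≤ x → |d2 φ x| ≤ B := fun x hx => (hb x hx).2.2
  have hpi := Real.pi_pos
  have key : ∀ ε, 0 < ε → ∀ y z, 0 ≤ y → y ≤ z →
      |J φhat ε φ y z| ≤ (16 * Real.pi ^ 2 * (248 * B) + 12 * Real.pi * B) * √z := by
    intro ε hε y z hy hyz
    rcases (hy.trans hyz).eq_or_lt with h0 | hz
    · rw [h.J_eq hε hφ hy hyz, ← h0]
      simp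
    -- With trivial parameters the comparison with `L` is not small, but it is bounded uniformly in
    -- ε.
    have h1 := h.abs_J_sub_L_le hε hφ (τ := 2 * B) (C := 0) (lam := 1) (σ₀ := 1) one_pos hB le_rfl
      (fun x ξ hx hξ => by
        have := abs_le.1 (hB x hx)
        have := abs_le.1 (hB ξ hξ)
        rw [abs_le]; constructor <;> linarith) one_pos le_rfl hy hyz hz
    have h2 := hφ.abs_L_le_sqrt hB hy hz.le
    rw [max_eq_right hyz] at h2
    have h3 := h.transferTail_le_one (show 0 ≤ z * 1 ^ 2 / ε ^ 2 by positivity)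
    have h4 := abs_sub_abs_le_abs_sub (J φhat ε φ y z) (L φ y z)
    have h5 : 16 * Real.pi ^ 2 * √z * (16 * (2 * B) + 40 * B * 1 +
      (8 * B + 512 * 0 * z ^ 2 + 80 * B / 1) * (transferTail φhat (z * 1 ^ 2 / ε ^ 2) + 1)) ≤
      16 * Real.pi ^ 2 * √z * (16 * (2 * B) + 40 * B * 1 +
      (8 * B + 512 * 0 * z ^ 2 + 80 * B / 1) * (1 + 1)) := by
      gcongr
    have h6 : 16 * Real.pi ^ 2 * √z * (16 * (2 * B) + 40 * B * 1 +
      (8 * B + 512 * 0 * z ^ 2 + 80 * B / 1) * (1 + 1)) = 16 * Real.pi ^ 2 * (248 * B) * √z := by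
      ring
    linarith
  refine ⟨16 * Real.pi ^ 2 * (248 * B) + 12 * Real.pi * B, by positivity,
    fun ε hε y z hy hz => ?_⟩
  rcases le_total y z with hyz | hyz
  · rw [max_eq_right hyz]; exact key ε hε y z hy hyz
  · rw [max_eq_left hyz, h.J_comm hε hy hz]; exact key ε hε z y hz hyz

/-- The quadratic kernels converge to the Fokker–Planck–Landau kernel locally uniformly. -/
theorem IsAdmissible.J_tendsto_L (h : IsAdmissible φhat) (hφ : IsTestFunction φ) {R δ : ℝ}
    (hR : 0 < R) (hδ : 0 < δ) :
    ∀ᶠ ε in 𝓝[>] (0 : ℝ), ∀ y z, 0 ≤ y → 0 ≤ z → y ≤ R → z ≤ R →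
      |J φhat ε φ y z - L φ y z| ≤ δ := by
  obtain ⟨B, hB0, hb⟩ := hφ.exists_bound
  have hB : ∀ x, 0 ≤ x → |d2 φ x| ≤ B := fun x hx => (hb x hx).2.2
  obtain ⟨CJ, hCJ0, hCJ⟩ := h.exists_J_bound hφ
  have hpi := Real.pi_pos
  -- For max(y, z) ≤ ν both kernels are small separately. The comparison estimate needs z bounded
  -- below to make zσ₀²/ε² large.
  obtain ⟨ν, hν, hνδ⟩ : ∃ ν : ℝ, 0 < ν ∧ (CJ + 12 * Real.pi * B) * √ν ≤ δ := by
    have hpos : 0 < CJ + 12 * Real.pi * B := by positivity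
    refine ⟨(δ / (CJ + 12 * Real.pi * B)) ^ 2, by positivity, ?_⟩
    rw [Real.sqrt_sq (by positivity), mul_div_cancel₀ _ hpos.ne']
  set A := 16 * Real.pi ^ 2 * √R with hA
  have hA0 : 0 < A := by positivity
  -- The terms in τ and `lam` are worth δ/4 each; the tail and σ₀ contribute δ/4 each.
  set τ := δ / (64 * A) with hτ
  set lam := δ / (160 * B * A) with hlam
  have hτ0 : 0 < τ := by positivity
  have hl0 : 0 < lam := by positivity
  obtain ⟨C, hC, hmod⟩ := hφ.exists_modulus hτ0
  set K₀ := 8 * B + 512 * C * R ^ 2 + 80 * B / lam with hK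
  have hK0 : 0 < K₀ := by positivity
  set σ₀ := min 1 (δ / (4 * A * K₀)) with hσ
  have hσ0 : 0 < σ₀ := by positivity
  have hlim : Tendsto (fun ε : ℝ => ν * σ₀ ^ 2 / ε ^ 2) (𝓝[>] 0) atTop := by
    have := ((tendsto_pow_atTop two_ne_zero).comp
      (tendsto_inv_nhdsGT_zero (𝕜 := ℝ))).const_mul_atTop (r := ν * σ₀ ^ 2) (by positivity)
    refine this.congr fun ε => ?_
    simp [div_eq_mul_inv]
  have hev := (h.tendsto_transferTail.comp hlim).eventually_le_const
    (show 0 < δ / (4 * A * K₀) by positivity)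
  have main : ∀ᶠ ε in 𝓝[>] (0 : ℝ), ∀ y z, 0 ≤ y → y ≤ z → z ≤ R →
      |J φhat ε φ y z - L φ y z| ≤ δ := by
    filter_upwards [hev, self_mem_nhdsWithin] with ε hε' hε y z hy hyz hzR
    have hε : 0 < ε := hε
    have hz := hy.trans hyz
    rcases le_total z ν with hzν | hzν
    · have h1 := hCJ ε hε y z hy hz
      have h2 := hφ.abs_L_le_sqrt hB hy hz
      rw [max_eq_right hyz] at h1 h2
      have h3 := abs_sub (J φhat ε φ y z) (L φ y z)
      have h4 : (CJ + 12 * Real.pi * B) * √z ≤ (CJ + 12 * Real.pi * B) * √ν := by gcongr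
      linarith
    · have hz' : 0 < z := hν.trans_le hzν
      refine (h.abs_J_sub_L_le hε hφ hl0 hB hC hmod hσ0 (min_le_left _ _) hy hyz hz').trans ?_
      have g1 : transferTail φhat (z * σ₀ ^ 2 / ε ^ 2) ≤ δ / (4 * A * K₀) := by
        refine (h.transferTail_anti (p := ν * σ₀ ^ 2 / ε ^ 2) (by positivity) ?_).trans hε'
        gcongr
      have g2 : σ₀ ≤ δ / (4 * A * K₀) := min_le_right _ _
      calc 16 * Real.pi ^ 2 * √z * (16 * τ + 40 * B * lam +
            (8 * B + 512 * C * z ^ 2 + 80 * B / lam) *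
              (transferTail φhat (z * σ₀ ^ 2 / ε ^ 2) + σ₀))
          ≤ 16 * Real.pi ^ 2 * √R * (16 * τ + 40 * B * lam +
            (8 * B + 512 * C * R ^ 2 + 80 * B / lam) *
              (δ / (4 * A * K₀) + δ / (4 * A * K₀))) := by
            have := transferTail_nonneg φhat (show 0 ≤ z * σ₀ ^ 2 / ε ^ 2 by positivity)
            gcongr
        _ = δ := by
            rw [← hA, ← hK, hτ, hlam]
            field_simp
            ring
  filter_upwards [main, self_mem_nhdsWithin] with ε hm hε y z hy hz hyR hzR
  rcases le_total y z with hyz | hyz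
  · exact hm y z hy hyz hzR
  · rw [h.J_comm hε hy hz, L_comm]
    exact hm z y hz hyz hyR

end WeakCoupling

/-! ### Positivity, monotonicity and singularity of the collision kernel. -/

section CubicBound

variable {φhat φ : ℝ → ℝ} {ε : ℝ} {Φ Ψ : ℝ → ℝ → ℝ} {x y z : ℝ}

theorem RegularScattering.W_eq_integral_prod (hΦ : RegularScattering Φ) (hx : 0 < x) (hy : 0 < y)
    (hz : 0 < z) (hs : x < y + z) :
    W Φ x y z = 4 * Real.pi / √(x * y * z) *
      ∫ p : ℝ × ℝ, Φ (√2 * √p.1) (√2 * √p.2) * (√(gram y z x p.1 p.2))⁻¹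
        ∂((volume.restrict (Ioi 0)).prod (volume.restrict (Ioi 0))) := by
  rw [W_eq_integral_gram hΦ hx hy hz hs, integral_prod _ (hΦ.integrable_mul_gram x y z)]

theorem RegularScattering.linear (hΦ : RegularScattering Φ) (hΨ : RegularScattering Ψ) (a b : ℝ) :
    RegularScattering fun r ρ => a * Φ r ρ + b * Ψ r ρ := by
  obtain ⟨M, hM⟩ := hΦ.bounded
  obtain ⟨N, hN⟩ := hΨ.bounded
  refine ⟨(hΦ.continuous.const_mul a).add (hΨ.continuous.const_mul b), |a| * M + |b| * N,
    fun u w => ?_⟩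
  refine (abs_add_le _ _).trans ?_
  rw [abs_mul, abs_mul]
  gcongr
  exacts [hM u w, hN u w]

theorem W_linear (hΦ : RegularScattering Φ) (hΨ : RegularScattering Ψ) (a b : ℝ) (x y z : ℝ) :
    W (fun r ρ => a * Φ r ρ + b * Ψ r ρ) x y z = a * W Φ x y z + b * W Ψ x y z := by
  by_cases h : 0 < xStar x y z ∧ 0 < x ∧ 0 < y ∧ 0 < z
  · obtain ⟨hs, hx, hy, hz⟩ := h
    have hs : x < y + z := by simpa [xStar] using hs
    rw [hΦ.W_eq_integral_prod hx hy hz hs, hΨ.W_eq_integral_prod hx hy hz hs,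
      (hΦ.linear hΨ a b).W_eq_integral_prod hx hy hz hs, mul_left_comm a, mul_left_comm b, ← mul_add]
    congr 1
    rw [← integral_const_mul a, ← integral_const_mul b,
      ← integral_add ((hΦ.integrable_mul_gram x y z).const_mul a)
        ((hΨ.integrable_mul_gram x y z).const_mul b)]
    simp only [add_mul, mul_assoc]
  · simp only [W, if_neg h]
    split_ifs <;> ring

theorem W_nonneg (h : ∀ r ρ, 0 ≤ Φ r ρ) (x y z : ℝ) : 0 ≤ W Φ x y z := by
  have hpi := Real.pi_pos
  by_cases hp : 0 < xStar x y z ∧ 0 < x ∧ 0 < y ∧ 0 < z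
  · obtain ⟨hs, hx, hy, hz⟩ := hp
    have hs : x < y + z := by simpa [xStar] using hs
    rw [W_of_pos hx hy hz hs]
    exact mul_nonneg (by positivity) (integral_nonneg fun s =>
      intervalIntegral.integral_nonneg (by positivity) fun θ _ => h _ _)
  · rw [W, if_neg hp]
    split_ifs
    exacts [mul_nonneg (by positivity) (h _ _), mul_nonneg (by positivity) (h _ _),
      mul_nonneg (by positivity) (h _ _), le_rfl]

theorem W_mono (hΦ : RegularScattering Φ) (hΨ : RegularScattering Ψ)
    (h : ∀ r ρ, Φ r ρ ≤ Ψ r ρ) (x y z : ℝ) : W Φ x y z ≤ W Ψ x y z := by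
  have h1 := W_linear hΨ hΦ 1 (-1) x y z
  have h2 : 0 ≤ W (fun r ρ => 1 * Ψ r ρ + (-1) * Φ r ρ) x y z :=
    W_nonneg (fun r ρ => by linarith [h r ρ]) x y z
  linarith

/-- The square of the first amplitude in the Bose–Einstein scattering function. -/
def directScattering (φhat : ℝ → ℝ) (ε r : ℝ) (_ρ : ℝ) : ℝ :=
  1 / ε ^ 4 * φhat (r / ε) ^ 2

theorem directScattering_nonneg (φhat : ℝ → ℝ) (ε r ρ : ℝ) : 0 ≤ directScattering φhat ε r ρ := by
  unfold directScattering; positivity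

theorem IsAdmissible.regular_directScattering (h : IsAdmissible φhat) (hε : 0 < ε) :
    RegularScattering (directScattering φhat ε) := by
  obtain ⟨C, hC⟩ := h.bounded
  refine ⟨?_, 1 / ε ^ 4 * C ^ 2, fun u w => ?_⟩
  · have h1 : Continuous fun p : ℝ × ℝ => φhat (√2 * √p.1 / ε) :=
      h.continuous_comp (by fun_prop) fun p => by positivity
    exact (h1.pow 2).const_mul _
  · rw [directScattering, abs_of_nonneg (by positivity), ← sq_abs]
    gcongr
    exact hC _ (by positivity)

theorem IsAdmissible.exists_directScattering_le (h : IsAdmissible φhat) :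
    ∃ D, 0 ≤ D ∧ ∀ ε, 0 < ε → ∀ r ρ, 0 < r → directScattering φhat ε r ρ ≤ D / ε ^ 2 / r ^ 2 := by
  obtain ⟨A, hA⟩ := h.decay
  refine ⟨A ^ 2, sq_nonneg A, fun ε hε r ρ hr => ?_⟩
  have h1 := hA (r / ε) (by positivity)
  have h2 : (r / ε * |φhat (r / ε)|) ^ 2 ≤ A ^ 2 := pow_le_pow_left₀ (by positivity) h1 2
  rw [mul_pow, sq_abs] at h2
  rw [directScattering, le_div_iff₀ (by positivity)]
  calc 1 / ε ^ 4 * φhat (r / ε) ^ 2 * r ^ 2 = (r / ε) ^ 2 * φhat (r / ε) ^ 2 / ε ^ 2 := by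
        field_simp
    _ ≤ A ^ 2 / ε ^ 2 := by gcongr

theorem integral_inv_sq {a b : ℝ} (ha : 0 < a) (hab : a ≤ b) :
    IntegrableOn (fun s : ℝ => 1 / s ^ 2) (Ioo a b) ∧
      ∫ s in Ioo a b, 1 / s ^ 2 = (b - a) / (a * b) := by
  have hc : ContinuousOn (fun s : ℝ => 1 / s ^ 2) (Icc a b) :=
    ContinuousOn.div (by fun_prop) (by fun_prop) fun s hs => (pow_pos (ha.trans_le hs.1) 2).ne'
  have hi : IntervalIntegrable (fun s : ℝ => 1 / s ^ 2) volume a b :=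
    ContinuousOn.intervalIntegrable (by rwa [uIcc_of_le hab])
  refine ⟨hc.integrableOn_Icc.mono_set Ioo_subset_Icc_self, ?_⟩
  rw [← integral_Ioc_eq_integral_Ioo, ← intervalIntegral.integral_of_le hab,
    intervalIntegral.integral_eq_sub_of_hasDerivAt (f := fun s => -s⁻¹) (fun s hs => ?_) hi]
  · have := ha.trans_le hab
    field_simp
    ring
  · rw [uIcc_of_le hab] at hs
    refine ((hasDerivAt_inv (ha.trans_le hs.1).ne').neg).congr_deriv ?_
    simp

/-- The integral of s⁻² over the transfer interval is its length divided by the product of its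
endpoints. By `transfer_endpoints` this is twice the smallest square root over |x - y|. -/
theorem W_le_of_pos {D : ℝ} (hD : 0 ≤ D) (h0 : ∀ r ρ, 0 ≤ Φ r ρ) (hΦ : ∀ r ρ, 0 < r → Φ r ρ ≤ D / r ^ 2)
    (hx : 0 < x) (hy : 0 < y) (hz : 0 < z) (hs : x < y + z) (hxy : x ≠ y) :
    W Φ x y z * |x - y| * √(x * y * z) ≤ 8 * Real.pi ^ 2 * D * min (min (√x) (√y)) (√z) := by
  have hpi := Real.pi_pos
  obtain ⟨e1, e2⟩ := transfer_endpoints hx hy hz hs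
  have hlt := transfer_low_lt_high hx hy hz hs
  have hl0 := transfer_low_nonneg x y z
  rw [W_of_pos hx hy hz hs]
  set l := max |√x - √y| |√(xStar x y z) - √z|
  set k := min (√x + √y) (√(xStar x y z) + √z)
  have hne : 0 < |x - y| := abs_pos.2 (sub_ne_zero.2 hxy)
  have hl : 0 < l := hl0.lt_of_ne fun h => by rw [← h, zero_mul] at e1; exact hne.ne e1
  obtain ⟨i1, i2⟩ := integral_inv_sq hl hlt.le
  have hin : ∫ s in Ioo l k, ∫ θ in (0 : ℝ)..(2 * Real.pi),
      Φ (√2 * s) (√2 * yStar x y z s θ) ≤ ∫ s in Ioo l k, Real.pi * D * (1 / s ^ 2) := by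
    refine integral_mono_of_nonneg (ae_of_all _ fun s =>
      intervalIntegral.integral_nonneg (by positivity) fun θ _ => h0 _ _) (i1.const_mul _) ?_
    filter_upwards [ae_restrict_mem measurableSet_Ioo] with s hs'
    have hs0 : 0 < s := hl.trans hs'.1
    have hb : ∀ θ ∈ uIoc (0 : ℝ) (2 * Real.pi), ‖Φ (√2 * s) (√2 * yStar x y z s θ)‖ ≤ D / (√2 * s) ^ 2 :=
      fun θ _ => by
        rw [Real.norm_of_nonneg (h0 _ _)]
        exact hΦ _ _ (by positivity)
    refine (le_abs_self _).trans
      ((intervalIntegral.norm_integral_le_of_norm_le_const hb).trans (le_of_eq ?_))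
    rw [sub_zero, abs_of_pos (by positivity), mul_pow, Real.sq_sqrt zero_le_two]
    field_simp
  rw [integral_const_mul, i2, e1, e2] at hin
  have hm : min (min (√x) (√y)) (min (√(xStar x y z)) (√z)) ≤ min (min (√x) (√y)) (√z) :=
    min_le_min_left _ (min_le_right _ _)
  have hsq : 0 < √(x * y * z) := by positivity
  calc _ = 4 * Real.pi * (|x - y| * ∫ s in Ioo l k, ∫ θ in (0 : ℝ)..(2 * Real.pi),
      Φ (√2 * s) (√2 * yStar x y z s θ)) := by field_simp
    _ ≤ 4 * Real.pi * (|x - y| * (Real.pi * D *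
        (2 * min (min (√x) (√y)) (min (√(xStar x y z)) (√z)) / |x - y|))) := by gcongr
    _ = 8 * Real.pi ^ 2 * D * min (min (√x) (√y)) (min (√(xStar x y z)) (√z)) := by
        field_simp; ring
    _ ≤ _ := by gcongr

/-- The singularity of the collision kernel of a scattering function of order `r⁻²`. -/
theorem W_mul_le {D : ℝ} (hD : 0 ≤ D) (h0 : ∀ r ρ, 0 ≤ Φ r ρ)
    (hΦ : ∀ r ρ, 0 < r → Φ r ρ ≤ D / r ^ 2) (hx : 0 ≤ x) (hy : 0 ≤ y) (hz : 0 ≤ z) :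
    W Φ x y z * |x - y| * √(x * y) ≤ 8 * Real.pi ^ 2 * D ∧
    W Φ x y z * |x - y| * √(x * z) ≤ 8 * Real.pi ^ 2 * D ∧
    W Φ x y z * |x - y| * √(y * z) ≤ 8 * Real.pi ^ 2 * D := by
  have hpi := Real.pi_pos
  have hc : 0 ≤ 8 * Real.pi ^ 2 * D := by positivity
  -- The boundary values of `W` on the three coordinate planes; t is the squared transfer |x - y|.
  have ax : ∀ a b t : ℝ, 0 < a → 0 < b → 0 < t →
      (4 * Real.pi) ^ 2 / √(a * b) * Φ (√(2 * t)) (√(2 * b)) * t * √(a * b) ≤ 8 * Real.pi ^ 2 * D ∧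
      (4 * Real.pi) ^ 2 / √(a * b) * Φ (√(2 * t)) (√(2 * (b - a))) * t * √(a * b) ≤
        8 * Real.pi ^ 2 * D ∧
      (4 * Real.pi) ^ 2 / √(a * b) * Φ (√(2 * t)) (√(2 * a)) * t * √(a * b) ≤
        8 * Real.pi ^ 2 * D := by
    intro a b t ha hb ht
    have hab : 0 < √(a * b) := by positivity
    have key : ∀ ρ, (4 * Real.pi) ^ 2 / √(a * b) * Φ (√(2 * t)) ρ * t * √(a * b) ≤
        8 * Real.pi ^ 2 * D := fun ρ => by
      have := hΦ (√(2 * t)) ρ (by positivity)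
      rw [Real.sq_sqrt (by positivity)] at this
      calc _ = (4 * Real.pi) ^ 2 * t * Φ (√(2 * t)) ρ := by field_simp
        _ ≤ (4 * Real.pi) ^ 2 * t * (D / (2 * t)) := by gcongr
        _ = _ := by field_simp; ring
    exact ⟨key _, key _, key _⟩
  rcases eq_or_ne x y with rfl | hxy
  · simp [hc]
  by_cases hp : 0 < xStar x y z ∧ 0 < x ∧ 0 < y ∧ 0 < z
  · obtain ⟨hs, hx, hy, hz⟩ := hp
    have hs : x < y + z := by simpa [xStar] using hs
    have key := W_le_of_pos hD h0 hΦ hx hy hz hs hxy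
    have hp := Real.sqrt_pos.2 hx
    have hq := Real.sqrt_pos.2 hy
    have hr := Real.sqrt_pos.2 hz
    rw [Real.sqrt_mul (by positivity), Real.sqrt_mul hx.le] at key
    have k1 := key.trans (mul_le_mul_of_nonneg_left (min_le_right _ _) hc)
    have k2 := key.trans (mul_le_mul_of_nonneg_left
      ((min_le_left _ _).trans (min_le_right _ _)) hc)
    have k3 := key.trans (mul_le_mul_of_nonneg_left
      ((min_le_left _ _).trans (min_le_left _ _)) hc)
    rw [Real.sqrt_mul hx.le, Real.sqrt_mul hx.le, Real.sqrt_mul hy.le]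
    refine ⟨le_of_mul_le_mul_right (le_trans (le_of_eq ?_) k1) hr,
      le_of_mul_le_mul_right (le_trans (le_of_eq ?_) k2) hq,
      le_of_mul_le_mul_right (le_trans (le_of_eq ?_) k3) hp⟩ <;> ring
  · rw [W, if_neg hp]
    split_ifs with h1 h2 h3
    · obtain ⟨rfl, hy, hz⟩ := h1
      have := (ax y z y hy hz hy).1
      simpa [abs_of_pos hy, hc] using this
    · obtain ⟨rfl, hx, hz⟩ := h2
      have := (ax x z x hx (hx.trans hz) hx).2.1
      simpa [abs_of_pos hx, hc] using this
    · obtain ⟨rfl, hx, hy⟩ := h3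
      have := (ax x y (y - x) hx (hx.trans hy) (by linarith)).2.2
      simpa [abs_of_neg (sub_neg.2 hy), hc] using this
    · simp [hc]

/-- For x < z/2 the smallest of the four energies is min(x, y), so the triangle with sides √x and √y
is the only active constraint. -/
theorem transfer_endpoints_of_small (hx : 0 < x) (hy : 0 < y) (hxz : x < z / 2) :
    max |√x - √y| |√(xStar x y z) - √z| = |√x - √y| ∧
    min (√x + √y) (√(xStar x y z) + √z) = √x + √y := by
  have hz : 0 < z := by linarith
  obtain ⟨-, e2⟩ := transfer_endpoints hx hy hz (by linarith)
  have hst : xStar x y z = y + z - x := xStar_of_le (by linarith)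
  have m : min (min (√x) (√y)) (min (√(xStar x y z)) (√z)) = √(min x y) := by
    rw [Monotone.map_min (f := Real.sqrt) fun _ _ h => Real.sqrt_le_sqrt h, min_eq_left]
    refine le_min ?_ ?_
    · exact (min_le_left _ _).trans (Real.sqrt_le_sqrt (by rw [hst]; linarith))
    · exact (min_le_left _ _).trans (Real.sqrt_le_sqrt (by linarith))
  rw [m, ← high_sub_low] at e2
  have h1 := le_max_left |√x - √y| |√(xStar x y z) - √z|
  have h2 := min_le_left (√x + √y) (√(xStar x y z) + √z)
  constructor <;> linarith

/-- The direct scattering ignores Y_*, and for small x and y the interval of s is symmetric in them.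
This symmetry drives the cancellation in the cubic term. -/
theorem W_directScattering_comm (φhat : ℝ → ℝ) (ε : ℝ) (hx : 0 ≤ x) (hy : 0 ≤ y)
    (hxz : x < z / 2) (hyz : y < z / 2) :
    W (directScattering φhat ε) x y z = W (directScattering φhat ε) y x z := by
  have hz : 0 < z := by linarith
  have axis : ∀ t, 0 < t → t < z →
      W (directScattering φhat ε) 0 t z = W (directScattering φhat ε) t 0 z := fun t ht htz => by
    have e1 : W (directScattering φhat ε) 0 t z = (4 * Real.pi) ^ 2 / √(t * z) *
        directScattering φhat ε (√(2 * t)) (√(2 * z)) := by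
      rw [W, if_neg (by simp), if_pos ⟨rfl, ht, hz⟩]
    have e2 : W (directScattering φhat ε) t 0 z = (4 * Real.pi) ^ 2 / √(t * z) *
        directScattering φhat ε (√(2 * t)) (√(2 * (z - t))) := by
      rw [W, if_neg (by simp), if_neg (by simp), if_pos ⟨rfl, ht, htz⟩]
    rw [e1, e2]
    rfl
  rcases hx.eq_or_lt with rfl | hx
  · rcases hy.eq_or_lt with rfl | hy
    · rfl
    · exact axis y hy (by linarith)
  · rcases hy.eq_or_lt with rfl | hy
    · exact (axis x hx (by linarith)).symm
    · obtain ⟨a1, a2⟩ := transfer_endpoints_of_small hx hy hxz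
      obtain ⟨b1, b2⟩ := transfer_endpoints_of_small hy hx hyz
      rw [W_of_pos hx hy hz (by linarith), W_of_pos hy hx hz (by linarith), a1, a2, b1, b2,
        abs_sub_comm (√y), add_comm (√y), mul_comm y x]
      rfl

theorem W_eq_zero_of_le (hx : 0 ≤ x) (hy : 0 ≤ y) (hxz : x + y ≤ z) (hz : 0 < z) : W Φ z x y = 0 := by
  rw [W, if_neg, if_neg, if_neg, if_neg]
  · rintro ⟨rfl, h1, h2⟩; linarith
  · rintro ⟨rfl, h1, h2⟩; linarith
  · rintro ⟨rfl, h1, h2⟩; exact hz.false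
  · rintro ⟨h1, -⟩
    rw [xStar, max_eq_right (by linarith)] at h1
    exact h1.false

/-- The collision kernel differs from its direct part by a controlled amount. -/
theorem IsAdmissible.abs_W_sub_le (h : IsAdmissible φhat) (hε : 0 < ε) {lam : ℝ} (hl : 0 < lam)
    (hx : 0 ≤ x) (hy : 0 ≤ y) (hz : 0 ≤ z) :
    |W (PhiBE φhat ε) x y z - W (directScattering φhat ε) x y z| ≤
      lam * W (directScattering φhat ε) x y z +
        (1 + 1 / lam) * W (directScattering φhat ε) x z y := by
  have hd := h.regular_directScattering hε
  have hsw := W_swap hd.flip hx hy hz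
  have key : ∀ f g : ℝ, -(lam * f ^ 2 + 1 / lam * g ^ 2) ≤ 2 * f * g ∧
      2 * f * g ≤ lam * f ^ 2 + 1 / lam * g ^ 2 := fun f g => by
    have e1 : 0 ≤ (lam * f - g) ^ 2 / lam := by positivity
    have e2 : 0 ≤ (lam * f + g) ^ 2 / lam := by positivity
    have e3 : (lam * f - g) ^ 2 / lam = lam * f ^ 2 + 1 / lam * g ^ 2 - 2 * f * g := by
      field_simp; ring
    have e4 : (lam * f + g) ^ 2 / lam = lam * f ^ 2 + 1 / lam * g ^ 2 + 2 * f * g := by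
      field_simp; ring
    constructor <;> linarith
  have hε4 : 0 ≤ 1 / ε ^ 4 := by positivity
  -- Young's inequality for (f + g)² holds pointwise and passes to `W` by monotonicity; the flipped
  -- scattering is the direct one with y and z exchanged.
  have u := W_mono (h.regularScattering hε) (hd.linear hd.flip (1 + lam) (1 + 1 / lam))
    (fun r ρ => by
      simp only [PhiBE, directScattering]
      have := mul_le_mul_of_nonneg_left (key (φhat (r / ε)) (φhat (ρ / ε))).2 hε4
      linarith) x y z
  have l := W_mono (hd.linear hd.flip (1 - lam) (-(1 + 1 / lam))) (h.regularScattering hε)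
    (fun r ρ => by
      simp only [PhiBE, directScattering]
      have := mul_le_mul_of_nonneg_left (key (φhat (r / ε)) (φhat (ρ / ε))).1 hε4
      have := mul_nonneg hε4 (sq_nonneg (φhat (ρ / ε)))
      linarith) x y z
  rw [W_linear hd hd.flip, hsw] at u l
  rw [abs_le]
  constructor <;> linarith

end CubicBound

/-! ### Symmetrization of the cubic kernel and the bound on the cubic term. -/

section CubicBound

variable {φhat φ : ℝ → ℝ} {ε B c : ℝ} {x y z : ℝ}

/-- The singularity of the direct part of the collision kernel, of strength `c`. -/
def DirectBound (φhat : ℝ → ℝ) (ε c : ℝ) : Prop :=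
  ∀ x y z, 0 ≤ x → 0 ≤ y → 0 ≤ z →
    W (directScattering φhat ε) x y z * |x - y| * √(x * y) ≤ c ∧
    W (directScattering φhat ε) x y z * |x - y| * √(x * z) ≤ c ∧
    W (directScattering φhat ε) x y z * |x - y| * √(y * z) ≤ c

theorem IsAdmissible.exists_directBound (h : IsAdmissible φhat) :
    ∃ D, 0 ≤ D ∧ ∀ ε, 0 < ε → DirectBound φhat ε (D / ε ^ 2) := by
  obtain ⟨D, hD, hb⟩ := h.exists_directScattering_le
  refine ⟨8 * Real.pi ^ 2 * D, by positivity, fun ε hε x y z hx hy hz => ?_⟩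
  rw [mul_div_assoc]
  exact W_mul_le (by positivity) (directScattering_nonneg φhat ε) (hb ε hε) hx hy hz

theorem IsTestFunction.abs_gain_le_mul (hφ : IsTestFunction φ) (hB : ∀ x, 0 ≤ x → |d2 φ x| ≤ B)
    (hx : 0 ≤ x) (hy : 0 ≤ y) (hz : 0 ≤ z) (hs : x ≤ y + z) :
    |gain φ y z x| ≤ B * |x - z| * |x - y| := by
  rw [gain, max_eq_left hx, max_eq_left hy, max_eq_left hz, max_eq_left (by linarith)]
  exact hφ.abs_second_difference_le hB hx hy hz hs

/-- The two direct parts are singular at x = y and at x = z respectively, and the gain carries the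
factor |x - z||x - y|, so each singularity is cancelled and one factor is left over. -/
theorem IsAdmissible.abs_K_mul_le (h : IsAdmissible φhat) (hε : 0 < ε) (hφ : IsTestFunction φ)
    (hB : ∀ x, 0 ≤ x → |d2 φ x| ≤ B) (hx : 0 ≤ x) (hy : 0 ≤ y) (hz : 0 ≤ z) {q : ℝ} (hq : 0 ≤ q)
    (hc : 0 ≤ c) (h1 : W (directScattering φhat ε) x y z * |x - y| * q ≤ c)
    (h2 : W (directScattering φhat ε) x z y * |x - z| * q ≤ c) :
    |K φhat ε φ x y z| * q ≤ 2 * B * c * (|x - z| + |x - y|) := by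
  have hB0 : 0 ≤ B := (abs_nonneg _).trans (hB 0 le_rfl)
  rw [K_eq _ _ _ hx hy hz]
  rcases le_or_gt x (y + z) with hs | hs
  · have hg := hφ.abs_gain_le_mul hB hx hy hz hs
    have hw := abs_le.1 (h.abs_W_sub_le hε one_pos hx hy hz)
    have hw0 : 0 ≤ W (PhiBE φhat ε) x y z :=
      W_nonneg (fun r ρ => by unfold PhiBE; positivity) x y z
    have hw' : W (PhiBE φhat ε) x y z ≤
        2 * (W (directScattering φhat ε) x y z + W (directScattering φhat ε) x z y) := by
      linarith [hw.2]
    rw [abs_mul, abs_of_nonneg hw0]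
    calc W (PhiBE φhat ε) x y z * |gain φ y z x| * q
        ≤ 2 * (W (directScattering φhat ε) x y z + W (directScattering φhat ε) x z y) *
          (B * |x - z| * |x - y|) * q := by
          gcongr
          exact hw0.trans hw'
      _ = 2 * B * (W (directScattering φhat ε) x y z * |x - y| * q * |x - z| +
          W (directScattering φhat ε) x z y * |x - z| * q * |x - y|) := by ring
      _ ≤ 2 * B * (c * |x - z| + c * |x - y|) := by gcongr
      _ = _ := by ring
  · rw [W_eq_zero_of_le hy hz hs.le (by linarith), zero_mul, abs_zero, zero_mul]
    positivity

/-- The cancellation between two cubic collisions with small energies. -/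
theorem IsAdmissible.abs_K_add_K_le (h : IsAdmissible φhat) (hε : 0 < ε) (hφ : IsTestFunction φ)
    (hB : ∀ x, 0 ≤ x → |d2 φ x| ≤ B) (hc : DirectBound φhat ε c) (hc0 : 0 ≤ c) (hx : 0 ≤ x)
    (hxy : x ≤ y) (hy : 0 < y) (hyz : y < z / 2) :
    |K φhat ε φ x y z + K φhat ε φ y x z| ≤ 7 * (B * c) := by
  have hz : 0 < z := by linarith
  have hB0 : 0 ≤ B := (abs_nonneg _).trans (hB 0 le_rfl)
  have hp := Real.sqrt_pos.2 hy
  have hr := Real.sqrt_pos.2 hz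
  have hpr : √y ≤ √z := Real.sqrt_le_sqrt (by linarith)
  have ey : √y * √y = y := Real.mul_self_sqrt hy.le
  have ez : √z * √z = z := Real.mul_self_sqrt hz.le
  have syz : √(y * z) = √y * √z := Real.sqrt_mul hy.le z
  have b1 := (hc x y z hx hy.le hz.le).2.2
  have b2 := (hc x z y hx hz.le hy.le).2.2
  have b3 := (hc y z x hy.le hz.le hx).1
  have comm := W_directScattering_comm φhat ε hx hy.le (by linarith) hyz
  -- The choice `lam` = √y/√z balances the errors: `lam` · z/(√y√z) = 1 and `lam`⁻¹ · y/(√y√z) = 1.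
  have hl : 0 < √y / √z := by positivity
  have v1 := h.abs_W_sub_le hε hl hx hy.le hz.le
  have v2 := h.abs_W_sub_le hε hl hy.le hx hz.le
  rw [← comm] at v2
  have g1 := hφ.abs_gain_le_mul hB hx hy.le hz.le (by linarith)
  have g2 := hφ.abs_gain_le_mul hB hy.le hx hz.le (by linarith)
  -- The values at x and y cancel in the sum, leaving the second difference of φ at z with step y -
  -- x.
  have g12 : |gain φ y z x + gain φ x z y| ≤ B * (y - x) * (y - x) := by
    have := hφ.abs_second_difference_le hB (x := z + (y - x)) (y := z) (z := z) (by linarith)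
      hz.le hz.le (by linarith)
    rw [add_sub_cancel_left, abs_of_nonneg (sub_nonneg.2 hxy)] at this
    refine le_trans (le_of_eq ?_) this
    rw [gain, gain, max_eq_left hx, max_eq_left hy.le, max_eq_left hz.le, max_eq_left (by linarith),
      max_eq_left (by linarith)]
    congr 1
    rw [show z + z - (z + (y - x)) = x + z - y by ring, show z + (y - x) = y + z - x by ring]
    ring
  rw [abs_sub_comm x z, abs_sub_comm x y, abs_of_nonneg (show 0 ≤ z - x by linarith),
    abs_of_nonneg (sub_nonneg.2 hxy)] at g1
  rw [abs_sub_comm y z, abs_of_nonneg (show 0 ≤ z - y by linarith),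
    abs_of_nonneg (sub_nonneg.2 hxy)] at g2
  rw [abs_sub_comm, abs_of_nonneg (sub_nonneg.2 hxy), syz] at b1
  rw [abs_sub_comm, abs_of_nonneg (show 0 ≤ z - x by linarith), mul_comm z y, syz] at b2
  rw [abs_sub_comm, abs_of_nonneg (show 0 ≤ z - y by linarith), syz] at b3
  have w0 : ∀ x y z, 0 ≤ W (directScattering φhat ε) x y z :=
    W_nonneg (directScattering_nonneg φhat ε)
  rw [K_eq _ _ _ hx hy.le hz.le, K_eq _ _ _ hy.le hx hz.le]
  have n1 := w0 x y z
  have n2 := w0 x z y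
  have n3 := w0 y z x
  set w := W (directScattering φhat ε) x y z
  set w₂ := W (directScattering φhat ε) x z y
  set w₃ := W (directScattering φhat ε) y z x
  have r1 : w * (y - x) ≤ c / (√y * √z) := by rw [le_div_iff₀ (by positivity)]; exact b1
  -- Contribution of the non-direct part of either kernel: u is the swapped direct part and k the
  -- distance from z to the small energy.
  have rem : ∀ {V g u k : ℝ}, 0 ≤ u → 0 ≤ k → k ≤ z → u * k * (√y * √z) ≤ c →
      |V - w| ≤ √y / √z * w + (1 + 1 / (√y / √z)) * u → |g| ≤ B * k * (y - x) →
      |(V - w) * g| ≤ 3 * (B * c) := by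
    intro V g u k hu hk hkz hb hV hg
    have r2 : u * k ≤ c / (√y * √z) := by rw [le_div_iff₀ (by positivity)]; exact hb
    have hyx : 0 ≤ y - x := sub_nonneg.2 hxy
    have hyx' : y - x ≤ y := by linarith
    rw [abs_mul]
    calc |V - w| * |g| ≤ (√y / √z * w + (1 + 1 / (√y / √z)) * u) * (B * k * (y - x)) := by gcongr
      _ = B * (√y / √z * (w * (y - x)) * k + (1 + 1 / (√y / √z)) * (u * k) * (y - x)) := by ring
      _ ≤ B * (√y / √z * (c / (√y * √z)) * z + (1 + 1 / (√y / √z)) * (c / (√y * √z)) * y) := by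
        gcongr
      _ = B * c * (2 + √y / √z) := by
        rw [← ey, ← ez]
        simp only [Real.sqrt_mul_self hp.le, Real.sqrt_mul_self hr.le]
        field_simp
        ring
      _ ≤ B * c * (2 + 1) := by
        gcongr
        exact (div_le_one hr).2 hpr
      _ = _ := by ring
  have t1 := rem n2 (by linarith) (by linarith) b2 v1 g1
  have t2 := rem n3 (by linarith) (by linarith) b3 v2 g2
  have t3 : |w * (gain φ y z x + gain φ x z y)| ≤ B * c := by
    rw [abs_mul, abs_of_nonneg n1]
    have hyx : 0 ≤ y - x := sub_nonneg.2 hxy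
    calc w * |gain φ y z x + gain φ x z y| ≤ w * (B * (y - x) * (y - x)) := by gcongr
      _ = B * (w * (y - x)) * (y - x) := by ring
      _ ≤ B * (c / (√y * √z)) * (√y * √z) := by
        gcongr
        calc y - x ≤ √y * √y := by linarith
          _ ≤ _ := by gcongr
      _ = B * c := by field_simp
  have e : W (PhiBE φhat ε) x y z * gain φ y z x + W (PhiBE φhat ε) y x z * gain φ x z y =
      w * (gain φ y z x + gain φ x z y) + (W (PhiBE φhat ε) x y z - w) * gain φ y z x +
        (W (PhiBE φhat ε) y x z - w) * gain φ x z y := by ring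
  rw [e]
  rw [abs_le] at *
  constructor <;> linarith [t1.1, t1.2, t2.1, t2.2, t3.1, t3.2]

/-- The cyclic sum is invariant under all permutations, because `K` is symmetric in its last two
arguments, so the energies may be ordered. Single terms need not be bounded; only the sum is. -/
theorem IsAdmissible.abs_sum_K_le (h : IsAdmissible φhat) (hε : 0 < ε) (hφ : IsTestFunction φ)
    (hB : ∀ x, 0 ≤ x → |d2 φ x| ≤ B) (hc : DirectBound φhat ε c) (hc0 : 0 ≤ c)
    (hx : 0 ≤ x) (hy : 0 ≤ y) (hz : 0 ≤ z) :
    |K φhat ε φ x y z + K φhat ε φ z x y + K φhat ε φ y z x| ≤ 24 * (B * c) := by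
  have hB0 : 0 ≤ B := (abs_nonneg _).trans (hB 0 le_rfl)
  have hBc : 0 ≤ B * c := by positivity
  have key : ∀ {x y z : ℝ}, 0 ≤ x → x ≤ y → y ≤ z →
      |K φhat ε φ x y z + K φhat ε φ z x y + K φhat ε φ y z x| ≤ 24 * (B * c) := by
    intro x y z hx hxy hyz
    have hy := hx.trans hxy
    have hz := hy.trans hyz
    rcases hy.eq_or_lt with hy0 | hy0
    · have hx0 : x = 0 := le_antisymm (hxy.trans hy0.ge) hx
      subst hx0
      rw [← hy0]
      have h1 : K φhat ε φ 0 0 z = 0 := by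
        have := hφ.abs_gain_le_mul hB (x := 0) (y := 0) le_rfl le_rfl hz (by linarith)
        rw [K_eq _ _ _ le_rfl le_rfl hz]
        refine mul_eq_zero_of_right _ (abs_nonpos_iff.1 (this.trans (by simp)))
      have h2 : K φhat ε φ z 0 0 = 0 := by
        rw [K_eq _ _ _ hz le_rfl le_rfl]
        rcases hz.eq_or_lt with hz | hz
        · rw [← hz, gain]; simp
        · rw [W_eq_zero_of_le le_rfl le_rfl (by linarith) hz, zero_mul]
      rw [h.K_comm hε le_rfl hz le_rfl, h1, h2]
      simpa using hBc
    -- If y < z/2 the term with z in first place vanishes, since z > x + y, and the other two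
    -- cancel. If y ≥ z/2 then √(yz) ≥ z/2 makes each term bounded by itself.
    rcases lt_or_ge y (z / 2) with hlt | hge
    · have h1 := h.abs_K_add_K_le hε hφ hB hc hc0 hx hxy hy0 hlt
      have h2 : K φhat ε φ z x y = 0 := by
        rw [K_eq _ _ _ hz hx hy, W_eq_zero_of_le hx hy (by linarith) (by linarith), zero_mul]
      rw [h.K_comm hε hy hz hx, h2, add_zero]
      linarith
    · have hz0 : 0 < z := hy0.trans_le hyz
      have hq : z / 2 ≤ √(y * z) := by
        refine Real.le_sqrt_of_sq_le ?_
        nlinarith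
      have fin : ∀ {k d : ℝ}, |k| * √(y * z) ≤ 2 * B * c * d → d ≤ 2 * z →
          |k| ≤ 8 * (B * c) := by
        intro k d h1 h2
        have h3 : |k| * (z / 2) ≤ 8 * (B * c) * (z / 2) := by
          calc |k| * (z / 2) ≤ |k| * √(y * z) := by gcongr
            _ ≤ 2 * B * c * d := h1
            _ ≤ 2 * B * c * (2 * z) := by gcongr
            _ = _ := by ring
        exact le_of_mul_le_mul_right h3 (by positivity)
      have hd : ∀ {a b : ℝ}, 0 ≤ a → 0 ≤ b → a ≤ z → b ≤ z → |a - b| ≤ z := fun h1 h2 h3 h4 => by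
        rw [abs_le]; constructor <;> linarith
      have k1 := fin (h.abs_K_mul_le hε hφ hB hx hy hz (Real.sqrt_nonneg (y * z)) hc0
        (hc x y z hx hy hz).2.2 (by rw [mul_comm y z]; exact (hc x z y hx hz hy).2.2))
        (by linarith [hd hx hz (hxy.trans hyz) le_rfl, hd hx hy (hxy.trans hyz) hyz])
      have k2 := fin (h.abs_K_mul_le hε hφ hB hz hx hy (Real.sqrt_nonneg (y * z)) hc0
        (by rw [mul_comm y z]; exact (hc z x y hz hx hy).2.1)
        (by rw [mul_comm y z]; exact (hc z y x hz hy hx).1))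
        (by linarith [hd hz hx le_rfl (hxy.trans hyz), hd hz hy le_rfl hyz])
      have k3 := fin (h.abs_K_mul_le hε hφ hB hy hz hx (Real.sqrt_nonneg (y * z)) hc0
        (hc y z x hy hz hx).1 (hc y x z hy hx hz).2.1)
        (by linarith [hd hy hz hyz le_rfl, hd hy hx hyz (hxy.trans hyz)])
      rw [abs_le] at *
      constructor <;> linarith [k1.1, k1.2, k2.1, k2.2, k3.1, k3.2]
  have rot : ∀ x y z, K φhat ε φ x y z + K φhat ε φ z x y + K φhat ε φ y z x =
      K φhat ε φ y z x + K φhat ε φ x y z + K φhat ε φ z x y := fun x y z => by ring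
  have flip : ∀ {x y z}, 0 ≤ x → 0 ≤ y → 0 ≤ z →
      K φhat ε φ x y z + K φhat ε φ z x y + K φhat ε φ y z x =
      K φhat ε φ x z y + K φhat ε φ y x z + K φhat ε φ z y x := fun hx hy hz => by
    rw [h.K_comm hε hx hy hz, h.K_comm hε hz hx hy, h.K_comm hε hy hz hx]; ring
  rcases le_total x y with h1 | h1 <;> rcases le_total y z with h2 | h2 <;>
    rcases le_total x z with h3 | h3
  · exact key hx h1 h2
  · exact key hx h1 h2
  · rw [flip hx hy hz]; exact key hx h3 h2
  · rw [rot, rot]; exact key hz h3 h1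
  · rw [flip hx hy hz, rot, rot]; exact key hy h1 h3
  · rw [rot]; exact key hy h2 h3
  · rw [flip hx hy hz, rot]; exact key hz h2 h1
  · rw [flip hx hy hz, rot]; exact key hz h2 h1

theorem measurePreserving_rotate (F : Measure ℝ≥0) [SFinite F] :
    MeasurePreserving (fun p : ℝ≥0 × ℝ≥0 × ℝ≥0 => (p.2.2, p.1, p.2.1)) (F.prod (F.prod F))
      (F.prod (F.prod F)) :=
  (Measure.measurePreserving_swap (μ := F.prod F) (ν := F)).comp
    (measurePreserving_prodAssoc F F F).symm

/-- The cubic term is controlled by the cube of the mass. -/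
theorem IsAdmissible.exists_integral3_bound (h : IsAdmissible φhat) (hφ : IsTestFunction φ) :
    ∃ C, 0 ≤ C ∧ ∀ ε, 0 < ε → ∀ F : Measure ℝ≥0, IsFiniteMeasure F →
      |ε ^ 3 * integral3 (K φhat ε φ) F| ≤ C * F.real univ ^ 3 * ε := by
  obtain ⟨B, hB0, hb⟩ := hφ.exists_bound
  obtain ⟨D, hD, hd⟩ := h.exists_directBound
  refine ⟨8 * (B * D), by positivity, fun ε hε F hF => ?_⟩
  set μ := F.prod (F.prod F) with hμ
  set f : ℝ≥0 × ℝ≥0 × ℝ≥0 → ℝ := fun p => K φhat ε φ p.1 p.2.1 p.2.2 with hf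
  have hint : |∫ p, f p ∂μ| ≤ 8 * (B * (D / ε ^ 2)) * F.real univ ^ 3 := by
    -- A single kernel is not known to be integrable; if it is not, its Bochner integral is 0.
    by_cases hi : Integrable f μ
    · have m1 := measurePreserving_rotate F
      have m2 := m1.comp m1
      have i1 := m1.integrable_comp_of_integrable hi
      have i2 := m2.integrable_comp_of_integrable hi
      have e1 : ∫ p, (f ∘ fun p : ℝ≥0 × ℝ≥0 × ℝ≥0 => (p.2.2, p.1, p.2.1)) p ∂μ = ∫ p, f p ∂μ := by
        have := integral_map (μ := μ) m1.measurable.aemeasurable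
          (by rw [m1.map_eq]; exact hi.aestronglyMeasurable)
        rw [m1.map_eq] at this
        exact this.symm
      have e2 : ∫ p, (f ∘ (fun p : ℝ≥0 × ℝ≥0 × ℝ≥0 => (p.2.2, p.1, p.2.1)) ∘
          fun p : ℝ≥0 × ℝ≥0 × ℝ≥0 => (p.2.2, p.1, p.2.1)) p ∂μ = ∫ p, f p ∂μ := by
        have := integral_map (μ := μ) m2.measurable.aemeasurable
          (by rw [m2.map_eq]; exact hi.aestronglyMeasurable)
        rw [m2.map_eq] at this
        exact this.symm
      -- The product measure is invariant under rotating the three factors, so the integral sees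
      -- only the cyclic sum.
      have e3 : 3 * ∫ p, f p ∂μ = ∫ p : ℝ≥0 × ℝ≥0 × ℝ≥0, (K φhat ε φ p.1 p.2.1 p.2.2 +
          K φhat ε φ p.2.2 p.1 p.2.1 + K φhat ε φ p.2.1 p.2.2 p.1) ∂μ := by
        have s1 := integral_add (hi.add i1) i2
        have s2 := integral_add hi i1
        simp only [Pi.add_apply] at s1 s2
        rw [s2, e1, e2] at s1
        simp only [Function.comp_apply] at s1
        rw [← s1.trans (by ring : _ = 3 * ∫ p, f p ∂μ)]
      have e4 : |3 * ∫ p, f p ∂μ| ≤ 24 * (B * (D / ε ^ 2)) * μ.real univ := by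
        rw [e3]
        have hb' : ∀ p : ℝ≥0 × ℝ≥0 × ℝ≥0, ‖K φhat ε φ p.1 p.2.1 p.2.2 +
            K φhat ε φ p.2.2 p.1 p.2.1 + K φhat ε φ p.2.1 p.2.2 p.1‖ ≤ 24 * (B * (D / ε ^ 2)) :=
          fun p => h.abs_sum_K_le hε hφ (fun x hx => (hb x hx).2.2) (hd ε hε) (by positivity)
            p.1.coe_nonneg p.2.1.coe_nonneg p.2.2.coe_nonneg
        exact norm_integral_le_of_norm_le_const (ae_of_all _ hb')
      have e5 : μ.real univ = F.real univ ^ 3 := by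
        rw [hμ, ← univ_prod_univ, measureReal_prod_prod, ← univ_prod_univ, measureReal_prod_prod]
        ring
      rw [abs_mul, abs_of_pos three_pos, e5] at e4
      linarith
    · rw [integral_undef hi, abs_zero]
      positivity
  have e : integral3 (K φhat ε φ) F = ∫ p, f p ∂μ := rfl
  rw [e, abs_mul, abs_of_pos (by positivity)]
  calc ε ^ 3 * |∫ p, f p ∂μ| ≤ ε ^ 3 * (8 * (B * (D / ε ^ 2)) * F.real univ ^ 3) := by gcongr
    _ = _ := by field_simp

end CubicBound

/-! ### Weak compactness of measures with a bounded moment. -/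

section WeakConvergence

open scoped BoundedContinuousFunction ENNReal

/-- The finite measures with `∫ (1 + x) dν ≤ M`. -/
def momentSet (M : ℝ≥0) : Set (FiniteMeasure ℝ≥0) :=
  {ν | ∫⁻ x, ((1 + x : ℝ≥0) : ℝ≥0∞) ∂(ν : Measure ℝ≥0) ≤ M}

/-- The function `min (1 + x) N`. -/
def truncatedMoment (N : ℕ) : ℝ≥0 →ᵇ ℝ≥0 :=
  BoundedContinuousFunction.mkOfBound ⟨fun x => min (1 + x) N, by fun_prop⟩ N fun x y => by
    have h1 : ((min (1 + x) N : ℝ≥0) : ℝ) ≤ N := by exact_mod_cast min_le_right (1 + x) (N : ℝ≥0)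
    have h2 : ((min (1 + y) N : ℝ≥0) : ℝ) ≤ N := by exact_mod_cast min_le_right (1 + y) (N : ℝ≥0)
    have h3 := (min (1 + x) N : ℝ≥0).coe_nonneg
    have h4 := (min (1 + y) N : ℝ≥0).coe_nonneg
    change dist (min (1 + x) N : ℝ≥0) (min (1 + y) N) ≤ _
    rw [NNReal.dist_eq, abs_le]
    constructor <;> linarith

/-- Lower semicontinuity of the moment: it is the supremum of the integrals of the bounded
continuous functions min(1 + x, N), each weakly continuous. -/
theorem isClosed_momentSet (M : ℝ≥0) : IsClosed (momentSet M) := by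
  have e : momentSet M = ⋂ N : ℕ, {ν : FiniteMeasure ℝ≥0 |
      ∫⁻ x, truncatedMoment N x ∂(ν : Measure ℝ≥0) ≤ M} := by
    ext ν
    simp only [momentSet, mem_ofPred_eq, mem_iInter]
    constructor
    · intro h N
      refine (lintegral_mono fun x => ?_).trans h
      exact ENNReal.coe_le_coe.2 (min_le_left (1 + x) (N : ℝ≥0))
    · intro h
      have ht : Tendsto (fun N : ℕ => ∫⁻ x, truncatedMoment N x ∂(ν : Measure ℝ≥0)) atTop
          (𝓝 (∫⁻ x, ((1 + x : ℝ≥0) : ℝ≥0∞) ∂(ν : Measure ℝ≥0))) := by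
        refine lintegral_tendsto_of_tendsto_of_monotone
          (fun N => by have := (truncatedMoment N).continuous; fun_prop)
          (ae_of_all _ fun x m n hmn => ?_) (ae_of_all _ fun x => ?_)
        · exact ENNReal.coe_le_coe.2 (min_le_min_left (1 + x) (by exact_mod_cast hmn))
        · refine tendsto_const_nhds.congr' ?_
          filter_upwards [eventually_ge_atTop ⌈1 + x⌉₊] with N hN
          have : min (1 + x) (N : ℝ≥0) = 1 + x :=
            min_eq_left ((Nat.le_ceil _).trans (by exact_mod_cast hN))
          exact congrArg _ this.symm
      exact le_of_tendsto' ht h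
  rw [e]
  exact isClosed_iInter fun N => isClosed_le
    (FiniteMeasure.continuous_lintegral_boundedContinuousFunction _) continuous_const

/-- Markov's inequality bounds the mass outside [0, n] by M/(n + 1), so the set is tight and
Prokhorov's theorem applies. -/
theorem isCompact_momentSet (M : ℝ≥0) : IsCompact (momentSet M) := by
  have hu : Tendsto (fun n : ℕ => M / ((n : ℝ≥0) + 1)) atTop (𝓝 0) := by
    have := (tendsto_one_div_add_atTop_nhds_zero_nat (𝕜 := ℝ≥0)).const_mul M
    simpa [div_eq_mul_inv] using this
  refine (isCompact_setOfPred_finiteMeasure_mass_le_compl_isCompact_le (E := ℝ≥0)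
    (K := fun n : ℕ => Icc 0 (n : ℝ≥0)) M hu (fun n => isCompact_Icc)
    (Or.inl inferInstance)).of_isClosed_subset (isClosed_momentSet M) fun ν hν => ⟨?_, fun n => ?_⟩
  · have h : (ν : Measure ℝ≥0) univ ≤ M := by
      rw [← lintegral_one]
      refine (lintegral_mono fun x => ?_).trans hν
      simp
    rw [← FiniteMeasure.ennreal_mass] at h
    exact_mod_cast h
  · have h1 := mul_meas_ge_le_lintegral (μ := (ν : Measure ℝ≥0))
      (f := fun x => ((1 + x : ℝ≥0) : ℝ≥0∞)) (by fun_prop) ((n + 1 : ℝ≥0) : ℝ≥0∞)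
    have h2 : (ν : Measure ℝ≥0) (Icc 0 (n : ℝ≥0))ᶜ ≤
        (ν : Measure ℝ≥0) {x | ((n + 1 : ℝ≥0) : ℝ≥0∞) ≤ ((1 + x : ℝ≥0) : ℝ≥0∞)} := by
      refine measure_mono fun x hx => ?_
      have hx' : (n : ℝ≥0) < x := by
        by_contra! hc
        exact hx ⟨zero_le, hc⟩
      refine ENNReal.coe_le_coe.2 ?_
      rw [add_comm]
      gcongr
    have h3 : ((n + 1 : ℝ≥0) : ℝ≥0∞) * (ν (Icc 0 (n : ℝ≥0))ᶜ : ℝ≥0) ≤ M := by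
      rw [FiniteMeasure.ennreal_coeFn_eq_coeFn_toMeasure]
      exact (mul_le_mul_right h2 _).trans (h1.trans hν)
    have h4 : (n + 1 : ℝ≥0) * ν (Icc 0 (n : ℝ≥0))ᶜ ≤ M := by exact_mod_cast h3
    rw [le_div_iff₀ (by positivity), mul_comm]
    exact h4

theorem integrable_moment {M : ℝ≥0} {ν : FiniteMeasure ℝ≥0} (h : ν ∈ momentSet M) :
    Integrable (fun x : ℝ≥0 => 1 + (x : ℝ)) (ν : Measure ℝ≥0) ∧
      ∫ x : ℝ≥0, (1 + (x : ℝ)) ∂(ν : Measure ℝ≥0) ≤ M := by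
  have e : ∀ x : ℝ≥0, ENNReal.ofReal (1 + (x : ℝ)) = ((1 + x : ℝ≥0) : ℝ≥0∞) := fun x => by
    rw [← ENNReal.ofReal_coe_nnreal]; rfl
  have hm : AEStronglyMeasurable (fun x : ℝ≥0 => 1 + (x : ℝ)) (ν : Measure ℝ≥0) :=
    Continuous.aestronglyMeasurable (by fun_prop)
  have hnn : 0 ≤ᵐ[(ν : Measure ℝ≥0)] fun x : ℝ≥0 => 1 + (x : ℝ) :=
    ae_of_all _ fun x => by positivity
  have hl : ∫⁻ x : ℝ≥0, ENNReal.ofReal (1 + (x : ℝ)) ∂(ν : Measure ℝ≥0) ≤ M := by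
    simp only [e]; exact h
  constructor
  · refine ⟨hm, ?_⟩
    rw [hasFiniteIntegral_iff_ofReal hnn]
    exact hl.trans_lt ENNReal.coe_lt_top
  · rw [integral_eq_lintegral_of_nonneg_ae hnn hm]
    exact ENNReal.toReal_le_of_le_ofReal M.coe_nonneg (by rwa [ENNReal.ofReal_coe_nnreal])

theorem mem_momentSet {M : ℝ≥0} {ν : FiniteMeasure ℝ≥0}
    (hi : Integrable (fun x : ℝ≥0 => 1 + (x : ℝ)) (ν : Measure ℝ≥0))
    (hM : ∫ x : ℝ≥0, (1 + (x : ℝ)) ∂(ν : Measure ℝ≥0) ≤ M) : ν ∈ momentSet M := by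
  have e : ∀ x : ℝ≥0, ENNReal.ofReal (1 + (x : ℝ)) = ((1 + x : ℝ≥0) : ℝ≥0∞) := fun x => by
    rw [← ENNReal.ofReal_coe_nnreal]; rfl
  have := ofReal_integral_eq_lintegral_ofReal hi (ae_of_all _ fun x => by positivity)
  simp only [e] at this
  rw [momentSet, mem_ofPred_eq, ← this, ← ENNReal.ofReal_coe_nnreal]
  exact ENNReal.ofReal_le_ofReal hM

theorem measureReal_le_moment {M : ℝ≥0} {ν : FiniteMeasure ℝ≥0} (h : ν ∈ momentSet M) :
    (ν : Measure ℝ≥0).real univ ≤ M := by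
  obtain ⟨hi, hM⟩ := integrable_moment h
  refine le_trans ?_ hM
  have := integral_mono (μ := (ν : Measure ℝ≥0)) (integrable_const (1 : ℝ)) hi fun x => by
    simp
  simpa using this

/-- A smooth function equal to `1` near the origin and vanishing at infinity. -/
def cutoff (b c : ℕ) (x : ℝ) : ℝ := Real.smoothTransition (b - (c + 1) * x)

theorem cutoff_nonneg (b c : ℕ) (x : ℝ) : 0 ≤ cutoff b c x := Real.smoothTransition.nonneg _

theorem cutoff_le_one (b c : ℕ) (x : ℝ) : cutoff b c x ≤ 1 := Real.smoothTransition.le_one _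

theorem isTestFunction_cutoff (b c : ℕ) : IsTestFunction (cutoff b c) := by
  refine ⟨ContDiff.contDiffOn ?_, b, fun x hx => Real.smoothTransition.zero_of_nonpos ?_⟩
  · exact Real.smoothTransition.contDiff.comp (by fun_prop)
  · have h0 : (0 : ℝ) ≤ x := (Nat.cast_nonneg b).trans hx
    nlinarith [mul_nonneg (Nat.cast_nonneg (α := ℝ) c) h0]

/-- The restriction of a test function to the half line. -/
def IsTestFunction.toBounded {φ : ℝ → ℝ} (h : IsTestFunction φ) : ℝ≥0 →ᵇ ℝ :=
  BoundedContinuousFunction.ofNormedAddCommGroup (fun x : ℝ≥0 => φ x)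
    (continuous_restrict h.continuousOn) h.exists_bound.choose
    fun x => (h.exists_bound.choose_spec.2 x x.coe_nonneg).1

/-- A countable family of test functions determines a measure. This is what makes diagonal
extraction possible. -/
theorem ext_of_cutoff {μ ν : FiniteMeasure ℝ≥0}
    (h : ∀ b c : ℕ, ∫ x : ℝ≥0, cutoff b c x ∂(μ : Measure ℝ≥0) =
      ∫ x : ℝ≥0, cutoff b c x ∂(ν : Measure ℝ≥0)) : μ = ν := by
  refine FiniteMeasure.toMeasure_injective (Measure.ext_of_Iic _ _ fun a => ?_)
  have key : ∀ ρ : FiniteMeasure ℝ≥0, Tendsto (fun c : ℕ =>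
      -- With this b the cutoff equals 1 up to a and vanishes beyond a + 2/(c + 1), so it tends to
      -- the indicator of `Iic a`.
      ∫ x : ℝ≥0, cutoff (⌈((c : ℝ) + 1) * a⌉₊ + 1) c x ∂(ρ : Measure ℝ≥0)) atTop
        (𝓝 ((ρ : Measure ℝ≥0).real (Iic a))) := by
    intro ρ
    rw [← integral_indicator_one measurableSet_Iic]
    refine tendsto_integral_of_dominated_convergence (fun _ => 1)
      (fun c => (continuous_restrict (isTestFunction_cutoff _ c).continuousOn).aestronglyMeasurable)
      (integrable_const _) (fun c => ae_of_all _ fun x => ?_) (ae_of_all _ fun x => ?_)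
    · rw [Real.norm_of_nonneg (cutoff_nonneg _ _ _)]
      exact cutoff_le_one _ _ _
    · by_cases hx : x ≤ a
      · rw [indicator_of_mem (mem_Iic.2 hx), Pi.one_apply]
        refine tendsto_const_nhds.congr fun c => ?_
        rw [cutoff, Real.smoothTransition.one_of_one_le]
        have h1 := Nat.le_ceil (((c : ℝ) + 1) * a)
        have h2 : ((c : ℝ) + 1) * x ≤ ((c : ℝ) + 1) * a := by gcongr
        push_cast
        linarith
      · rw [indicator_of_notMem (by simpa using hx)]
        refine tendsto_const_nhds.congr' ?_
        have hax : 0 < (x : ℝ) - a := sub_pos.2 (by exact_mod_cast not_le.1 hx)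
        filter_upwards [eventually_ge_atTop ⌈2 / ((x : ℝ) - a)⌉₊] with c hc
        rw [cutoff, Real.smoothTransition.zero_of_nonpos]
        have h1 := Nat.ceil_lt_add_one (show 0 ≤ ((c : ℝ) + 1) * a by positivity)
        have h2 : 2 / ((x : ℝ) - a) ≤ c := Nat.ceil_le.1 hc
        rw [div_le_iff₀ hax] at h2
        push_cast
        nlinarith
  have h1 := key μ
  simp only [h] at h1
  have := tendsto_nhds_unique h1 (key ν)
  rwa [measureReal_def, measureReal_def, ENNReal.toReal_eq_toReal_iff' (measure_ne_top _ _)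
    (measure_ne_top _ _)] at this

theorem IsTestFunction.tendsto_integral {φ : ℝ → ℝ} (h : IsTestFunction φ) {ι : Type*}
    {l : Filter ι} {ν : ι → FiniteMeasure ℝ≥0} {ρ : FiniteMeasure ℝ≥0} (ht : Tendsto ν l (𝓝 ρ)) :
    Tendsto (fun i => ∫ x : ℝ≥0, φ x ∂(ν i : Measure ℝ≥0)) l
      (𝓝 (∫ x : ℝ≥0, φ x ∂(ρ : Measure ℝ≥0))) :=
  FiniteMeasure.tendsto_iff_forall_integral_tendsto.1 ht h.toBounded

/-- In the class of measures with a bounded moment, convergence against cutoff functions implies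
weak convergence. -/
theorem tendsto_of_cutoff {M : ℝ≥0} {ι : Type*} {l : Filter ι} {ν : ι → FiniteMeasure ℝ≥0}
    {ρ : FiniteMeasure ℝ≥0} (hν : ∀ᶠ i in l, ν i ∈ momentSet M)
    (h : ∀ b c : ℕ, Tendsto (fun i => ∫ x : ℝ≥0, cutoff b c x ∂(ν i : Measure ℝ≥0)) l
      (𝓝 (∫ x : ℝ≥0, cutoff b c x ∂(ρ : Measure ℝ≥0)))) : Tendsto ν l (𝓝 ρ) := by
  refine (isCompact_momentSet M).tendsto_nhds_of_unique_mapClusterPt hν fun σ _ hσ =>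
    ext_of_cutoff fun b c => ?_
  have h1 : MapClusterPt (∫ x : ℝ≥0, cutoff b c x ∂(σ : Measure ℝ≥0)) l
      (fun i => ∫ x : ℝ≥0, cutoff b c x ∂(ν i : Measure ℝ≥0)) :=
    hσ.tendsto_comp ((isTestFunction_cutoff b c).tendsto_integral tendsto_id)
  obtain ⟨u, hu1, hu2⟩ := mapClusterPt_iff_ultrafilter.1 h1
  exact tendsto_nhds_unique hu2 ((h b c).mono_left hu1)

theorem exists_tendsto_of_cutoff {M : ℝ≥0} {ν : ℕ → FiniteMeasure ℝ≥0} (hν : ∀ n, ν n ∈ momentSet M)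
    (h : ∀ b c : ℕ, ∃ a, Tendsto (fun n => ∫ x : ℝ≥0, cutoff b c x ∂(ν n : Measure ℝ≥0)) atTop
      (𝓝 a)) : ∃ ρ ∈ momentSet M, Tendsto ν atTop (𝓝 ρ) := by
  obtain ⟨ρ, hρ, hc⟩ := isCompact_momentSet M (f := map ν atTop)
    (tendsto_principal.2 (Eventually.of_forall hν))
  replace hc : MapClusterPt ρ atTop ν := hc
  refine ⟨ρ, hρ, tendsto_of_cutoff (Eventually.of_forall hν) fun b c => ?_⟩
  obtain ⟨a, ha⟩ := h b c
  have h1 : MapClusterPt (∫ x : ℝ≥0, cutoff b c x ∂(ρ : Measure ℝ≥0)) atTop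
      (fun i => ∫ x : ℝ≥0, cutoff b c x ∂(ν i : Measure ℝ≥0)) :=
    hc.tendsto_comp ((isTestFunction_cutoff b c).tendsto_integral tendsto_id)
  obtain ⟨u, hu1, hu2⟩ := mapClusterPt_iff_ultrafilter.1 h1
  rwa [tendsto_nhds_unique hu2 (ha.mono_left hu1)]

/-- After normalization this is continuity of the product of probability measures. A zero limit
cannot be normalized and is handled by the sup norm times the squared mass. -/
theorem tendsto_integral_prod {X : Type*} [TopologicalSpace X] [MeasurableSpace X]
    [SecondCountableTopology X] [TopologicalSpace.PseudoMetrizableSpace X] [BorelSpace X]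
    [Nonempty X]
    {ι : Type*} {l : Filter ι} {ν : ι → FiniteMeasure X} {ρ : FiniteMeasure X}
    (ht : Tendsto ν l (𝓝 ρ)) (f : X × X →ᵇ ℝ) :
    Tendsto (fun i => ∫ p, f p ∂((ν i : Measure X).prod (ν i : Measure X))) l
      (𝓝 (∫ p, f p ∂((ρ : Measure X).prod (ρ : Measure X)))) := by
  have hm : Tendsto (fun i => ((ν i).mass : ℝ) ^ 2) l (𝓝 ((ρ.mass : ℝ) ^ 2)) :=
    ((NNReal.continuous_coe.tendsto _).comp ht.mass).pow 2
  have hsq : ∀ σ : FiniteMeasure X, ∫ p, f p ∂((σ : Measure X).prod (σ : Measure X)) =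
      (σ.mass : ℝ) ^ 2 * ∫ p, f p ∂((σ.normalize.prod σ.normalize : ProbabilityMeasure (X × X)) :
        Measure (X × X)) := by
    intro σ
    have e : (σ : Measure X) = σ.mass • (σ.normalize : Measure X) := by
      conv_lhs => rw [σ.self_eq_mass_smul_normalize]
      rfl
    rw [ProbabilityMeasure.toMeasure_prod]
    conv_lhs => rw [e]
    rw [Measure.prod_smul_left, Measure.prod_smul_right, integral_smul_nnreal_measure,
      integral_smul_nnreal_measure, NNReal.smul_def, NNReal.smul_def, smul_eq_mul, smul_eq_mul]
    ring
  by_cases h0 : ρ = 0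
  · subst h0
    have e0 : ∫ p, f p ∂(((0 : FiniteMeasure X) : Measure X).prod (0 : FiniteMeasure X)) = 0 := by
      simp
    rw [e0]
    have hm' : Tendsto (fun i => ‖f‖ * ((ν i).mass : ℝ) ^ 2) l (𝓝 0) := by
      simpa using hm.const_mul ‖f‖
    refine squeeze_zero_norm (fun i => ?_) hm'
    refine (norm_integral_le_of_norm_le_const (ae_of_all _ f.norm_coe_le_norm)).trans (le_of_eq ?_)
    rw [← univ_prod_univ, measureReal_prod_prod, sq]
    rfl
  · simp only [hsq]
    have hn := FiniteMeasure.tendsto_normalize_of_tendsto ht h0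
    have hp : Tendsto (fun i => (ν i).normalize.prod (ν i).normalize) l
        (𝓝 (ρ.normalize.prod ρ.normalize)) :=
      (ProbabilityMeasure.continuous_prod.tendsto (ρ.normalize, ρ.normalize)).comp
        (hn.prodMk_nhds hn)
    exact hm.mul (ProbabilityMeasure.tendsto_iff_forall_integral_tendsto.1 hp f)

/-- Diagonal extraction for a countable family of bounded real sequences. -/
theorem exists_subseq_tendsto {ι : Type*} [Countable ι] {f : ℕ → ι → ℝ} {C : ι → ℝ}
    (hf : ∀ n i, |f n i| ≤ C i) :
    ∃ k : ℕ → ℕ, StrictMono k ∧ ∀ i, ∃ a, Tendsto (fun n => f (k n) i) atTop (𝓝 a) := by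
  have hc : IsCompact (univ.pi fun i => Icc (-C i) (C i)) := isCompact_univ_pi fun i => isCompact_Icc
  obtain ⟨a, -, k, hk, ha⟩ := hc.tendsto_subseq (x := f) fun n i _ => abs_le.1 (hf n i)
  exact ⟨k, hk, fun i => ⟨a i, (tendsto_pi_nhds.1 ha) i⟩⟩

end WeakConvergence

/-! ### Passage to the limit in the quadratic term, and compactness of curves of measures. -/

section Limit

open scoped BoundedContinuousFunction

variable {φhat φ : ℝ → ℝ} {M : ℝ≥0}

theorem integrable_mul_moment {ν : FiniteMeasure ℝ≥0} (h : ν ∈ momentSet M) :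
    Integrable (fun p : ℝ≥0 × ℝ≥0 => (1 + (p.1 : ℝ)) * (1 + (p.2 : ℝ)))
      ((ν : Measure ℝ≥0).prod (ν : Measure ℝ≥0)) ∧
    ∫ p : ℝ≥0 × ℝ≥0, (1 + (p.1 : ℝ)) * (1 + (p.2 : ℝ))
      ∂((ν : Measure ℝ≥0).prod (ν : Measure ℝ≥0)) ≤ (M : ℝ) ^ 2 := by
  obtain ⟨hi, hM⟩ := integrable_moment h
  refine ⟨hi.mul_prod hi, ?_⟩
  rw [integral_prod_mul (fun x : ℝ≥0 => 1 + (x : ℝ)) fun x : ℝ≥0 => 1 + (x : ℝ), sq]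
  have h0 : 0 ≤ ∫ x : ℝ≥0, (1 + (x : ℝ)) ∂(ν : Measure ℝ≥0) :=
    integral_nonneg fun x => by positivity
  gcongr

theorem abs_integral2_le {Ψ : ℝ → ℝ → ℝ} {ν : FiniteMeasure ℝ≥0} (h : ν ∈ momentSet M) {C : ℝ}
    (hC : 0 ≤ C) (hΨ : ∀ y z, 0 ≤ y → 0 ≤ z → |Ψ y z| ≤ C * ((1 + y) * (1 + z))) :
    |integral2 Ψ ν| ≤ C * (M : ℝ) ^ 2 := by
  obtain ⟨hi, hM⟩ := integrable_mul_moment h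
  have hb : ∀ p : ℝ≥0 × ℝ≥0, ‖Ψ p.1 p.2‖ ≤ C * ((1 + (p.1 : ℝ)) * (1 + (p.2 : ℝ))) :=
    fun p => hΨ p.1 p.2 p.1.coe_nonneg p.2.coe_nonneg
  refine (norm_integral_le_of_norm_le (hi.const_mul C) (ae_of_all _ hb)).trans ?_
  rw [integral_const_mul]
  gcongr

theorem integrable_of_moment {Ψ : ℝ → ℝ → ℝ} {ν : FiniteMeasure ℝ≥0} (h : ν ∈ momentSet M) {C : ℝ}
    (hm : Measurable fun p : ℝ≥0 × ℝ≥0 => Ψ p.1 p.2)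
    (hΨ : ∀ y z, 0 ≤ y → 0 ≤ z → |Ψ y z| ≤ C * ((1 + y) * (1 + z))) :
    Integrable (fun p : ℝ≥0 × ℝ≥0 => Ψ p.1 p.2)
      ((ν : Measure ℝ≥0).prod (ν : Measure ℝ≥0)) :=
  ((integrable_mul_moment h).1.const_mul C).mono' hm.aestronglyMeasurable
    (ae_of_all _ fun p : ℝ≥0 × ℝ≥0 => hΨ p.1 p.2 p.1.coe_nonneg p.2.coe_nonneg)

theorem sqrt_max_le {y z : ℝ} (hy : 0 ≤ y) (hz : 0 ≤ z) : √(max y z) ≤ (1 + y) * (1 + z) := by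
  have hm : 0 ≤ max y z := hy.trans (le_max_left _ _)
  have h1 : √(max y z) ≤ 1 + max y z := by
    rw [Real.sqrt_le_left (by positivity)]
    nlinarith
  have h2 : max y z ≤ y + z := max_le (by linarith) (by linarith)
  nlinarith [mul_nonneg hy hz]

theorem IsAdmissible.exists_J_le_moment (h : IsAdmissible φhat) (hφ : IsTestFunction φ) :
    ∃ C : ℝ, 0 ≤ C ∧ ∀ ε, 0 < ε → ∀ y z, 0 ≤ y → 0 ≤ z →
      |J φhat ε φ y z| ≤ C * ((1 + y) * (1 + z)) := by
  obtain ⟨C, hC, hb⟩ := h.exists_J_bound hφ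
  exact ⟨C, hC, fun ε hε y z hy hz => (hb ε hε y z hy hz).trans
    (mul_le_mul_of_nonneg_left (sqrt_max_le hy hz) hC)⟩

theorem IsTestFunction.abs_L_le_moment (hφ : IsTestFunction φ) {B : ℝ}
    (hB : ∀ x, 0 ≤ x → |d2 φ x| ≤ B) {y z : ℝ} (hy : 0 ≤ y) (hz : 0 ≤ z) :
    |L φ y z| ≤ 12 * Real.pi * B * ((1 + y) * (1 + z)) := by
  have hB0 : 0 ≤ B := (abs_nonneg _).trans (hB 0 le_rfl)
  have := Real.pi_pos
  exact (hφ.abs_L_le_sqrt hB hy hz).trans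
    (mul_le_mul_of_nonneg_left (sqrt_max_le hy hz) (by positivity))

/-- Local uniform convergence covers bounded energies. At large energies both kernels are at most of
order √max, which is at most δ max once √max ≥ A/δ, and the moment bound controls that weight
uniformly. -/
theorem IsAdmissible.eventually_abs_J_sub_L_le (h : IsAdmissible φhat) (hφ : IsTestFunction φ)
    {δ : ℝ} (hδ : 0 < δ) :
    ∀ᶠ ε in 𝓝[>] (0 : ℝ), ∀ y z, 0 ≤ y → 0 ≤ z →
      |J φhat ε φ y z - L φ y z| ≤ δ * ((1 + y) * (1 + z)) := by
  obtain ⟨B, hB0, hb⟩ := hφ.exists_bound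
  obtain ⟨C, hC, hJ⟩ := h.exists_J_bound hφ
  have hpi := Real.pi_pos
  set A := C + 12 * Real.pi * B with hA
  have hA0 : 0 < A := by positivity
  filter_upwards [h.J_tendsto_L hφ (R := (A / δ) ^ 2) (by positivity) hδ, self_mem_nhdsWithin]
    with ε hε hε0 y z hy hz
  have hyz : 0 ≤ y * z := mul_nonneg hy hz
  by_cases hR : max y z ≤ (A / δ) ^ 2
  · refine (hε y z hy hz ((le_max_left _ _).trans hR) ((le_max_right _ _).trans hR)).trans ?_
    exact le_mul_of_one_le_right hδ.le (by nlinarith)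
  · have hm : 0 ≤ max y z := hy.trans (le_max_left _ _)
    have h1 : A / δ ≤ √(max y z) := Real.le_sqrt_of_sq_le (not_le.1 hR).le
    rw [div_le_iff₀ hδ] at h1
    have h2 := hJ ε hε0 y z hy hz
    have h3 := hφ.abs_L_le_sqrt (fun x hx => (hb x hx).2.2) hy hz
    have h4 := abs_sub (J φhat ε φ y z) (L φ y z)
    have h5 : max y z ≤ (1 + y) * (1 + z) := by
      have : max y z ≤ y + z := max_le (by linarith) (by linarith)
      nlinarith
    calc |J φhat ε φ y z - L φ y z| ≤ A * √(max y z) := by rw [hA, add_mul]; linarith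
      _ ≤ √(max y z) * δ * √(max y z) := by gcongr
      _ = δ * (√(max y z) * √(max y z)) := by ring
      _ = δ * max y z := by rw [Real.mul_self_sqrt hm]
      _ ≤ _ := by gcongr

/-- The kernel of the Fokker–Planck–Landau equation as a bounded continuous function. -/
def IsTestFunction.boundedL (hφ : IsTestFunction φ) : ℝ≥0 × ℝ≥0 →ᵇ ℝ :=
  BoundedContinuousFunction.ofNormedAddCommGroup (fun p : ℝ≥0 × ℝ≥0 => L φ p.1 p.2)
    hφ.continuous_L hφ.exists_L_bound.choose
    fun p => hφ.exists_L_bound.choose_spec.2 p.1 p.2 p.1.coe_nonneg p.2.coe_nonneg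

theorem IsTestFunction.tendsto_integral2_L (hφ : IsTestFunction φ) {ι : Type*} {l : Filter ι}
    {ν : ι → FiniteMeasure ℝ≥0} {ρ : FiniteMeasure ℝ≥0} (ht : Tendsto ν l (𝓝 ρ)) :
    Tendsto (fun i => integral2 (L φ) (ν i)) l (𝓝 (integral2 (L φ) ρ)) :=
  tendsto_integral_prod ht hφ.boundedL

/-- Convergence of the quadratic collision terms along a weakly convergent sequence. -/
theorem IsAdmissible.tendsto_integral2_J (h : IsAdmissible φhat) (hφ : IsTestFunction φ)
    {e : ℕ → ℝ} (he : Tendsto e atTop (𝓝[>] 0)) {ν : ℕ → FiniteMeasure ℝ≥0} {ρ : FiniteMeasure ℝ≥0}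
    (hν : ∀ n, ν n ∈ momentSet M) (ht : Tendsto ν atTop (𝓝 ρ)) :
    Tendsto (fun n => integral2 (J φhat (e n) φ) (ν n)) atTop (𝓝 (integral2 (L φ) ρ)) := by
  obtain ⟨C, hC, hJ⟩ := h.exists_J_le_moment hφ
  obtain ⟨B, hB0, hb⟩ := hφ.exists_bound
  have hdiff : Tendsto (fun n => integral2 (J φhat (e n) φ) (ν n) - integral2 (L φ) (ν n)) atTop
      (𝓝 0) := by
    rw [Metric.tendsto_atTop']
    intro η hη
    have hM : 0 < (M : ℝ) ^ 2 + 1 := by positivity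
    have hev := he.eventually ((h.eventually_abs_J_sub_L_le hφ (δ := η / (M ^ 2 + 1))
      (by positivity)).and self_mem_nhdsWithin)
    obtain ⟨N, hN⟩ := eventually_atTop.1 hev
    refine ⟨N, fun n hn => ?_⟩
    obtain ⟨h1, h2⟩ := hN n hn.le
    have i1 := integrable_of_moment (hν n) (h.measurable_J h2 hφ) (hJ _ h2)
    have i2 := integrable_of_moment (hν n) hφ.continuous_L.measurable
      (fun y z hy hz => hφ.abs_L_le_moment (fun x hx => (hb x hx).2.2) hy hz)
    have e1 : integral2 (J φhat (e n) φ) (ν n) - integral2 (L φ) (ν n) =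
        integral2 (fun y z => J φhat (e n) φ y z - L φ y z) (ν n) := (integral_sub i1 i2).symm
    rw [dist_zero_right, e1]
    refine (abs_integral2_le (hν n) (by positivity) h1).trans_lt ?_
    rw [div_mul_eq_mul_div, div_lt_iff₀ hM]
    nlinarith
  simpa using hdiff.add (hφ.tendsto_integral2_L ht)

/-- Equicontinuous curves of measures with a bounded moment have a subsequence converging weakly at
all times. -/
theorem exists_subseq_tendsto_curve {ν : ℕ → ℝ≥0 → FiniteMeasure ℝ≥0}
    (hν : ∀ n t, ν n t ∈ momentSet M)
    (hL : ∀ b c : ℕ, ∃ C : ℝ, 0 ≤ C ∧ ∀ n s t, |∫ x : ℝ≥0, cutoff b c x ∂(ν n t : Measure ℝ≥0) -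
      ∫ x : ℝ≥0, cutoff b c x ∂(ν n s : Measure ℝ≥0)| ≤ C * dist t s) :
    ∃ k : ℕ → ℕ, StrictMono k ∧ ∃ ρ : ℝ≥0 → FiniteMeasure ℝ≥0, Continuous ρ ∧
      ∀ t, ρ t ∈ momentSet M ∧ Tendsto (fun n => ν (k n) t) atTop (𝓝 (ρ t)) := by
  set u : ℕ × ℕ → ℕ → ℝ≥0 → ℝ := fun b n t =>
    ∫ x : ℝ≥0, cutoff b.1 b.2 x ∂(ν n t : Measure ℝ≥0) with hu
  have hub : ∀ b n t, |u b n t| ≤ M := fun b n t => by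
    refine le_trans ?_ (measureReal_le_moment (hν n t))
    have := norm_integral_le_of_norm_le_const (μ := (ν n t : Measure ℝ≥0)) (C := 1)
      (f := fun x : ℝ≥0 => cutoff b.1 b.2 x) (ae_of_all _ fun x => by
        rw [Real.norm_of_nonneg (cutoff_nonneg _ _ _)]; exact cutoff_le_one _ _ _)
    rwa [one_mul] at this
  obtain ⟨k, hk, hconv⟩ := exists_subseq_tendsto (ι := (ℕ × ℕ) × ℕ)
    (f := fun n i => u i.1 n (TopologicalSpace.denseSeq ℝ≥0 i.2)) (C := fun _ => M)
    fun n i => hub _ _ _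
  -- Convergence at a dense sequence of times extends to every time by the Lipschitz bound uniform
  -- in n.
  have hall : ∀ b t, ∃ a, Tendsto (fun n => u b (k n) t) atTop (𝓝 a) := by
    intro b t
    refine cauchySeq_tendsto_of_complete (Metric.cauchySeq_iff'.2 fun η hη => ?_)
    obtain ⟨C, hC, hLip⟩ := hL b.1 b.2
    obtain ⟨j, hj⟩ := (TopologicalSpace.denseRange_denseSeq ℝ≥0).exists_dist_lt t
      (show 0 < η / (3 * (C + 1)) by positivity)
    obtain ⟨a, ha⟩ := hconv (b, j)
    obtain ⟨N, hN⟩ := Metric.cauchySeq_iff'.1 ha.cauchySeq (η / 3) (by positivity)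
    refine ⟨N, fun n hn => ?_⟩
    have h1 := hN n hn
    have h2 : ∀ n, |u b (k n) t - u b (k n) (TopologicalSpace.denseSeq ℝ≥0 j)| < η / 3 := fun n => by
      refine (hLip (k n) _ t).trans_lt ?_
      rw [lt_div_iff₀ (by positivity)] at hj
      nlinarith [dist_nonneg (x := t) (y := TopologicalSpace.denseSeq ℝ≥0 j)]
    have h3 := h2 n
    have h4 := h2 N
    rw [Real.dist_eq, abs_lt] at *
    dsimp only at h1
    constructor <;> linarith [h1.1, h1.2, h3.1, h3.2, h4.1, h4.2]
  choose ρ hρ ht using fun t => exists_tendsto_of_cutoff (M := M) (ν := fun n => ν (k n) t)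
    (fun n => hν _ t) fun b c => hall (b, c) t
  refine ⟨k, hk, ρ, ?_, fun t => ⟨hρ t, ht t⟩⟩
  refine continuous_iff_continuousAt.2 fun t =>
    tendsto_of_cutoff (Eventually.of_forall hρ) fun b c => ?_
  obtain ⟨C, hC, hLip⟩ := hL b c
  have hlim := fun t => (isTestFunction_cutoff b c).tendsto_integral (ht t)
  have hLim : ∀ s, |∫ x : ℝ≥0, cutoff b c x ∂(ρ s : Measure ℝ≥0) -
      ∫ x : ℝ≥0, cutoff b c x ∂(ρ t : Measure ℝ≥0)| ≤ C * dist s t := fun s =>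
    le_of_tendsto' ((hlim s).sub (hlim t)).abs fun n => hLip _ _ _
  rw [tendsto_iff_dist_tendsto_zero]
  refine squeeze_zero (fun _ => dist_nonneg) hLim ?_
  have : Tendsto (fun s => C * dist s t) (𝓝 t) (𝓝 (C * dist t t)) :=
    Continuous.tendsto (by fun_prop) t
  simpa using this

end Limit

/-! ### The integrated equation, its limit, and conservation of energy. -/

section Limit

variable {φhat φ : ℝ → ℝ} {M : ℝ≥0} {ε : ℝ} {F : ℝ → Measure ℝ≥0}

/-- A conservative family as a curve of finite measures. -/
def Conserves.curve (h : Conserves F) (t : ℝ≥0) : FiniteMeasure ℝ≥0 :=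
  ⟨F t, (h.mem t t.coe_nonneg).finite⟩

theorem Conserves.curve_mem (h : Conserves F) (hM : ∫ x : ℝ≥0, (1 + (x : ℝ)) ∂(F 0) ≤ M) (t : ℝ≥0) :
    h.curve t ∈ momentSet M := by
  have key : ∀ s : ℝ, 0 ≤ s → Integrable (fun x : ℝ≥0 => 1 + (x : ℝ)) (F s) ∧
      ∫ x : ℝ≥0, (1 + (x : ℝ)) ∂(F s) = (F s).real univ + ∫ x : ℝ≥0, (x : ℝ) ∂(F s) := by
    intro s hs
    have := (h.mem s hs).finite
    have hi := (h.mem s hs).moment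
    refine ⟨(integrable_const 1).add hi, ?_⟩
    rw [integral_add (integrable_const 1) hi]
    simp
  obtain ⟨h1, h2⟩ := key t t.coe_nonneg
  refine mem_momentSet h1 ?_
  change ∫ x : ℝ≥0, (1 + (x : ℝ)) ∂(F t) ≤ M
  rwa [h2, measureReal_def, h.mass t t.coe_nonneg, h.energy t t.coe_nonneg, ← measureReal_def,
    ← (key 0 le_rfl).2]

theorem IsAdmissible.exists_rate_bound (h : IsAdmissible φhat) (hφ : IsTestFunction φ) (M : ℝ≥0)
    (ε₀ : ℝ) : ∃ C : ℝ, 0 ≤ C ∧ ∀ ε, ε ∈ Ioc 0 ε₀ → ∀ ν ∈ momentSet M,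
      |integral2 (J φhat ε φ) ν + ε ^ 3 * integral3 (K φhat ε φ) ν| ≤ C := by
  obtain ⟨C, hC, hJ⟩ := h.exists_J_le_moment hφ
  obtain ⟨A, hA, hK⟩ := h.exists_integral3_bound hφ
  refine ⟨C * M ^ 2 + A * M ^ 3 * |ε₀|, by positivity, fun ε hε ν hν => ?_⟩
  refine (abs_add_le _ _).trans (add_le_add (abs_integral2_le hν hC (hJ ε hε.1)) ?_)
  refine (hK ε hε.1 ν inferInstance).trans ?_
  have h1 := measureReal_le_moment hν
  have h2 := hε.1.le
  have h3 : ε ≤ |ε₀| := hε.2.trans (le_abs_self _)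
  gcongr

theorem abs_sub_le_of_hasDerivWithinAt {u D : ℝ → ℝ} {C : ℝ}
    (hu : ∀ t, 0 ≤ t → HasDerivWithinAt u (D t) (Ici 0) t) (hD : ∀ t, 0 ≤ t → |D t| ≤ C) {s t : ℝ}
    (hs : 0 ≤ s) (ht : 0 ≤ t) : |u t - u s| ≤ C * |t - s| :=
  (convex_Ici (0 : ℝ)).norm_image_sub_le_of_norm_hasDerivWithin_le hu hD hs ht

/-- Regularity in time of the collision terms is read off from the C¹ requirement: their sum is the
derivative, hence continuous. -/
theorem IsBESolution.integral_eq (hF : IsBESolution φhat ε F) (hφ : IsTestFunction φ) (t : ℝ≥0) :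
    IntervalIntegrable (fun s => integral2 (J φhat ε φ) (F s) +
      ε ^ 3 * integral3 (K φhat ε φ) (F s)) volume 0 t ∧
    ∫ s in (0 : ℝ)..t, (integral2 (J φhat ε φ) (F s) + ε ^ 3 * integral3 (K φhat ε φ) (F s)) =
      (∫ x : ℝ≥0, φ x ∂(F t)) - ∫ x : ℝ≥0, φ x ∂(F 0) := by
  have ht := t.coe_nonneg
  have hd := hF.equation φ hφ
  have hc : ContinuousOn (fun s => integral2 (J φhat ε φ) (F s) +
      ε ^ 3 * integral3 (K φhat ε φ) (F s)) (Ici 0) :=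
    ((hF.contDiff φ hφ).continuousOn_derivWithin (uniqueDiffOn_Ici 0) le_rfl).congr fun s hs =>
      ((hd s hs).derivWithin (uniqueDiffOn_Ici 0 s hs)).symm
  have hi : IntervalIntegrable (fun s => integral2 (J φhat ε φ) (F s) +
      ε ^ 3 * integral3 (K φhat ε φ) (F s)) volume 0 t :=
    (hc.mono fun s hs => by rw [uIcc_of_le ht] at hs; exact hs.1).intervalIntegrable
  refine ⟨hi, intervalIntegral.integral_eq_sub_of_hasDerivAt_of_le ht
    (fun s hs => ((hd s hs.1).continuousWithinAt).mono Icc_subset_Ici_self)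
    (fun s hs => (hd s hs.1.le).hasDerivAt (Ici_mem_nhds hs.1)) hi⟩

/-- The integrated form of the limit equation. -/
theorem IsAdmissible.limit_equation (h : IsAdmissible φhat) (hφ : IsTestFunction φ) {ε₀ : ℝ}
    {e : ℕ → ℝ} (he : ∀ n, e n ∈ Ioc 0 ε₀) (he0 : Tendsto e atTop (𝓝 0))
    {F : ℕ → ℝ → Measure ℝ≥0} (hF : ∀ n, IsBESolution φhat (e n) (F n))
    (hM : ∀ n t, (hF n).conserves.curve t ∈ momentSet M) {ρ : ℝ≥0 → FiniteMeasure ℝ≥0}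
    (ht : ∀ t, Tendsto (fun n => (hF n).conserves.curve t) atTop (𝓝 (ρ t))) (t : ℝ≥0) :
    ∫ s in (0 : ℝ)..t, integral2 (L φ) (ρ s.toNNReal) =
      (∫ x : ℝ≥0, φ x ∂(ρ t : Measure ℝ≥0)) - ∫ x : ℝ≥0, φ x ∂(ρ 0 : Measure ℝ≥0) := by
  have he' : Tendsto e atTop (𝓝[>] 0) :=
    tendsto_nhdsWithin_iff.2 ⟨he0, Eventually.of_forall fun n => (he n).1⟩
  obtain ⟨C, hC, hrate⟩ := h.exists_rate_bound hφ M ε₀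
  obtain ⟨A, hA, hK⟩ := h.exists_integral3_bound hφ
  have h1 : Tendsto (fun n => (∫ x : ℝ≥0, φ x ∂(F n t)) - ∫ x : ℝ≥0, φ x ∂(F n 0)) atTop
      (𝓝 ((∫ x : ℝ≥0, φ x ∂(ρ t : Measure ℝ≥0)) - ∫ x : ℝ≥0, φ x ∂(ρ 0 : Measure ℝ≥0))) :=
    (hφ.tendsto_integral (ht t)).sub (hφ.tendsto_integral (ht 0))
  have h2 : Tendsto (fun n => ∫ s in (0 : ℝ)..t, (integral2 (J φhat (e n) φ) (F n s) +
      e n ^ 3 * integral3 (K φhat (e n) φ) (F n s))) atTop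
      (𝓝 (∫ s in (0 : ℝ)..t, integral2 (L φ) (ρ s.toNNReal))) := by
    refine intervalIntegral.tendsto_integral_filter_of_dominated_convergence (fun _ => C)
      (Eventually.of_forall fun n => ?_) (Eventually.of_forall fun n => ae_of_all _ fun s hs => ?_)
      intervalIntegrable_const (ae_of_all _ fun s hs => ?_)
    · rw [uIoc_of_le t.coe_nonneg]
      exact ((hF n).integral_eq hφ t).1.1.aestronglyMeasurable
    · rw [uIoc_of_le t.coe_nonneg] at hs
      exact hrate _ (he n) _ (hM n ⟨s, hs.1.le⟩)
    · rw [uIoc_of_le t.coe_nonneg] at hs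
      lift s to ℝ≥0 using hs.1.le
      rw [Real.toNNReal_coe]
      have c1 := h.tendsto_integral2_J hφ he' (fun n => hM n s) (ht s)
      have c2 : Tendsto (fun n => e n ^ 3 * integral3 (K φhat (e n) φ) (F n s)) atTop (𝓝 0) := by
        have : Tendsto (fun n => A * M ^ 3 * e n) atTop (𝓝 0) := by
          simpa using he0.const_mul (A * (M : ℝ) ^ 3)
        refine squeeze_zero_norm (fun n => ?_) this
        refine (hK _ (he n).1 (F n s) ((hF n).conserves.mem s s.coe_nonneg).finite).trans ?_
        have h3 : (F n s).real univ ≤ M := measureReal_le_moment (hM n s)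
        have h4 := (he n).1.le
        gcongr
      have c3 := c1.add c2
      rw [add_zero] at c3
      exact c3
  simp only [fun n => ((hF n).integral_eq hφ t).2] at h2
  exact tendsto_nhds_unique h2 h1

theorem contDiffOn_of_integral_eq {u g : ℝ → ℝ} (hg : Continuous g)
    (hu : ∀ t, 0 ≤ t → u t = u 0 + ∫ s in (0 : ℝ)..t, g s) :
    ContDiffOn ℝ 1 u (Ici 0) ∧ ∀ t, 0 ≤ t → HasDerivWithinAt u (g t) (Ici 0) t := by
  have hd : ∀ t, HasDerivAt (fun t => u 0 + ∫ s in (0 : ℝ)..t, g s) (g t) t := fun t =>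
    (intervalIntegral.integral_hasDerivAt_right (hg.intervalIntegrable _ _)
      (hg.stronglyMeasurableAtFilter _ _) hg.continuousAt).const_add _
  constructor
  · refine ContDiffOn.congr (ContDiff.contDiffOn ?_) hu
    rw [contDiff_one_iff_deriv]
    refine ⟨fun t => (hd t).differentiableAt, ?_⟩
    rwa [funext fun t => (hd t).deriv]
  · exact fun t ht => (hd t).hasDerivWithinAt.congr hu (hu t ht)

/-- Dilation of a test function. -/
theorem IsTestFunction.dilate (hφ : IsTestFunction φ) {R : ℝ} (hR : 0 < R) :
    IsTestFunction (fun x => R * φ (x / R)) ∧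
      ∀ x, 0 ≤ x → d2 (fun x => R * φ (x / R)) x = d2 φ (x / R) / R := by
  have hmaps : MapsTo (fun x : ℝ => x / R) (Ici 0) (Ici 0) := fun x hx => div_nonneg hx hR.le
  have hdiv : ∀ x, HasDerivWithinAt (fun x : ℝ => x / R) (1 / R) (Ici 0) x := fun x =>
    ((hasDerivAt_id x).div_const R).hasDerivWithinAt
  have e1 : ∀ x, 0 ≤ x → d1 (fun x => R * φ (x / R)) x = d1 φ (x / R) := fun x hx => by
    have := ((hφ.hasDeriv_d1 (hmaps hx)).comp x (hdiv x) hmaps).const_mul R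
    refine (HasDerivWithinAt.derivWithin this (uniqueDiffOn_Ici 0 x hx)).trans ?_
    field_simp
  refine ⟨⟨?_, ?_⟩, fun x hx => ?_⟩
  · exact contDiffOn_const.mul (hφ.contDiffOn.comp (by fun_prop) hmaps)
  · obtain ⟨r, hr⟩ := hφ.compactSupport
    refine ⟨r * R, fun x hx => ?_⟩
    rw [hr _ (by rwa [le_div_iff₀ hR]), mul_zero]
  · have := (hφ.hasDeriv_d2 (hmaps hx)).comp x (hdiv x) hmaps
    refine (HasDerivWithinAt.derivWithin (this.congr e1 (e1 x hx))
      (uniqueDiffOn_Ici 0 x hx)).trans ?_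
    field_simp

theorem isTestFunction_truncatedId : IsTestFunction fun x => x * Real.smoothTransition (2 - x) := by
  refine ⟨ContDiff.contDiffOn ?_, 2, fun x hx => ?_⟩
  · exact contDiff_id.mul (Real.smoothTransition.contDiff.comp (by fun_prop))
  · rw [Real.smoothTransition.zero_of_nonpos (by linarith), mul_zero]

/-- A bounded-moment curve obeying the weak equation conserves the energy. -/
theorem energy_conserved {ρ : ℝ≥0 → FiniteMeasure ℝ≥0} (hρ : ∀ t, ρ t ∈ momentSet M)
    (heq : ∀ φ, IsTestFunction φ → ∀ t : ℝ≥0, ∫ s in (0 : ℝ)..t, integral2 (L φ) (ρ s.toNNReal) =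
      (∫ x : ℝ≥0, φ x ∂(ρ t : Measure ℝ≥0)) - ∫ x : ℝ≥0, φ x ∂(ρ 0 : Measure ℝ≥0)) (t : ℝ≥0) :
    ∫ x : ℝ≥0, (x : ℝ) ∂(ρ t : Measure ℝ≥0) = ∫ x : ℝ≥0, (x : ℝ) ∂(ρ 0 : Measure ℝ≥0) := by
  set g : ℝ → ℝ := fun x => x * Real.smoothTransition (2 - x) with hg
  have hgt : IsTestFunction g := isTestFunction_truncatedId
  obtain ⟨B, hB0, hb⟩ := hgt.exists_bound
  have hmom : ∀ t, Integrable (fun x : ℝ≥0 => (x : ℝ)) (ρ t : Measure ℝ≥0) := fun t => by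
    refine (integrable_moment (hρ t)).1.mono' (by fun_prop) (ae_of_all _ fun x => ?_)
    rw [Real.norm_of_nonneg x.coe_nonneg]
    linarith
  have hlim : ∀ t, Tendsto (fun n : ℕ => ∫ x : ℝ≥0, ((n + 1 : ℝ) * g (x / (n + 1 : ℝ)))
      ∂(ρ t : Measure ℝ≥0)) atTop (𝓝 (∫ x : ℝ≥0, (x : ℝ) ∂(ρ t : Measure ℝ≥0))) := by
    intro t
    have hval : ∀ (n : ℕ) (x : ℝ≥0), (n + 1 : ℝ) * g (x / (n + 1 : ℝ)) =
        x * Real.smoothTransition (2 - x / (n + 1 : ℝ)) := fun n x => by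
      simp only [hg]; field_simp
    refine tendsto_integral_of_dominated_convergence (fun x : ℝ≥0 => (x : ℝ)) (fun n => ?_) (hmom t)
      (fun n => ae_of_all _ fun x => ?_) (ae_of_all _ fun x => ?_)
    · exact (continuous_restrict
        (hgt.dilate (R := n + 1) (by positivity)).1.continuousOn).aestronglyMeasurable
    · rw [hval, norm_mul, Real.norm_of_nonneg x.coe_nonneg,
        Real.norm_of_nonneg (Real.smoothTransition.nonneg _)]
      exact mul_le_of_le_one_right x.coe_nonneg (Real.smoothTransition.le_one _)
    · refine tendsto_const_nhds.congr' ?_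
      filter_upwards [eventually_ge_atTop ⌈(x : ℝ)⌉₊] with n hn
      have h1 : (x : ℝ) ≤ n := Nat.ceil_le.1 hn
      have h2 : (x : ℝ) / (n + 1) ≤ 1 := by
        rw [div_le_one (by positivity)]; linarith
      rw [hval, Real.smoothTransition.one_of_one_le (by linarith), mul_one]
  have hpi := Real.pi_pos
  -- The dilates R g(x/R) tend to x while their second derivatives are at most B/R. Since `L` is
  -- bounded linearly in the second derivative, the change of their integrals over [0, t] is O(1/R).
  have hbd : ∀ n : ℕ, ‖(∫ x : ℝ≥0, ((n + 1 : ℝ) * g (x / (n + 1 : ℝ))) ∂(ρ t : Measure ℝ≥0)) -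
      ∫ x : ℝ≥0, ((n + 1 : ℝ) * g (x / (n + 1 : ℝ))) ∂(ρ 0 : Measure ℝ≥0)‖ ≤
      12 * Real.pi * B * M ^ 2 * t * (1 / ((n : ℝ) + 1)) := by
    intro n
    obtain ⟨d1, d2⟩ := hgt.dilate (R := n + 1) (by positivity)
    rw [← heq _ d1 t]
    refine (intervalIntegral.norm_integral_le_of_norm_le_const (C := 12 * Real.pi * (B / (n + 1)) *
      M ^ 2) fun s _ => ?_).trans (le_of_eq ?_)
    · refine abs_integral2_le (hρ _) (by positivity) fun y z hy hz =>
        d1.abs_L_le_moment (fun x hx => ?_) hy hz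
      rw [d2 x hx, abs_div, abs_of_pos (show (0 : ℝ) < n + 1 by positivity)]
      gcongr
      exact (hb _ (by positivity)).2.2
    · rw [sub_zero, abs_of_nonneg t.coe_nonneg]
      ring
  have hz : Tendsto (fun n : ℕ => 12 * Real.pi * B * M ^ 2 * t * (1 / ((n : ℝ) + 1))) atTop
      (𝓝 0) := by
    rw [← mul_zero (12 * Real.pi * B * M ^ 2 * t)]
    exact tendsto_one_div_add_atTop_nhds_zero_nat.const_mul _
  exact sub_eq_zero.1 (tendsto_nhds_unique ((hlim t).sub (hlim 0)) (squeeze_zero_norm hbd hz))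

end Limit

/-! ### From the integrated equation to weak solutions; uniform Lipschitz bound in time. -/

section Limit

variable {φhat : ℝ → ℝ} {M : ℝ≥0} {F : ℝ → Measure ℝ≥0}

/-- A weakly continuous curve with bounded moment and constant mass obeying the integrated equation
is a weak solution of the Fokker–Planck–Landau equation. -/
theorem isFPLSolution_of_integral_eq {ρ : ℝ≥0 → FiniteMeasure ℝ≥0} (hc : Continuous ρ)
    (hρ : ∀ t, ρ t ∈ momentSet M) (hmass : ∀ t, (ρ t).mass = (ρ 0).mass)
    (heq : ∀ φ, IsTestFunction φ → ∀ t : ℝ≥0, ∫ s in (0 : ℝ)..t, integral2 (L φ) (ρ s.toNNReal) =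
      (∫ x : ℝ≥0, φ x ∂(ρ t : Measure ℝ≥0)) - ∫ x : ℝ≥0, φ x ∂(ρ 0 : Measure ℝ≥0)) :
    IsFPLSolution fun t => (ρ t.toNNReal : Measure ℝ≥0) := by
  have key : ∀ φ, IsTestFunction φ →
      ContDiffOn ℝ 1 (fun t : ℝ => ∫ x : ℝ≥0, φ x ∂(ρ t.toNNReal : Measure ℝ≥0)) (Ici 0) ∧
      ∀ t : ℝ, 0 ≤ t → HasDerivWithinAt
        (fun t : ℝ => ∫ x : ℝ≥0, φ x ∂(ρ t.toNNReal : Measure ℝ≥0))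
        (integral2 (L φ) (ρ t.toNNReal)) (Ici 0) t := by
    intro φ hφ
    refine contDiffOn_of_integral_eq (g := fun t => integral2 (L φ) (ρ t.toNNReal)) ?_ fun t ht => ?_
    · have : Continuous fun t : ℝ => ρ t.toNNReal := hc.comp continuous_real_toNNReal
      exact continuous_iff_continuousAt.2 fun t => hφ.tendsto_integral2_L (this.tendsto t)
    · lift t to ℝ≥0 using ht
      rw [heq φ hφ t, Real.toNNReal_coe, Real.toNNReal_zero]
      ring
  refine ⟨⟨fun t _ => ⟨inferInstance, ?_⟩, fun t _ => ?_, fun t _ => ?_⟩,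
    fun φ hφ => (key φ hφ).1, fun φ hφ => (key φ hφ).2⟩
  · refine (integrable_moment (hρ t.toNNReal)).1.mono' (by fun_prop) (ae_of_all _ fun x => ?_)
    rw [Real.norm_of_nonneg x.coe_nonneg]
    linarith
  · simp only [← FiniteMeasure.ennreal_mass, hmass]
  · rw [Real.toNNReal_zero]
    exact energy_conserved hρ heq _

theorem IsAdmissible.exists_lipschitz (h : IsAdmissible φhat) {φ : ℝ → ℝ} (hφ : IsTestFunction φ)
    (M : ℝ≥0) (ε₀ : ℝ) : ∃ C : ℝ, 0 ≤ C ∧ ∀ ε ∈ Ioc 0 ε₀, ∀ F, ∀ hF : IsBESolution φhat ε F,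
      (∀ t, hF.conserves.curve t ∈ momentSet M) → ∀ s t : ℝ≥0,
        |∫ x : ℝ≥0, φ x ∂(F t) - ∫ x : ℝ≥0, φ x ∂(F s)| ≤ C * dist t s := by
  obtain ⟨C, hC, hb⟩ := h.exists_rate_bound hφ M ε₀
  refine ⟨C, hC, fun ε hε F hF hM s t => ?_⟩
  rw [NNReal.dist_eq]
  exact abs_sub_le_of_hasDerivWithinAt (hF.equation φ hφ)
    (fun r hr => hb ε hε _ (hM ⟨r, hr⟩)) s.coe_nonneg t.coe_nonneg

end Limit

end QuantumBoltzmann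

end

/-! ### The main theorem. -/

theorem theorem3
    (φhat : ℝ → ℝ) (hφhat : QuantumBoltzmann.IsAdmissible φhat)
    (ε₀ : ℝ) (hε₀ : 0 < ε₀)
    (Fε : ℝ → ℝ → Measure ℝ≥0)
    (hsol : ∀ ε : ℝ, ε ∈ Ioc 0 ε₀ → QuantumBoltzmann.IsBESolution φhat ε (Fε ε))
    (hbound : ∃ M : ℝ, ∀ ε : ℝ, ε ∈ Ioc 0 ε₀ → ∫ x : ℝ≥0, (1 + (x : ℝ)) ∂(Fε ε 0) ≤ M) :
    (∀ e : ℕ → ℝ, (∀ n, e n ∈ Ioc 0 ε₀) → Tendsto e atTop (𝓝 0) →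
      ∃ k : ℕ → ℕ, StrictMono k ∧ ∃ F : ℝ → Measure ℝ≥0,
        QuantumBoltzmann.IsFPLSolution F ∧
        (∀ G : Measure ℝ≥0, (∀ n, Fε (e n) 0 = G) → F 0 = G) ∧
        (∀ t : ℝ, 0 ≤ t → ∀ ψ : ℝ≥0 → ℝ, Continuous ψ → HasCompactSupport ψ →
          Tendsto (fun n => ∫ x, ψ x ∂(Fε (e (k n)) t)) atTop (𝓝 (∫ x, ψ x ∂(F t)))) ∧
        (∀ t : ℝ, 0 ≤ t → ∀ φ : ℝ → ℝ, QuantumBoltzmann.IsTestFunction φ →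
          Tendsto (fun n => QuantumBoltzmann.integral2
              (QuantumBoltzmann.J φhat (e (k n)) φ) (Fε (e (k n)) t)) atTop
            (𝓝 (QuantumBoltzmann.integral2 (QuantumBoltzmann.L φ) (F t))))) ∧
    (∀ φ : ℝ → ℝ, QuantumBoltzmann.IsTestFunction φ →
      (∃ C : ℝ, ∀ ε : ℝ, ε ∈ Ioc 0 ε₀ → ∀ t : ℝ, 0 ≤ t →
        |ε ^ 3 * QuantumBoltzmann.integral3 (QuantumBoltzmann.K φhat ε φ) (Fε ε t)| ≤ C * ε) ∧
      (∀ t : ℝ, 0 ≤ t →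
        Tendsto (fun ε : ℝ =>
            ε ^ 3 * QuantumBoltzmann.integral3 (QuantumBoltzmann.K φhat ε φ) (Fε ε t))
          (𝓝[>] 0) (𝓝 0))) := by
  obtain ⟨M, hM⟩ := hbound
  have hmem : ∀ ε (hε : ε ∈ Ioc 0 ε₀) (t : ℝ≥0),
      (hsol ε hε).conserves.curve t ∈ QuantumBoltzmann.momentSet M.toNNReal := fun ε hε t =>
    (hsol ε hε).conserves.curve_mem ((hM ε hε).trans (Real.le_coe_toNNReal M)) t
  refine ⟨fun e he he0 => ?_, fun φ hφ => ?_⟩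
  · have hL : ∀ b c : ℕ, ∃ C : ℝ, 0 ≤ C ∧ ∀ n (s t : ℝ≥0),
        |∫ x : ℝ≥0, QuantumBoltzmann.cutoff b c x ∂(Fε (e n) t) -
          ∫ x : ℝ≥0, QuantumBoltzmann.cutoff b c x ∂(Fε (e n) s)| ≤ C * dist t s := fun b c => by
      obtain ⟨C, hC, hb⟩ := hφhat.exists_lipschitz
        (QuantumBoltzmann.isTestFunction_cutoff b c) M.toNNReal ε₀
      exact ⟨C, hC, fun n => hb (e n) (he n) _ (hsol _ (he n)) (hmem _ (he n))⟩
    obtain ⟨k, hk, ρ, hc, hρ⟩ := QuantumBoltzmann.exists_subseq_tendsto_curve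
      (ν := fun n t => (hsol _ (he n)).conserves.curve t) (fun n t => hmem _ (he n) t) hL
    have hek : Tendsto (fun n => e (k n)) atTop (𝓝 0) := he0.comp hk.tendsto_atTop
    have hek' : Tendsto (fun n => e (k n)) atTop (𝓝[>] 0) :=
      tendsto_nhdsWithin_iff.2 ⟨hek, Eventually.of_forall fun n => (he _).1⟩
    -- Convergence of finite measures tests against the constant 1, so no mass escapes to infinity.
    have hmass : ∀ t, (ρ t).mass = (ρ 0).mass := fun t => by
      refine tendsto_nhds_unique (hρ t).2.mass ((hρ 0).2.mass.congr fun n => ?_)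
      have := (hsol _ (he (k n))).conserves.mass t t.coe_nonneg
      exact congrArg ENNReal.toNNReal this.symm
    refine ⟨k, hk, fun t => (ρ t.toNNReal : Measure ℝ≥0),
      QuantumBoltzmann.isFPLSolution_of_integral_eq hc (fun t => (hρ t).1) hmass
        fun φ hφ t => hφhat.limit_equation hφ (fun n => he (k n)) hek
          (fun n => hsol _ (he (k n))) (fun n t => hmem _ (he (k n)) t) (fun t => (hρ t).2) t,
      fun G hG => ?_, fun t ht ψ hψ hψc => ?_, fun t ht φ hφ => ?_⟩
    · have h0 : ∀ n, (hsol _ (he (k n))).conserves.curve 0 =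
          (hsol _ (he (k 0))).conserves.curve 0 := fun n => Subtype.ext ((hG _).trans (hG _).symm)
      have h1 := tendsto_nhds_unique ((hρ 0).2.congr h0) tendsto_const_nhds
      simp only [Real.toNNReal_zero, h1]
      exact hG _
    · lift t to ℝ≥0 using ht
      simp only [Real.toNNReal_coe]
      obtain ⟨C, hC⟩ := hψc.exists_bound_of_continuous hψ
      exact FiniteMeasure.tendsto_iff_forall_integral_tendsto.1 (hρ t).2
        (BoundedContinuousFunction.ofNormedAddCommGroup ψ hψ C hC)
    · lift t to ℝ≥0 using ht
      simp only [Real.toNNReal_coe]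
      exact hφhat.tendsto_integral2_J hφ hek' (fun n => hmem _ (he (k n)) t) (hρ t).2
  · obtain ⟨C, hC, hb⟩ := hφhat.exists_integral3_bound hφ
    have hbd : ∀ ε : ℝ, ε ∈ Ioc 0 ε₀ → ∀ t : ℝ, 0 ≤ t →
        |ε ^ 3 * QuantumBoltzmann.integral3 (QuantumBoltzmann.K φhat ε φ) (Fε ε t)| ≤
          C * M.toNNReal ^ 3 * ε := fun ε hε t ht => by
      refine (hb ε hε.1 _ ((hsol ε hε).conserves.mem t ht).finite).trans ?_
      have h1 : (Fε ε t).real univ ≤ M.toNNReal :=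
        QuantumBoltzmann.measureReal_le_moment (hmem ε hε ⟨t, ht⟩)
      have h2 := hε.1.le
      gcongr
    refine ⟨⟨_, hbd⟩, fun t ht => ?_⟩
    have hlim : Tendsto (fun ε : ℝ => C * (M.toNNReal : ℝ) ^ 3 * ε) (𝓝[>] 0) (𝓝 0) := by
      have : Tendsto (fun ε : ℝ => C * (M.toNNReal : ℝ) ^ 3 * ε) (𝓝 0)
          (𝓝 (C * (M.toNNReal : ℝ) ^ 3 * 0)) := Continuous.tendsto (by fun_prop) 0
      rw [mul_zero] at this
      exact this.mono_left nhdsWithin_le_nhds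
    refine squeeze_zero_norm' ?_ hlim
    filter_upwards [Ioc_mem_nhdsGT hε₀] with ε hε
    exact hbd ε hε t ht
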